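/- Let $n\ge 3$, $2\le\gamma<n$, $\alpha,\beta\ge 0$ and $p_0,q_0>1$ be real numbers ($n$ an integer) with $$\frac{n-1}{n}\,\frac{1}{p_0+1}+\frac{1}{q_0+1}=\frac{n+\alpha+\beta+1-\gamma}{n}.$$ Write $\mathbb{R}^n_+=\{x=(x',x_n)\in\mathbb{R}^{n-1}\times\mathbb{R}: x_n>0\}$, $\partial\mathbb{R}^n_+=\mathbb{R}^{n-1}$, and let $$P(x,\xi,\gamma)=\frac{x_n}{(|x'-\xi|^2+x_n^2)^{\frac{n+2-\gamma}{2}}}\qquad (x\in\mathbb{R}^n_+,\ \xi\in\partial\mathbb{R}^n_+)$$ be the fractional Poisson kernel. Let $u:\partial\mathbb{R}^n_+\to(0,\infty]$ and $v:\mathbb{R}^n_+\to(0,\infty]$ satisfy $(u,v)\in L^{p_0+1}(\partial\mathbb{R}^n_+)\times L^{q_0+1}(\mathbb{R}^n_+)$ and $$u(\xi)=\int_{\mathbb{R}^n_+}|\xi|^{-\alpha}P(x,\xi,\gamma)\,v^{q_0}(x)\,|x|^{-\beta}\,dx\quad\text{for all }\xi\in\partial\mathbb{R}^n_+\setminus\{0\},$$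 $$v(x)=\int_{\partial\mathbb{R}^n_+}|x|^{-\beta}P(x,\xi,\gamma)\,u^{p_0}(\xi)\,|\xi|^{-\alpha}\,d\xi\quad\text{for all }x\in\mathbb{R}^n_+.$$ (i) If $\frac{1}{q_0}-\frac{n+1+\beta-\gamma}{q_0n}>\frac{\beta-1}{n}$, then the integral below is finite and $$\lim_{|\xi|\to0,\ \xi\ne0}u(\xi)|\xi|^{\alpha}=\int_{\mathbb{R}^n_+}\frac{v^{q_0}(x)\,x_n}{|x|^{n+2-\gamma+\beta}}\,dx .$$ (ii) If $\frac{1}{p_0}-\frac{n+2+\alpha-\gamma}{p_0(n-1)}>\frac{\alpha}{n-1}$, then the integral below is finite and $$\lim_{|x|\to0,\ x\in\mathbb{R}^n_+}\frac{v(x)|x|^{\beta}}{x_n}=\int_{\partial\mathbb{R}^n_+}\frac{u^{p_0}(\xi)}{|\xi|^{n+2-\gamma+\alpha}}\,d\xi .$$ -/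

import Mathlib

open MeasureTheory Filter Topology
open scoped ENNReal

/-- The boundary `∂ℝⁿ₊ = ℝⁿ⁻¹`, with its Euclidean norm and Lebesgue measure. -/
abbrev Boundary (n : ℕ) : Type := EuclideanSpace ℝ (Fin (n - 1))

/-- The ambient space `ℝⁿ = ℝⁿ⁻¹ × ℝ`; a point is `x = (x', xₙ)`.  It carries the product topology
and the product Lebesgue measure, which are the usual ones of `ℝⁿ`.  The default norm of the product
is the maximum norm and is never used: `|x|` is `euclNorm x` below. -/
abbrev Ambient (n : ℕ) : Type := Boundary n × ℝ

/-- The Euclidean norm `|x| = (|x'|² + xₙ²)^{1/2}` of `x = (x', xₙ)`. -/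
noncomputable def euclNorm {n : ℕ} (x : Ambient n) : ℝ := √(‖x.1‖ ^ 2 + x.2 ^ 2)

/-- The open upper half space `ℝⁿ₊ = {x : xₙ > 0}`. -/
def upperHalf (n : ℕ) : Set (Ambient n) := {x | 0 < x.2}

/-- The fractional Poisson kernel `P(x, ξ, γ) = xₙ / (|x' - ξ|² + xₙ²)^{(n + 2 - γ) / 2}`. -/
noncomputable def fracPoisson {n : ℕ} (γ : ℝ) (x : Ambient n) (ξ : Boundary n) : ℝ :=
  x.2 / (‖x.1 - ξ‖ ^ 2 + x.2 ^ 2) ^ (((n : ℝ) + 2 - γ) / 2)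

/-- `(u, v) ∈ L^{p₀+1}(∂ℝⁿ₊) × L^{q₀+1}(ℝⁿ₊)` is a pair of positive solutions of the doubly weighted
integral system with the fractional Poisson kernel,
`u(ξ) = ∫_{ℝⁿ₊} |ξ|^{-α} P(x,ξ,γ) v(x)^{q₀} |x|^{-β} dx` and
`v(x) = ∫_{∂ℝⁿ₊} |x|^{-β} P(x,ξ,γ) u(ξ)^{p₀} |ξ|^{-α} dξ`.
The functions take values in `(0, ∞]`, so that a solution may be infinite at some points and finite
solutions are included.  Nothing is required of `u` at the origin, where the weight `|ξ|^{-α}` is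
singular, nor of `v` outside the half space. -/
structure IsPositiveSolution {n : ℕ} (α β γ p₀ q₀ : ℝ)
    (u : Boundary n → ℝ≥0∞) (v : Ambient n → ℝ≥0∞) : Prop where
  memLp_u : MemLp u (ENNReal.ofReal (p₀ + 1)) volume
  memLp_v : MemLp v (ENNReal.ofReal (q₀ + 1)) (volume.restrict (upperHalf n))
  pos_u : ∀ ξ : Boundary n, ξ ≠ 0 → 0 < u ξ
  pos_v : ∀ x ∈ upperHalf n, 0 < v x
  eq_u : ∀ ξ : Boundary n, ξ ≠ 0 →
    u ξ = ∫⁻ x in upperHalf n,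
      ENNReal.ofReal (‖ξ‖ ^ (-α) * fracPoisson γ x ξ * euclNorm x ^ (-β)) * v x ^ q₀
  eq_v : ∀ x ∈ upperHalf n,
    v x = ∫⁻ ξ : Boundary n,
      ENNReal.ofReal (euclNorm x ^ (-β) * fracPoisson γ x ξ * ‖ξ‖ ^ (-α)) * u ξ ^ p₀

/-! Set `A = n/(q₀+1)`, `B = (n-1)/(p₀+1)` and pass to `f = |ξ|^B u`, `g = |x|^A v`. With the
dilation invariant measures `|ξ|^{-(n-1)} dξ` and `|x|^{-n} dx` the system becomes `f = ∫ K g^q`, `g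
= ∫ K f^p`, where `K = xₙ |x|^{δ₁-1} |ξ|^{δ₂} |x-ξ|^{-D}` is homogeneous of degree `0`, `δ₁ = A - β
+ 1`, `δ₂ = B - α` and `δ₁ + δ₂ = D = n + 2 - γ`. The hypotheses on `u` and `v` say that `f ∈
L^{p+1}` and `g ∈ L^{q+1}`. Positivity of `v` forces `u ≳ |ξ|^{-α}` at `0` and `u ≳ |ξ|^{-α-D}` at
infinity; integrability of `u^{p+1}` then gives `δ₂ > 0` and `δ₁ > 0`.

Two properties of `K` are used. It maps pure powers to pure powers: `∫ K |x|^σ ≲ |ξ|^σ` for `-δ₁ < σ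
< δ₂`, and symmetrically in the other variable. And its large values carry little mass: `∫_{K>h} K ≲
h^{1-a}` in `ξ` and `≲ h^{1-b}` in `x`, with exponents that can be tuned so that `a/(p+1) + b/(q+1)
= 1`.

Boundedness (`ae_bounded_of_integral_system`). The tails bound the potentials of the truncated
functions by exactly matching powers of the truncation level. The part of `f(x)` produced by the low
values of `g` is absorbed, and likewise for `g`, with cut-offs `f = η g^κ` that are the same curve
for both equations. Tonelli then compares the energies of `f` and `g` above corresponding levels in
both directions, with a gain of `1/2`, so both vanish.

Decay (`ScaledSystem.exists_decay`). Small energy near the origin makes `f` tend to `0` there. Since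
`p > 1`, the factor `f^{p-1}` is then small, and a weighted supremum argument gives `f ≲ |ξ|^σ`, `g
≲ |x|^σ` for every `0 < σ < min δ₁ δ₂`.

Limits. The hypotheses of (i) and (ii) are exactly `δ₂ < q δ₁` and `δ₁ < p δ₂`, so `σ` can be chosen
with `q σ > δ₂`, respectively `p σ > δ₁`. This makes the limiting integral finite and the
contribution near the moving singularity negligible; elsewhere dominated convergence applies. -/

/-! ### Truncated potentials of kernels with power tails -/

theorem ENNReal.exists_lt_mul_two_inv_pow {k h : ℝ≥0∞} (hk : k ≠ 0) (hkh : k ≤ h) (hh : h ≠ ∞) :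
    ∃ j : ℕ, h * 2⁻¹ ^ j * 2⁻¹ < k ∧ k ≤ h * 2⁻¹ ^ j := by
  have hex : ∃ j : ℕ, h * 2⁻¹ ^ j * 2⁻¹ < k := by
    have h1 : Tendsto (fun j : ℕ => h * 2⁻¹ ^ j * (2⁻¹ : ℝ≥0∞)) atTop (𝓝 (h * 0 * 2⁻¹)) := by
      refine ENNReal.Tendsto.mul_const (ENNReal.Tendsto.const_mul ?_ (Or.inr hh)) (Or.inr (by simp))
      exact ENNReal.tendsto_pow_atTop_nhds_zero_of_lt_one (by simp)
    have h2 : h * 0 * (2⁻¹ : ℝ≥0∞) < k := by simpa using pos_iff_ne_zero.2 hk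
    exact (h1.eventually_lt_const h2).exists
  classical
  refine ⟨Nat.find hex, Nat.find_spec hex, ?_⟩
  rcases hj : Nat.find hex with _ | j
  · simpa using hkh
  · have := Nat.find_min hex (m := j) (by omega)
    rw [not_lt] at this
    rwa [pow_succ, ← mul_assoc]

/-- A tail bound `∫_{k > h} k ≤ C h^{1-a}` controls the higher moments of `k` truncated at `h`. -/
theorem exists_lintegral_rpow_truncated_le {a e : ℝ} (he : 0 < e) (hae : a - 1 < e) :
    ∃ c : ℝ≥0∞, c ≠ ∞ ∧ ∀ {X : Type} [MeasurableSpace X] (μ : Measure X) (k : X → ℝ≥0∞) (C : ℝ≥0∞),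
      Measurable k →
      (∀ h : ℝ≥0∞, h ≠ 0 → h ≠ ∞ → ∫⁻ x in {x | h < k x}, k x ∂μ ≤ C * h ^ (1 - a)) →
      ∀ h : ℝ≥0∞, h ≠ 0 → h ≠ ∞ →
        ∫⁻ x in {x | k x ≤ h}, k x ^ (1 + e) ∂μ ≤ c * C * h ^ (e + 1 - a) := by
  have hw : 0 < e + 1 - a := by linarith
  have hr : (2⁻¹ : ℝ≥0∞) ^ (e + 1 - a) < 1 := ENNReal.rpow_lt_one (by simp) hw
  refine ⟨2⁻¹ ^ (1 - a) * (1 - 2⁻¹ ^ (e + 1 - a))⁻¹, ?_, ?_⟩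
  · refine ENNReal.mul_ne_top (ENNReal.rpow_ne_top_of_ne_zero (by simp) (by simp)) ?_
    simpa [tsub_eq_zero_iff_le] using hr
  intro X _ μ k C hk htail h h0 ht
  -- On the dyadic layer `h 2^{-j-1} < k ≤ h 2^{-j}` one power of `k` is kept and the other `e` are
  -- replaced by the top of the layer. Relaxing the layer to a tail makes the hypothesis applicable;
  -- the resulting series has ratio `2^{-(e+1-a)} < 1`.
  have key : ∀ x ∈ {x | k x ≤ h}, k x ^ (1 + e) ≤
      ∑' j : ℕ, {x | h * 2⁻¹ ^ j * 2⁻¹ < k x}.indicator (fun x => (h * 2⁻¹ ^ j) ^ e * k x) x := by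
    intro x hx
    rcases eq_or_ne (k x) 0 with h0' | h0'
    · rw [h0', ENNReal.zero_rpow_of_pos (by linarith)]; exact zero_le
    obtain ⟨j, hj1, hj2⟩ := ENNReal.exists_lt_mul_two_inv_pow h0' hx ht
    refine le_trans ?_ (ENNReal.le_tsum j)
    rw [Set.indicator_of_mem (by exact hj1), ENNReal.rpow_add_of_nonneg _ _ zero_le_one he.le,
      ENNReal.rpow_one, mul_comm]
    gcongr
  have hms : ∀ t : ℝ≥0∞, MeasurableSet {x | t < k x} := fun t => measurableSet_lt measurable_const hk
  calc ∫⁻ x in {x | k x ≤ h}, k x ^ (1 + e) ∂μ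
      ≤ ∫⁻ x in {x | k x ≤ h}, ∑' j : ℕ, {x | h * 2⁻¹ ^ j * 2⁻¹ < k x}.indicator
          (fun x => (h * 2⁻¹ ^ j) ^ e * k x) x ∂μ :=
        setLIntegral_mono' (measurableSet_le hk measurable_const) key
    _ ≤ ∫⁻ x, ∑' j : ℕ, {x | h * 2⁻¹ ^ j * 2⁻¹ < k x}.indicator
          (fun x => (h * 2⁻¹ ^ j) ^ e * k x) x ∂μ := setLIntegral_le_lintegral _ _
    _ = ∑' j : ℕ, (h * 2⁻¹ ^ j) ^ e * ∫⁻ x in {x | h * 2⁻¹ ^ j * 2⁻¹ < k x}, k x ∂μ := by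
        rw [lintegral_tsum fun j => ((hk.const_mul _).indicator (hms _)).aemeasurable]
        congr 1; ext j
        rw [lintegral_indicator (hms _), lintegral_const_mul _ hk]
    _ ≤ ∑' j : ℕ, (C * h ^ (e + 1 - a) * 2⁻¹ ^ (1 - a)) * (2⁻¹ ^ (e + 1 - a)) ^ j := by
        refine ENNReal.tsum_le_tsum fun j => ?_
        have hj0 : (2⁻¹ : ℝ≥0∞) ^ j ≠ 0 := by simp
        have hjt : (2⁻¹ : ℝ≥0∞) ^ j ≠ ∞ := by simp
        have hH0 : h * 2⁻¹ ^ j ≠ 0 := mul_ne_zero h0 hj0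
        have hHt : h * 2⁻¹ ^ j ≠ ∞ := ENNReal.mul_ne_top ht hjt
        refine (mul_le_mul_right (htail _ (mul_ne_zero hH0 (by simp))
          (ENNReal.mul_ne_top hHt (by simp))) _).trans_eq ?_
        rw [ENNReal.mul_rpow_of_ne_zero hH0 (by simp) (1 - a), mul_left_comm, ← mul_assoc (_ ^ e),
          ← ENNReal.rpow_add _ _ hH0 hHt, ← add_sub_assoc, ENNReal.mul_rpow_of_ne_zero h0 hj0,
          ← ENNReal.rpow_natCast, ← ENNReal.rpow_mul, mul_comm (j : ℝ), ENNReal.rpow_mul,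
          ENNReal.rpow_natCast]
        ring
    _ = _ := by
        rw [ENNReal.tsum_mul_left, ENNReal.tsum_geometric]
        ring

/-- The truncated potential estimate: if `k` has tails `∫_{k > h} k ≤ C h^{1-a}`, then
`∫_{f ≤ S} k f^p` is bounded by a multiple of `S^{(p+1)/a-1}`. -/
theorem exists_lintegral_mul_rpow_truncated_le {a p : ℝ} (ha : 1 ≤ a) (hp : 0 < p)
    (hap : a < p + 1) :
    ∃ c : ℝ≥0∞, c ≠ ∞ ∧ ∀ {X : Type} [MeasurableSpace X] (μ : Measure X) (k f : X → ℝ≥0∞)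
      (C : ℝ≥0∞), Measurable k → Measurable f →
      (∀ h : ℝ≥0∞, h ≠ 0 → h ≠ ∞ → ∫⁻ x in {x | h < k x}, k x ∂μ ≤ C * h ^ (1 - a)) →
      ∀ L S : ℝ≥0∞, L ≠ 0 → L ≠ ∞ → S ≠ 0 → S ≠ ∞ →
        ∫⁻ x in {x | f x ≤ S}, k x * f x ^ p ∂μ ≤
          (c * C * L ^ (1 - a) + L * ∫⁻ x in {x | f x ≤ S}, f x ^ (p + 1) ∂μ) *
            S ^ ((p + 1) / a - 1) := by
  have ha0 : 0 < a := by linarith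
  have hp1 : 0 < p + 1 := by linarith
  -- This `e` satisfies `(f^{(p+1)/a})^e = f^p`, and `a - 1 < e` is the same as `a < p + 1`.
  set e : ℝ := a * p / (p + 1) with he
  have he0 : 0 < e := by positivity
  have hae : a - 1 < e := by rw [he, lt_div_iff₀ hp1]; nlinarith
  have hκ : 0 < (p + 1) / a - 1 := by rw [sub_pos, lt_div_iff₀ ha0]; linarith
  obtain ⟨c, hc, hmom⟩ := exists_lintegral_rpow_truncated_le he0 hae
  refine ⟨1 + c, by simp [hc], ?_⟩
  intro X _ μ k f C hk hf htail L S hL0 hLt hS0 hSt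
  -- The largest value of the threshold `L f^{(p+1)/a}` on `{f ≤ S}`.
  set h : ℝ≥0∞ := L * S ^ ((p + 1) / a) with hh
  have hSa0 : S ^ ((p + 1) / a) ≠ 0 := by simp [ENNReal.rpow_eq_zero_iff, hS0, hSt]
  have hSat : S ^ ((p + 1) / a) ≠ ∞ := ENNReal.rpow_ne_top_of_ne_zero hS0 hSt
  have h0 : h ≠ 0 := mul_ne_zero hL0 hSa0
  have ht : h ≠ ∞ := ENNReal.mul_ne_top hLt hSat
  -- Three regimes. Below the threshold `L f^{(p+1)/a}` the kernel is controlled by `f`, which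
  -- leaves `f^{p+1}`. Above `h` the tail of `k` is used with `f ≤ S`. In between, `f^p ≤ (k/L)^e`
  -- turns the product into a truncated moment of `k`.
  have key : ∀ x ∈ {x | f x ≤ S}, k x * f x ^ p ≤
      L * S ^ ((p + 1) / a - 1) * f x ^ (p + 1) + S ^ p * {x | h < k x}.indicator k x
        + (L ^ e)⁻¹ * {x | k x ≤ h}.indicator (fun x => k x ^ (1 + e)) x := by
    intro x hx
    have hx' : f x ≤ S := hx
    rcases le_or_gt (k x) (L * f x ^ ((p + 1) / a)) with h1 | h1
    · refine le_trans ?_ (le_self_add.trans le_self_add)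
      calc k x * f x ^ p ≤ L * f x ^ ((p + 1) / a) * f x ^ p := by gcongr
        _ = L * f x ^ ((p + 1) / a - 1) * f x ^ (p + 1) := by
          rw [mul_assoc, mul_assoc, ← ENNReal.rpow_add_of_nonneg _ _ (by positivity) hp.le,
            ← ENNReal.rpow_add_of_nonneg _ _ hκ.le hp1.le]
          congr 2; ring
        _ ≤ _ := by gcongr
    · rcases lt_or_ge h (k x) with h2 | h2
      · refine le_trans ?_ (le_add_self.trans le_self_add)
        rw [Set.indicator_of_mem (by exact h2), mul_comm]
        gcongr
      · refine le_trans ?_ le_add_self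
        rw [Set.indicator_of_mem (by exact h2), ENNReal.rpow_add_of_nonneg _ _ zero_le_one he0.le,
          ENNReal.rpow_one, mul_left_comm]
        gcongr
        have h3 : f x ^ p = (f x ^ ((p + 1) / a)) ^ e := by
          rw [← ENNReal.rpow_mul, he]; congr 1; field_simp
        have hLe0 : L ^ e ≠ 0 := by simp [ENNReal.rpow_eq_zero_iff, hL0, hLt]
        have hLet : L ^ e ≠ ∞ := ENNReal.rpow_ne_top_of_ne_zero hL0 hLt
        rw [h3, mul_comm, ← div_eq_mul_inv, ENNReal.le_div_iff_mul_le (Or.inl hLe0) (Or.inl hLet),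
          ← ENNReal.mul_rpow_of_nonneg _ _ he0.le, mul_comm]
        gcongr
  have hms1 : MeasurableSet {x | h < k x} := measurableSet_lt measurable_const hk
  have hms2 : MeasurableSet {x | k x ≤ h} := measurableSet_le hk measurable_const
  have hLS : h ^ (1 - a) * S ^ p = L ^ (1 - a) * S ^ ((p + 1) / a - 1) := by
    rw [hh, ENNReal.mul_rpow_of_ne_zero hL0 hSa0, mul_assoc, ← ENNReal.rpow_mul,
      ← ENNReal.rpow_add _ _ hS0 hSt]
    congr 2; field_simp; ring
  have hLS2 : (L ^ e)⁻¹ * h ^ (e + 1 - a) = L ^ (1 - a) * S ^ ((p + 1) / a - 1) := by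
    rw [hh, ENNReal.mul_rpow_of_ne_zero hL0 hSa0, ← ENNReal.rpow_neg, ← mul_assoc,
      ← ENNReal.rpow_add _ _ hL0 hLt, ← ENNReal.rpow_mul]
    congr 2
    · ring
    · rw [he]; field_simp; ring
  calc ∫⁻ x in {x | f x ≤ S}, k x * f x ^ p ∂μ
      ≤ ∫⁻ x in {x | f x ≤ S}, (L * S ^ ((p + 1) / a - 1) * f x ^ (p + 1)
        + S ^ p * {x | h < k x}.indicator k x
        + (L ^ e)⁻¹ * {x | k x ≤ h}.indicator (fun x => k x ^ (1 + e)) x) ∂μ :=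
        setLIntegral_mono' (measurableSet_le hf measurable_const) key
    _ = L * S ^ ((p + 1) / a - 1) * (∫⁻ x in {x | f x ≤ S}, f x ^ (p + 1) ∂μ)
        + S ^ p * (∫⁻ x in {x | f x ≤ S}, {x | h < k x}.indicator k x ∂μ)
        + (L ^ e)⁻¹ * (∫⁻ x in {x | f x ≤ S}, {x | k x ≤ h}.indicator
          (fun x => k x ^ (1 + e)) x ∂μ) := by
        have m1 := hf.pow_const (p + 1)
        have m2 := hk.indicator hms1
        have m3 := (hk.pow_const (1 + e)).indicator hms2
        rw [lintegral_add_right _ (m3.const_mul _), lintegral_add_right _ (m2.const_mul _),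
          lintegral_const_mul _ m1, lintegral_const_mul _ m2, lintegral_const_mul _ m3]
    _ ≤ L * S ^ ((p + 1) / a - 1) * (∫⁻ x in {x | f x ≤ S}, f x ^ (p + 1) ∂μ)
        + S ^ p * (C * h ^ (1 - a)) + (L ^ e)⁻¹ * (c * C * h ^ (e + 1 - a)) := by
        gcongr
        · refine (setLIntegral_le_lintegral _ _).trans ?_
          rw [lintegral_indicator hms1]; exact htail h h0 ht
        · refine (setLIntegral_le_lintegral _ _).trans ?_
          rw [lintegral_indicator hms2]; exact hmom μ k C hk htail h h0 ht
    _ = L * S ^ ((p + 1) / a - 1) * (∫⁻ x in {x | f x ≤ S}, f x ^ (p + 1) ∂μ)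
        + C * (h ^ (1 - a) * S ^ p) + c * C * ((L ^ e)⁻¹ * h ^ (e + 1 - a)) := by ring
    _ = _ := by rw [hLS, hLS2]; ring

theorem ENNReal.exists_mul_rpow_neg_le {C ε : ℝ≥0∞} {s : ℝ} (hC : C ≠ ∞) (hε : ε ≠ 0) (hs : s < 0) :
    ∃ L : ℝ≥0∞, L ≠ 0 ∧ L ≠ ∞ ∧ C * L ^ s ≤ ε := by
  have h1 : Tendsto (fun n : ℕ => ((n : ℝ≥0∞) + 1)⁻¹) atTop (𝓝 0) := by
    have := (ENNReal.tendsto_inv_nat_nhds_zero).comp (tendsto_add_atTop_nat 1)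
    refine this.congr fun n => ?_
    simp
  have h2 : Tendsto (fun n : ℕ => C * (((n : ℝ≥0∞) + 1)⁻¹) ^ (-s)) atTop (𝓝 (C * 0)) := by
    refine ENNReal.Tendsto.const_mul ?_ (Or.inr hC)
    have := h1.ennrpow_const (-s)
    rwa [ENNReal.zero_rpow_of_pos (by linarith)] at this
  rw [mul_zero] at h2
  obtain ⟨n, hn⟩ := (h2.eventually_lt_const (pos_iff_ne_zero.2 hε)).exists
  refine ⟨(n : ℝ≥0∞) + 1, by simp, by simp, ?_⟩
  rw [ENNReal.inv_rpow, ← ENNReal.rpow_neg, neg_neg] at hn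
  exact hn.le

theorem exists_setLIntegral_gt_le {X : Type} [MeasurableSpace X] {μ : Measure X} {g : X → ℝ≥0∞}
    {r : ℝ} (hr : 0 < r) (hg : Measurable g) (hgr : ∫⁻ x, g x ^ r ∂μ ≠ ∞) {ε : ℝ≥0∞} (hε : ε ≠ 0) :
    ∃ t : ℝ≥0∞, t ≠ 0 ∧ t ≠ ∞ ∧ ∫⁻ x in {x | t < g x}, g x ^ r ∂μ ≤ ε := by
  have hfin : ∀ᵐ x ∂μ, g x < ∞ := by
    filter_upwards [ae_lt_top (hg.pow_const r) hgr] with x hx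
    exact (ENNReal.rpow_lt_top_iff_of_pos hr).1 hx
  have hms : ∀ t : ℝ≥0∞, MeasurableSet {x | t < g x} := fun t => measurableSet_lt measurable_const hg
  have h1 : Tendsto (fun n : ℕ => ∫⁻ x, {x | (n : ℝ≥0∞) + 1 < g x}.indicator (fun x => g x ^ r) x ∂μ)
      atTop (𝓝 (∫⁻ _, 0 ∂μ)) := by
    refine tendsto_lintegral_of_dominated_convergence (fun x => g x ^ r)
      (fun n => (hg.pow_const r).indicator (hms _)) (fun n => ae_of_all _ fun x =>
        Set.indicator_le_self _ _ _) hgr ?_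
    filter_upwards [hfin] with x hx
    obtain ⟨N, hN⟩ := ENNReal.exists_nat_gt hx.ne
    refine tendsto_const_nhds.congr' ?_
    filter_upwards [eventually_ge_atTop N] with n hn
    rw [Set.indicator_of_notMem]
    simp only [Set.mem_ofPred_eq, not_lt]
    exact hN.le.trans ((Nat.cast_le.2 hn).trans le_self_add)
  rw [lintegral_zero] at h1
  obtain ⟨n, hn⟩ := (h1.eventually_lt_const (pos_iff_ne_zero.2 hε)).exists
  refine ⟨(n : ℝ≥0∞) + 1, by simp, by simp, ?_⟩
  rw [lintegral_indicator (hms _)] at hn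
  exact hn.le

/-- The constant can be made as small as desired at high truncation levels, uniformly in the kernel.
Because `b > 1`, a large `L` kills the tail term; the energy of `g` above a high level `t` is small
even after multiplication by `L`; and the part `g ≤ t` contributes a fixed amount, dominated by any
positive power of a large `T`. -/
theorem exists_forall_truncated_le {Y : Type} [MeasurableSpace Y] {ν : Measure Y} {ι : Type}
    {k : ι → Y → ℝ≥0∞} {g : Y → ℝ≥0∞} {b q : ℝ} {C : ℝ≥0∞} (hb : 1 < b) (hq : 0 < q)
    (hbq : b < q + 1) (hC : C ≠ ∞) (hk : ∀ i, Measurable (k i)) (hg : Measurable g)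
    (htail : ∀ i, ∀ h : ℝ≥0∞, h ≠ 0 → h ≠ ∞ → ∫⁻ x in {x | h < k i x}, k i x ∂ν ≤ C * h ^ (1 - b))
    (hgq : ∫⁻ x, g x ^ (q + 1) ∂ν ≠ ∞) {ε : ℝ≥0∞} (hε : ε ≠ 0) :
    ∃ T₀ : ℝ≥0∞, T₀ ≠ 0 ∧ T₀ ≠ ∞ ∧ ∀ i, ∀ T : ℝ≥0∞, T₀ ≤ T → T ≠ ∞ →
      ∫⁻ x in {x | g x ≤ T}, k i x * g x ^ q ∂ν ≤ ε * T ^ ((q + 1) / b - 1) := by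
  have hb0 : 0 < b := by linarith
  have hκ : 0 < (q + 1) / b - 1 := by rw [sub_pos, lt_div_iff₀ hb0]; linarith
  obtain ⟨c, hc, htr⟩ := exists_lintegral_mul_rpow_truncated_le hb.le hq hbq
  have hε3 : ε / 3 ≠ 0 := by simp [ENNReal.div_eq_zero_iff, hε]
  obtain ⟨L, hL0, hLt, hL⟩ := ENNReal.exists_mul_rpow_neg_le (C := c * C) (s := 1 - b)
    (ENNReal.mul_ne_top hc hC) hε3 (by linarith)
  obtain ⟨t, ht0, htt, ht⟩ := exists_setLIntegral_gt_le (μ := ν) (by linarith) hg hgq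
    (ε := ε / 3 / L) (by simp [ENNReal.div_eq_zero_iff, hε, hLt])
  -- Bound for the contribution of `{g ≤ t}`, from the truncated estimate with `L = 1`; it does not
  -- depend on `T`.
  set M : ℝ≥0∞ := (c * C * 1 ^ (1 - b) + 1 * ∫⁻ x, g x ^ (q + 1) ∂ν) * t ^ ((q + 1) / b - 1) with hM
  have hMt : M ≠ ∞ := by
    refine ENNReal.mul_ne_top ?_ (ENNReal.rpow_ne_top_of_nonneg hκ.le htt)
    simp [ENNReal.mul_ne_top hc hC, hgq]
  obtain ⟨T₁, hT0, hTt, hT⟩ := ENNReal.exists_mul_rpow_neg_le hMt hε3 (neg_neg_of_pos hκ)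
  have hT' : M ≤ ε / 3 * T₁ ^ ((q + 1) / b - 1) := by
    rw [ENNReal.rpow_neg, ← div_eq_mul_inv] at hT
    exact (ENNReal.div_le_iff (by simp [ENNReal.rpow_eq_zero_iff, hT0, hTt])
      (ENNReal.rpow_ne_top_of_nonneg hκ.le hTt)).1 hT
  refine ⟨T₁, hT0, hTt, fun i T hT₀ hTT => ?_⟩
  have hTn0 : T ≠ 0 := fun h => hT0 (le_antisymm (h ▸ hT₀) zero_le)
  have hms : MeasurableSet {x | t < g x} := measurableSet_lt measurable_const hg
  set g₁ : Y → ℝ≥0∞ := {x | t < g x}.indicator g with hg₁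
  have hg₁m : Measurable g₁ := hg.indicator hms
  have h1 : ∫⁻ x in {x | g x ≤ t}, k i x * g x ^ q ∂ν ≤ M := by
    refine (htr ν (k i) g C (hk i) hg (htail i) 1 t (by simp) (by simp) ht0 htt).trans ?_
    rw [hM]
    gcongr
    exact Measure.restrict_le_self
  have h2 : ∫⁻ x in {x | g₁ x ≤ T}, k i x * g₁ x ^ q ∂ν
      ≤ (ε / 3 + ε / 3) * T ^ ((q + 1) / b - 1) := by
    refine (htr ν (k i) g₁ C (hk i) hg₁m (htail i) L T hL0 hLt hTn0 hTT).trans ?_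
    gcongr
    have h3 : ∫⁻ x in {x | g₁ x ≤ T}, g₁ x ^ (q + 1) ∂ν ≤ ε / 3 / L := by
      refine le_trans ((setLIntegral_le_lintegral _ _).trans ?_) ht
      rw [← lintegral_indicator hms]
      refine lintegral_mono fun x => ?_
      by_cases hx : x ∈ {x | t < g x}
      · simp [hg₁, hx]
      · simp [hg₁, hx, show 0 < q + 1 by linarith]
    calc L * _ ≤ L * (ε / 3 / L) := by gcongr
      _ = ε / 3 := ENNReal.mul_div_cancel hL0 hLt
  calc ∫⁻ x in {x | g x ≤ T}, k i x * g x ^ q ∂ν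
      ≤ ∫⁻ x in {x | g x ≤ t} ∪ {x | t < g x ∧ g x ≤ T}, k i x * g x ^ q ∂ν := by
        refine lintegral_mono_set fun x hx => ?_
        rcases le_or_gt (g x) t with h | h
        · exact Or.inl h
        · exact Or.inr ⟨h, hx⟩
    _ ≤ ∫⁻ x in {x | g x ≤ t}, k i x * g x ^ q ∂ν
        + ∫⁻ x in {x | t < g x ∧ g x ≤ T}, k i x * g x ^ q ∂ν := lintegral_union_le _ _ _
    _ ≤ M + (ε / 3 + ε / 3) * T ^ ((q + 1) / b - 1) := by
        refine add_le_add h1 (le_trans ?_ h2)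
        have hm2 : MeasurableSet {x | t < g x ∧ g x ≤ T} :=
          hms.inter (measurableSet_le hg measurable_const)
        refine le_trans (setLIntegral_mono' (g := fun x => k i x * g₁ x ^ q) hm2 fun x hx => ?_)
          (lintegral_mono_set fun x hx => ?_)
        · rw [hg₁, Set.indicator_of_mem (by exact hx.1)]
        · simp only [Set.mem_ofPred_eq, hg₁]
          rw [Set.indicator_of_mem (by exact hx.1)]; exact hx.2
    _ ≤ ε / 3 * T ^ ((q + 1) / b - 1) + (ε / 3 + ε / 3) * T ^ ((q + 1) / b - 1) := by
        gcongr
        exact hT'.trans (by gcongr)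
    _ = _ := by
        rw [← add_mul, ← add_assoc, ENNReal.add_thirds]

/-! ### Boundedness of finite energy solutions -/

/-- Tonelli for an inner domain that moves with the outer variable; it serves both energy
comparisons. -/
theorem lintegral_mul_lintegral_swap {X Y : Type} [MeasurableSpace X] [MeasurableSpace Y]
    {μ : Measure X} {ν : Measure Y} [SFinite μ] [SFinite ν] {K : Y → X → ℝ≥0∞}
    (hK : Measurable (Function.uncurry K)) {F : X → ℝ≥0∞} {G : Y → ℝ≥0∞} (hF : Measurable F)
    (hG : Measurable G) {A : Set X} {B : X → Set Y} (hA : MeasurableSet A)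
    (hB : MeasurableSet {z : X × Y | z.2 ∈ B z.1}) :
    ∫⁻ x in A, F x * ∫⁻ y in B x, K y x * G y ∂ν ∂μ =
      ∫⁻ y, G y * ∫⁻ x in {x | x ∈ A ∧ y ∈ B x}, K y x * F x ∂μ ∂ν := by
  have hB1 : ∀ x, MeasurableSet (B x) := fun x => hB.preimage measurable_prodMk_left
  have hB2 : ∀ y, MeasurableSet {x | x ∈ A ∧ y ∈ B x} := fun y =>
    hA.inter (hB.preimage measurable_prodMk_right)
  have hS : MeasurableSet {z : X × Y | z.1 ∈ A ∧ z.2 ∈ B z.1} :=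
    (hA.preimage measurable_fst).inter hB
  have hK1 : ∀ x, Measurable fun y => K y x := fun x => hK.comp measurable_prodMk_right
  have hK2 : ∀ y, Measurable fun x => K y x := fun y => hK.comp measurable_prodMk_left
  have hKG : ∀ x, Measurable fun y => K y x * G y := fun x => (hK1 x).mul hG
  have hKF : ∀ y, Measurable fun x => K y x * F x := fun y => (hK2 y).mul hF
  have hK' : Measurable fun z : X × Y => K z.2 z.1 := hK.comp measurable_swap
  have e1 : ∫⁻ x in A, F x * ∫⁻ y in B x, K y x * G y ∂ν ∂μ =
      ∫⁻ x, ∫⁻ y, {z : X × Y | z.1 ∈ A ∧ z.2 ∈ B z.1}.indicator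
        (fun z => F z.1 * (K z.2 z.1 * G z.2)) (x, y) ∂ν ∂μ := by
    rw [← lintegral_indicator hA]
    refine lintegral_congr fun x => ?_
    by_cases hx : x ∈ A
    · rw [Set.indicator_of_mem hx, ← lintegral_const_mul _ (hKG x),
        ← lintegral_indicator (hB1 x)]
      refine lintegral_congr fun y => ?_
      by_cases hy : y ∈ B x <;> simp [hx, hy]
    · simp [hx]
  rw [e1, lintegral_lintegral_swap]
  · refine lintegral_congr fun y => ?_
    rw [← lintegral_const_mul _ (hKF y), ← lintegral_indicator (hB2 y)]
    refine lintegral_congr fun x => ?_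
    by_cases hx : x ∈ A <;> by_cases hy : y ∈ B x <;> simp [hx, hy, mul_comm, mul_left_comm]
  · exact (((hF.comp measurable_fst).mul (hK'.mul (hG.comp measurable_snd))).indicator
      hS).aemeasurable

theorem ENNReal.le_two_mul_of_le_half_add {a r : ℝ≥0∞} (ha : a ≠ ∞) (h : a ≤ a / 2 + r) :
    a ≤ 2 * r := by
  have h1 : a / 2 + a / 2 ≤ a / 2 + r := by rwa [ENNReal.add_halves]
  have h2 : a / 2 ≤ r := (ENNReal.add_le_add_iff_left (ENNReal.div_ne_top ha (by simp))).1 h1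
  calc a = a / 2 + a / 2 := (ENNReal.add_halves a).symm
    _ ≤ r + r := add_le_add h2 h2
    _ = 2 * r := (two_mul r).symm

theorem ae_le_of_setLIntegral_rpow_eq_zero {X : Type} [MeasurableSpace X] {μ : Measure X}
    {f : X → ℝ≥0∞} {r : ℝ} (hr : 0 < r) (hf : Measurable f) {s : ℝ≥0∞}
    (h : ∫⁻ x in {x | s < f x}, f x ^ r ∂μ = 0) : ∀ᵐ x ∂μ, f x ≤ s := by
  have h1 := (lintegral_eq_zero_iff (hf.pow_const r)).1 h
  have h2 := (ae_restrict_iff' (measurableSet_lt measurable_const hf)).1 h1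
  filter_upwards [h2] with x hx
  by_contra hlt
  rw [not_le] at hlt
  have := hx hlt
  simp only [Pi.zero_apply, ENNReal.rpow_eq_zero_iff_of_pos hr] at this
  rw [this] at hlt
  exact not_lt_zero hlt

/-- Finite energy solutions of the system `f = ∫ K g^q`, `g = ∫ K f^p` are bounded, if the kernel
has tails of critical size `h^{1-a}`, `h^{1-b}` in the two variables. -/
theorem ae_bounded_of_integral_system {X Y : Type} [MeasurableSpace X] [MeasurableSpace Y]
    {μ : Measure X} {ν : Measure Y} [SFinite μ] [SFinite ν] {K : Y → X → ℝ≥0∞}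
    (hK : Measurable (Function.uncurry K)) {f : X → ℝ≥0∞} {g : Y → ℝ≥0∞} (hf : Measurable f)
    (hg : Measurable g) {a b p q : ℝ} (ha : 1 ≤ a) (hb : 1 < b) (hp : 0 < p) (hq : 0 < q)
    (hab : a / (p + 1) + b / (q + 1) = 1) {C : ℝ≥0∞} (hC : C ≠ ∞)
    (hrow : ∀ y, ∀ h : ℝ≥0∞, h ≠ 0 → h ≠ ∞ → ∫⁻ x in {x | h < K y x}, K y x ∂μ ≤ C * h ^ (1 - a))
    (hcol : ∀ x, ∀ h : ℝ≥0∞, h ≠ 0 → h ≠ ∞ → ∫⁻ y in {y | h < K y x}, K y x ∂ν ≤ C * h ^ (1 - b))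
    (hfe : ∀ᵐ x ∂μ, f x = ∫⁻ y, K y x * g y ^ q ∂ν)
    (hge : ∀ᵐ y ∂ν, g y = ∫⁻ x, K y x * f x ^ p ∂μ)
    (hfp : ∫⁻ x, f x ^ (p + 1) ∂μ ≠ ∞) (hgq : ∫⁻ y, g y ^ (q + 1) ∂ν ≠ ∞) :
    ∃ M : ℝ≥0∞, M ≠ ∞ ∧ (∀ᵐ x ∂μ, f x ≤ M) ∧ ∀ᵐ y ∂ν, g y ≤ M := by
  have ha0 : 0 < a := by linarith
  have hb0 : 0 < b := by linarith
  have hp1 : 0 < p + 1 := by linarith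
  have hq1 : 0 < q + 1 := by linarith
  have hap : a < p + 1 := by
    have : 0 < b / (q + 1) := by positivity
    rw [← div_lt_one hp1]; linarith
  have hbq : b < q + 1 := by
    have : 0 < a / (p + 1) := by positivity
    rw [← div_lt_one hq1]; linarith
  set κ : ℝ := (q + 1) / b - 1 with hκdef
  set κ' : ℝ := (p + 1) / a - 1 with hκ'def
  have hκ : 0 < κ := by rw [hκdef, sub_pos, lt_div_iff₀ hb0]; linarith
  have hκ' : 0 < κ' := by rw [hκ'def, sub_pos, lt_div_iff₀ ha0]; linarith
  -- The critical relation `hab` is equivalent to `(p+1-a)(q+1-b) = ab`. Hence `S = η T^κ` and `T =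
  -- (S/η)^{κ'}` are inverse to each other, and one curve serves as cut-off in both equations.
  have hκκ : κ' * κ = 1 := by
    rw [hκdef, hκ'def]; field_simp at hab ⊢; linarith
  have hK1 : ∀ x, Measurable fun y => K y x := fun x => hK.comp measurable_prodMk_right
  have hK2 : ∀ y, Measurable fun x => K y x := fun y => hK.comp measurable_prodMk_left
  have hff : ∀ᵐ x ∂μ, f x < ∞ := by
    filter_upwards [ae_lt_top (hf.pow_const _) hfp] with x hx
    exact (ENNReal.rpow_lt_top_iff_of_pos hp1).1 hx
  have hgf : ∀ᵐ x ∂ν, g x < ∞ := by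
    filter_upwards [ae_lt_top (hg.pow_const _) hgq] with x hx
    exact (ENNReal.rpow_lt_top_iff_of_pos hq1).1 hx
  -- the two truncated estimates
  obtain ⟨c, hc, htr⟩ := exists_lintegral_mul_rpow_truncated_le ha hp hap
  set C₁ : ℝ≥0∞ := c * C * 1 ^ (1 - a) + 1 * ∫⁻ x, f x ^ (p + 1) ∂μ with hC₁
  have hC₁t : C₁ ≠ ∞ := by simp [hC₁, ENNReal.mul_ne_top hc hC, hfp]
  have hT₁ : ∀ y, ∀ S : ℝ≥0∞, S ≠ 0 → S ≠ ∞ →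
      ∫⁻ x in {x | f x ≤ S}, K y x * f x ^ p ∂μ ≤ C₁ * S ^ κ' := by
    intro y S h0 ht
    refine (htr μ (K y) f C (hK2 y) hf (hrow y) 1 S (by simp) (by simp) h0 ht).trans ?_
    rw [hC₁]
    gcongr
    exact Measure.restrict_le_self
  -- `η = L⁻¹` is so small that the part of `g y` coming from `f ≤ η g(y)^κ` is at most `g y / 2`.
  obtain ⟨L, hL0, hLt, hL⟩ := ENNReal.exists_mul_rpow_neg_le (C := C₁) (ε := 2⁻¹) (s := -κ')
    hC₁t (by simp) (by linarith)
  set η : ℝ≥0∞ := L⁻¹ with hη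
  have hη0 : η ≠ 0 := by simp [hη, hLt]
  have hηt : η ≠ ∞ := by simp [hη, hL0]
  have hηC : C₁ * η ^ κ' ≤ 2⁻¹ := by
    rwa [hη, ENNReal.inv_rpow, ← ENNReal.rpow_neg]
  -- With `η/8`, the part of `f x` coming from `g ≤ (f(x)/η)^{κ'}` is at most `f x / 8`. This is
  -- enough for absorption, and after the factor `2` of the absorption it still leaves a constant
  -- below `1/2`. This is where the strict inequality `b > 1` enters.
  obtain ⟨t, ht0, htt, hT₂⟩ := exists_forall_truncated_le (ν := ν) (k := fun x y => K y x) hb hq hbq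
    hC hK1 hg hcol hgq (ε := η / 8) (by simp [ENNReal.div_eq_zero_iff, hη0])
  simp only [← hκdef] at hT₂
  set s : ℝ≥0∞ := η * t ^ κ with hs
  have hpow : ∀ z : ℝ≥0∞, (z ^ κ) ^ κ' = z := fun z => by
    rw [← ENNReal.rpow_mul, mul_comm, hκκ, ENNReal.rpow_one]
  have hpow' : ∀ z : ℝ≥0∞, (z ^ κ') ^ κ = z := fun z => by
    rw [← ENNReal.rpow_mul, hκκ, ENNReal.rpow_one]
  have hlev : ∀ z w : ℝ≥0∞, (z / η) ^ κ' < w ↔ z < η * w ^ κ := fun z w => by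
    rw [← ENNReal.rpow_lt_rpow_iff hκ, hpow', ENNReal.div_lt_iff (Or.inl hη0) (Or.inl hηt), mul_comm]
  have hlev' : ∀ z w : ℝ≥0∞, η * w ^ κ < z ↔ w < (z / η) ^ κ' := fun z w => by
    rw [← ENNReal.rpow_lt_rpow_iff (x := w) hκ, hpow',
      ENNReal.lt_div_iff_mul_lt (Or.inl hη0) (Or.inl hηt), mul_comm]
  have hη8 : ∀ z : ℝ≥0∞, η / 8 * (z / η) = z / 8 := fun z => by
    rw [div_eq_mul_inv, div_eq_mul_inv, div_eq_mul_inv,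
      show η * 8⁻¹ * (z * η⁻¹) = z * 8⁻¹ * (η * η⁻¹) by ring, ENNReal.mul_inv_cancel hη0 hηt, mul_one]
  have hmsf : MeasurableSet {x | s < f x} := measurableSet_lt measurable_const hf
  have hmsg : MeasurableSet {x | t < g x} := measurableSet_lt measurable_const hg
  set I : ℝ≥0∞ := ∫⁻ x in {x | s < f x}, f x ^ (p + 1) ∂μ with hI
  set J : ℝ≥0∞ := ∫⁻ y in {y | t < g y}, g y ^ (q + 1) ∂ν with hJ
  have hIt : I ≠ ∞ := ne_top_of_le_ne_top hfp (setLIntegral_le_lintegral _ _)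
  -- above the levels the truncated parts are absorbed
  have hIJ : I ≤ J := by
    have h1 : I ≤ ∫⁻ x in {x | s < f x}, 2 * f x ^ p *
        ∫⁻ y in {y | (f x / η) ^ κ' < g y}, K y x * g y ^ q ∂ν ∂μ := by
      refine lintegral_mono_ae ((ae_restrict_iff' hmsf).2 ?_)
      filter_upwards [hfe, hff] with x hx hxt hsx
      have hsx' : t < (f x / η) ^ κ' := (hlev' _ _).1 hsx
      have hTt : (f x / η) ^ κ' ≠ ∞ :=
        ENNReal.rpow_ne_top_of_nonneg hκ'.le (ENNReal.div_ne_top hxt.ne hη0)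
      have h2 := hT₂ x _ hsx'.le hTt
      rw [hpow', hη8] at h2
      have h3 : f x ≤ f x / 2 + ∫⁻ y in {y | (f x / η) ^ κ' < g y}, K y x * g y ^ q ∂ν := by
        have hm : MeasurableSet {y | g y ≤ (f x / η) ^ κ'} := measurableSet_le hg measurable_const
        conv_lhs => rw [hx, ← lintegral_add_compl _ hm]
        have hcompl : {y | g y ≤ (f x / η) ^ κ'}ᶜ = {y | (f x / η) ^ κ' < g y} := by
          ext y; simp
        rw [hcompl]
        refine add_le_add (h2.trans ?_) le_rfl
        gcongr
        norm_num
      have h4 := ENNReal.le_two_mul_of_le_half_add hxt.ne h3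
      rw [ENNReal.rpow_add_of_nonneg _ _ hp.le zero_le_one, ENNReal.rpow_one, mul_comm 2, mul_assoc]
      gcongr
    -- After the swap the inner integral runs over `f < η g(y)^κ`, precisely where the truncated
    -- estimate bounds it by `g y`.
    refine h1.trans ?_
    rw [lintegral_mul_lintegral_swap (F := fun x => 2 * f x ^ p) (G := fun y => g y ^ q) hK
      ((hf.pow_const p).const_mul 2) (hg.pow_const q) hmsf (measurableSet_lt
      (((hf.comp measurable_fst).div_const η).pow_const κ') (hg.comp measurable_snd)),
      hJ, ← lintegral_indicator hmsg]
    refine lintegral_mono_ae ?_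
    filter_upwards [hgf] with y hgy
    by_cases hy : t < g y
    · rw [Set.indicator_of_mem (by exact hy)]
      have hS0 : η * g y ^ κ ≠ 0 := mul_ne_zero hη0
        (by simp [ENNReal.rpow_eq_zero_iff, (zero_le.trans_lt hy).ne', hgy.ne])
      have hSt : η * g y ^ κ ≠ ∞ :=
        ENNReal.mul_ne_top hηt (ENNReal.rpow_ne_top_of_nonneg hκ.le hgy.ne)
      have h2 : ∫⁻ x in {x | x ∈ {x | s < f x} ∧ y ∈ {y | (f x / η) ^ κ' < g y}},
          K y x * (2 * f x ^ p) ∂μ ≤ g y := by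
        calc _ ≤ ∫⁻ x in {x | f x ≤ η * g y ^ κ}, K y x * (2 * f x ^ p) ∂μ :=
              lintegral_mono_set fun x hx => ((hlev _ _).1 hx.2).le
          _ = 2 * ∫⁻ x in {x | f x ≤ η * g y ^ κ}, K y x * f x ^ p ∂μ := by
              have hm : Measurable fun x => K y x * f x ^ p := (hK2 y).mul (hf.pow_const p)
              rw [← lintegral_const_mul _ hm]
              exact lintegral_congr fun x => by ring
          _ ≤ 2 * (C₁ * (η * g y ^ κ) ^ κ') := by
              gcongr
              exact hT₁ y _ hS0 hSt
          _ = 2 * (C₁ * η ^ κ') * g y := by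
              rw [ENNReal.mul_rpow_of_nonneg _ _ hκ'.le, hpow]; ring
          _ ≤ 2 * 2⁻¹ * g y := by gcongr
          _ = g y := by rw [ENNReal.mul_inv_cancel (by simp) (by simp), one_mul]
      rw [ENNReal.rpow_add_of_nonneg _ _ hq.le zero_le_one, ENNReal.rpow_one]
      exact mul_le_mul_right h2 _
    -- The levels `s = η t^κ` and `t` correspond, so `f > s` and `(f/η)^{κ'} < g` together force `g
    -- > t`.
    · have : {x | s < f x ∧ (f x / η) ^ κ' < g y} = ∅ := by
        ext x
        simp only [Set.mem_ofPred_eq, Set.mem_empty_iff_false, iff_false, not_and]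
        intro h1 h2
        exact hy (((hlev' _ _).1 h1).trans h2)
      rw [this]; simp
  -- The same comparison with the roles exchanged. The smaller constant `η/8` now yields a genuine
  -- gain.
  have hJI : J ≤ I / 2 := by
    have h1 : J ≤ ∫⁻ y in {y | t < g y}, 2 * g y ^ q *
        ∫⁻ x in {x | η * g y ^ κ < f x}, K y x * f x ^ p ∂μ ∂ν := by
      refine lintegral_mono_ae ((ae_restrict_iff' hmsg).2 ?_)
      filter_upwards [hge, hgf] with y hy hyt hty
      have hS0 : η * g y ^ κ ≠ 0 := mul_ne_zero hη0
        (by simp [ENNReal.rpow_eq_zero_iff, (zero_le.trans_lt hty).ne', hyt.ne])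
      have hSt : η * g y ^ κ ≠ ∞ :=
        ENNReal.mul_ne_top hηt (ENNReal.rpow_ne_top_of_nonneg hκ.le hyt.ne)
      have h2 := hT₁ y _ hS0 hSt
      have h3 : g y ≤ g y / 2 + ∫⁻ x in {x | η * g y ^ κ < f x}, K y x * f x ^ p ∂μ := by
        have hm : MeasurableSet {x | f x ≤ η * g y ^ κ} := measurableSet_le hf measurable_const
        conv_lhs => rw [hy, ← lintegral_add_compl _ hm]
        have hcompl : {x | f x ≤ η * g y ^ κ}ᶜ = {x | η * g y ^ κ < f x} := by
          ext x; simp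
        rw [hcompl]
        refine add_le_add (h2.trans ?_) le_rfl
        rw [ENNReal.mul_rpow_of_nonneg _ _ hκ'.le, hpow, ← mul_assoc, ENNReal.div_eq_inv_mul]
        gcongr
      have h4 := ENNReal.le_two_mul_of_le_half_add hyt.ne h3
      rw [ENNReal.rpow_add_of_nonneg _ _ hq.le zero_le_one, ENNReal.rpow_one, mul_comm 2, mul_assoc]
      gcongr
    refine h1.trans ?_
    rw [lintegral_mul_lintegral_swap (K := fun x y => K y x) (F := fun y => 2 * g y ^ q)
      (G := fun x => f x ^ p) (hK.comp measurable_swap)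
      ((hg.pow_const q).const_mul 2) (hf.pow_const p) hmsg (measurableSet_lt
      (((hg.comp measurable_fst).pow_const κ).const_mul η) (hf.comp measurable_snd)),
      hI, ENNReal.div_eq_inv_mul, ← lintegral_const_mul _ (hf.pow_const _),
      ← lintegral_indicator hmsf]
    refine lintegral_mono_ae ?_
    filter_upwards [hff] with x hfx
    by_cases hx : s < f x
    · rw [Set.indicator_of_mem (by exact hx)]
      have h2 : ∫⁻ y in {y | y ∈ {y | t < g y} ∧ x ∈ {x | η * g y ^ κ < f x}},
          K y x * (2 * g y ^ q) ∂ν ≤ 2⁻¹ * f x := by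
        calc _ ≤ ∫⁻ y in {y | g y ≤ (f x / η) ^ κ'}, K y x * (2 * g y ^ q) ∂ν :=
              lintegral_mono_set fun y hy => ((hlev' _ _).1 hy.2).le
          _ = 2 * ∫⁻ y in {y | g y ≤ (f x / η) ^ κ'}, K y x * g y ^ q ∂ν := by
              have hm : Measurable fun y => K y x * g y ^ q := (hK1 x).mul (hg.pow_const q)
              rw [← lintegral_const_mul _ hm]
              exact lintegral_congr fun x => by ring
          _ ≤ 2 * (η / 8 * ((f x / η) ^ κ') ^ κ) := by
              gcongr
              exact hT₂ x _ ((hlev' _ _).1 hx).le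
                (ENNReal.rpow_ne_top_of_nonneg hκ'.le (ENNReal.div_ne_top hfx.ne hη0))
          _ = 2 * (f x / 8) := by rw [hpow', hη8]
          _ ≤ 2 * (f x / 4) := by gcongr; norm_num
          _ = 2⁻¹ * f x := by
              rw [div_eq_mul_inv, show (4 : ℝ≥0∞) = 2 * 2 by norm_num,
                ENNReal.mul_inv (by simp) (by simp), show 2 * (f x * (2⁻¹ * 2⁻¹)) =
                (2 * 2⁻¹) * (2⁻¹ * f x) by ring, ENNReal.mul_inv_cancel (by simp) (by simp), one_mul]
      rw [ENNReal.rpow_add_of_nonneg _ _ hp.le zero_le_one, ENNReal.rpow_one, mul_left_comm]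
      exact mul_le_mul_right h2 _
    · have : {y | t < g y ∧ η * g y ^ κ < f x} = ∅ := by
        ext y
        simp only [Set.mem_ofPred_eq, Set.mem_empty_iff_false, iff_false, not_and]
        intro h1 h2
        refine hx (lt_trans ?_ h2)
        rw [hs, ENNReal.mul_lt_mul_iff_right hη0 hηt]
        exact ENNReal.rpow_lt_rpow h1 hκ
      rw [this]; simp
  -- `I ≤ J ≤ I/2` with `I` finite.
  have hI0 : I = 0 := by
    by_contra h
    exact absurd (hIJ.trans hJI) (not_le.2 (ENNReal.half_lt_self h hIt))
  have hJ0 : J = 0 := by simpa [hI0] using hJI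
  refine ⟨max s t, ?_, ?_, ?_⟩
  · simp only [ne_eq, max_eq_top, htt, or_false]
    exact ENNReal.mul_ne_top hηt (ENNReal.rpow_ne_top_of_nonneg hκ.le htt)
  · filter_upwards [ae_le_of_setLIntegral_rpow_eq_zero hp1 hf hI0] with x hx
    exact hx.trans (le_max_left _ _)
  · filter_upwards [ae_le_of_setLIntegral_rpow_eq_zero hq1 hg hJ0] with x hx
    exact hx.trans (le_max_right _ _)

/-! ### Integrals of powers under a growth condition -/

theorem Real.rpow_le_of_comparable {N R c : ℝ} (hR : 0 < R) (hc : 1 ≤ c) (h1 : R ≤ c * N)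
    (h2 : N ≤ c * R) (s : ℝ) : N ^ s ≤ c ^ |s| * R ^ s := by
  have hc0 : 0 < c := by linarith
  have hN : 0 < N := by
    by_contra h
    nlinarith [mul_nonneg hc0.le (neg_nonneg.2 (not_lt.1 h))]
  rcases le_total 0 s with hs | hs
  · rw [abs_of_nonneg hs, ← Real.mul_rpow hc0.le hR.le]
    exact Real.rpow_le_rpow hN.le h2 hs
  · rw [abs_of_nonpos hs, Real.rpow_neg hc0.le, ← Real.inv_rpow hc0.le,
      ← Real.mul_rpow (by positivity) hR.le]
    refine Real.rpow_le_rpow_of_nonpos (by positivity) ?_ hs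
    rw [inv_mul_le_iff₀ hc0]; exact h1

/-- Powers of `N` with negative exponent take a conventional value where `N = 0`; this makes that
set irrelevant. -/
theorem measure_eq_zero_of_growth {Ω : Type} [MeasurableSpace Ω] {m : Measure Ω} {N : Ω → ℝ}
    {d : ℝ} {V : ℝ≥0∞} (hd : 0 < d) (hV : V ≠ ∞)
    (hm : ∀ r : ℝ, 0 < r → m {ω | N ω < r} ≤ V * ENNReal.ofReal (r ^ d)) :
    m {ω | N ω ≤ 0} = 0 := by
  have h1 : Tendsto (fun r : ℝ => V * ENNReal.ofReal (r ^ d)) (𝓝[>] 0) (𝓝 (V * ENNReal.ofReal (0 ^ d))) := by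
    refine ENNReal.Tendsto.const_mul (ENNReal.tendsto_ofReal ?_) (Or.inr hV)
    exact ((Real.continuousAt_rpow_const 0 d (Or.inr hd.le)).tendsto).mono_left nhdsWithin_le_nhds
  rw [Real.zero_rpow hd.ne', ENNReal.ofReal_zero, mul_zero] at h1
  refine le_antisymm (ge_of_tendsto h1 ?_) zero_le
  filter_upwards [self_mem_nhdsWithin] with r hr
  refine (measure_mono fun ω hω => ?_).trans (hm r hr)
  exact lt_of_le_of_lt (show N ω ≤ 0 from hω) hr

/-- Integration of a power of `N` over a set covered by a geometric family of annuli. -/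
theorem exists_lintegral_rpow_annuli_le {d s θ : ℝ} (hd : 0 < d) (hθ : 0 < θ) (hθs : θ ^ (d - s) < 1)
    {V : ℝ≥0∞} (hV : V ≠ ∞) :
    ∃ C : ℝ≥0∞, C ≠ ∞ ∧ ∀ {Ω : Type} [MeasurableSpace Ω] (m : Measure Ω) (N : Ω → ℝ),
      Measurable N → (∀ r : ℝ, 0 < r → m {ω | N ω < r} ≤ V * ENNReal.ofReal (r ^ d)) →
      ∀ (r : ℝ) (A : Set Ω), 0 < r → MeasurableSet A →
        (∀ ω ∈ A, 0 < N ω → ∃ j : ℕ, r * θ ^ j ≤ N ω ∧ N ω ≤ 2 * (r * θ ^ j)) →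
        ∫⁻ ω in A, ENNReal.ofReal (N ω ^ (-s)) ∂m ≤ C * ENNReal.ofReal (r ^ (d - s)) := by
  -- `2^{|s|}` is the cost of replacing `N` by the radius of its annulus, `3^d` that of enclosing
  -- the closed annulus of outer radius `2 r θ^j` in an open ball, and the last factor sums the
  -- geometric series.
  refine ⟨ENNReal.ofReal (2 ^ |-s|) * (V * ENNReal.ofReal (3 ^ d)) *
    (1 - ENNReal.ofReal (θ ^ (d - s)))⁻¹, ?_, ?_⟩
  · refine ENNReal.mul_ne_top (ENNReal.mul_ne_top (by simp) (ENNReal.mul_ne_top hV (by simp))) ?_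
    simpa [tsub_eq_zero_iff_le] using hθs
  intro Ω _ m N hN hm r A hr hA hcov
  have hR : ∀ j : ℕ, 0 < r * θ ^ j := fun j => by positivity
  have hms : ∀ t : ℝ, MeasurableSet {ω | N ω < t} := fun t => measurableSet_lt hN measurable_const
  have hnull := measure_eq_zero_of_growth hd hV hm
  have hpos : ∀ᵐ ω ∂m, 0 < N ω := by
    rw [ae_iff]; simpa using hnull
  calc ∫⁻ ω in A, ENNReal.ofReal (N ω ^ (-s)) ∂m
      ≤ ∫⁻ ω in A, ∑' j : ℕ, {ω | N ω < 3 * (r * θ ^ j)}.indicator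
          (fun _ => ENNReal.ofReal (2 ^ |-s| * (r * θ ^ j) ^ (-s))) ω ∂m := by
        refine lintegral_mono_ae ((ae_restrict_iff' hA).2 ?_)
        filter_upwards [hpos] with ω hω hωA
        obtain ⟨j, hj1, hj2⟩ := hcov ω hωA hω
        refine le_trans ?_ (ENNReal.le_tsum j)
        rw [Set.indicator_of_mem]
        · exact ENNReal.ofReal_le_ofReal
            (Real.rpow_le_of_comparable (hR j) one_le_two (by linarith) hj2 _)
        · show N ω < 3 * (r * θ ^ j)
          linarith [hR j]
    _ ≤ ∫⁻ ω, ∑' j : ℕ, {ω | N ω < 3 * (r * θ ^ j)}.indicator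
          (fun _ => ENNReal.ofReal (2 ^ |-s| * (r * θ ^ j) ^ (-s))) ω ∂m :=
        setLIntegral_le_lintegral _ _
    _ = ∑' j : ℕ, ENNReal.ofReal (2 ^ |-s| * (r * θ ^ j) ^ (-s)) * m {ω | N ω < 3 * (r * θ ^ j)} := by
        rw [lintegral_tsum fun j => (measurable_const.indicator (hms _)).aemeasurable]
        congr 1; ext j
        rw [lintegral_indicator_const (hms _)]
    _ ≤ ∑' j : ℕ, ENNReal.ofReal (2 ^ |-s|) * (V * ENNReal.ofReal (3 ^ d)) *
          ENNReal.ofReal (r ^ (d - s)) * (ENNReal.ofReal (θ ^ (d - s))) ^ j := by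
        refine ENNReal.tsum_le_tsum fun j => ?_
        refine (mul_le_mul_right (hm _ (by linarith [hR j])) _).trans_eq ?_
        rw [ENNReal.ofReal_mul (by positivity), Real.mul_rpow (by norm_num) (hR j).le,
          ENNReal.ofReal_mul (by positivity), ← ENNReal.ofReal_pow (by positivity)]
        have : ENNReal.ofReal ((r * θ ^ j) ^ (-s)) * ENNReal.ofReal ((r * θ ^ j) ^ d) =
            ENNReal.ofReal (r ^ (d - s)) * ENNReal.ofReal ((θ ^ (d - s)) ^ j) := by
          rw [← ENNReal.ofReal_mul (by positivity), ← ENNReal.ofReal_mul (by positivity),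
            ← Real.rpow_add (hR j), Real.mul_rpow hr.le (by positivity), ← Real.rpow_natCast,
            ← Real.rpow_mul hθ.le, ← Real.rpow_natCast, ← Real.rpow_mul hθ.le]
          congr 3
          · ring
          · ring_nf
        calc _ = ENNReal.ofReal (2 ^ |-s|) * (V * ENNReal.ofReal (3 ^ d)) *
              (ENNReal.ofReal ((r * θ ^ j) ^ (-s)) * ENNReal.ofReal ((r * θ ^ j) ^ d)) := by ring
          _ = _ := by rw [this]; ring
    _ = _ := by
        rw [ENNReal.tsum_mul_left, ENNReal.tsum_geometric]; ring

theorem exists_lintegral_rpow_ball_le {d s : ℝ} (hd : 0 < d) (hs : s < d) {V : ℝ≥0∞} (hV : V ≠ ∞) :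
    ∃ C : ℝ≥0∞, C ≠ ∞ ∧ ∀ {Ω : Type} [MeasurableSpace Ω] (m : Measure Ω) (N : Ω → ℝ),
      Measurable N → (∀ r : ℝ, 0 < r → m {ω | N ω < r} ≤ V * ENNReal.ofReal (r ^ d)) →
      ∀ r : ℝ, 0 < r →
        ∫⁻ ω in {ω | N ω < r}, ENNReal.ofReal (N ω ^ (-s)) ∂m ≤ C * ENNReal.ofReal (r ^ (d - s)) := by
  obtain ⟨C, hC, h⟩ := exists_lintegral_rpow_annuli_le (d := d) (s := s) (θ := 2⁻¹) hd (by norm_num)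
    (Real.rpow_lt_one (by norm_num) (by norm_num) (by linarith)) hV
  refine ⟨C, hC, fun m N hN hm r hr => h m N hN hm r _ hr (measurableSet_lt hN measurable_const) ?_⟩
  intro ω hω h0
  have hω' : N ω < r := hω
  obtain ⟨j, hj1, hj2⟩ := exists_nat_pow_near_of_lt_one (x := N ω / r) (y := (2⁻¹ : ℝ))
    (by positivity) ((div_le_one hr).2 hω'.le) (by norm_num) (by norm_num)
  rw [lt_div_iff₀ hr] at hj1
  rw [div_le_iff₀ hr] at hj2
  -- Annuli are indexed by their inner radius, which here is `r 2^{-(j+1)}`.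
  refine ⟨j + 1, by linarith, ?_⟩
  rw [pow_succ]; linarith

theorem exists_lintegral_rpow_compl_ball_le {d s : ℝ} (hd : 0 < d) (hs : d < s) {V : ℝ≥0∞}
    (hV : V ≠ ∞) :
    ∃ C : ℝ≥0∞, C ≠ ∞ ∧ ∀ {Ω : Type} [MeasurableSpace Ω] (m : Measure Ω) (N : Ω → ℝ),
      Measurable N → (∀ r : ℝ, 0 < r → m {ω | N ω < r} ≤ V * ENNReal.ofReal (r ^ d)) →
      ∀ r : ℝ, 0 < r →
        ∫⁻ ω in {ω | r ≤ N ω}, ENNReal.ofReal (N ω ^ (-s)) ∂m ≤ C * ENNReal.ofReal (r ^ (d - s)) := by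
  obtain ⟨C, hC, h⟩ := exists_lintegral_rpow_annuli_le (d := d) (s := s) (θ := 2) hd (by norm_num)
    (Real.rpow_lt_one_of_one_lt_of_neg (by norm_num) (by linarith)) hV
  refine ⟨C, hC, fun m N hN hm r hr => h m N hN hm r _ hr (measurableSet_le measurable_const hN) ?_⟩
  intro ω hω h0
  have hω' : r ≤ N ω := hω
  obtain ⟨j, hj1, hj2⟩ := exists_nat_pow_near (x := N ω / r) (y := (2 : ℝ))
    ((one_le_div hr).2 hω') (by norm_num)
  rw [le_div_iff₀ hr] at hj1
  rw [div_lt_iff₀ hr] at hj2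
  refine ⟨j, by linarith, ?_⟩
  rw [pow_succ] at hj2; linarith

/-! ### Power bounds and tails of Poisson-like kernels -/

/-- A kernel `k` on a `d`-dimensional space, seen from a point at distance `R` from the origin:
`N` is the distance to the origin and `ρ` the distance to the point. -/
structure PoissonLike (d l δ δ' : ℝ) (C₁ : ℝ) (C₂ V : ℝ≥0∞) {Ω : Type} [MeasurableSpace Ω]
    (m : Measure Ω) (N ρ : Ω → ℝ) (k : Ω → ℝ≥0∞) (R : ℝ) : Prop where
  pos : 0 < R
  nonneg_N : ∀ ω, 0 ≤ N ω
  meas_N : Measurable N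
  meas_ρ : Measurable ρ
  growth : ∀ r : ℝ, 0 < r → m {ω | N ω < r} ≤ V * ENNReal.ofReal (r ^ d)
  le_add : ∀ ω, N ω ≤ ρ ω + R
  add_le : ∀ ω, R ≤ N ω + ρ ω
  kernel_le : ∀ ω, k ω ≤ ENNReal.ofReal (N ω ^ δ * R ^ δ' * ρ ω ^ (-(δ + δ')))
  kernel_near : ∀ ω, ρ ω < R / 2 → k ω ≤ ENNReal.ofReal (C₁ * (R / ρ ω) ^ l)
  pos_near : ∀ ω, k ω ≠ 0 → 0 < ρ ω
  integral_near : ∀ r : ℝ, 0 < r → r ≤ R / 2 →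
    ∫⁻ ω in {ω | ρ ω < r}, k ω ∂m ≤ C₂ * ENNReal.ofReal (r ^ (d - l) * R ^ l)

namespace PoissonLike

variable {d l δ δ' : ℝ} {C₁ : ℝ} {C₂ V : ℝ≥0∞} {Ω : Type} [MeasurableSpace Ω]
    {m : Measure Ω} {N ρ : Ω → ℝ} {k : Ω → ℝ≥0∞} {R : ℝ}

/-- Within `R/2` of the point, `N` is comparable to `R`, so the weight leaves the integral. -/
theorem near_le (h : PoissonLike d l δ δ' C₁ C₂ V m N ρ k R) (s : ℝ) {r : ℝ} (hr : 0 < r)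
    (hrR : r ≤ R / 2) :
    ∫⁻ ω in {ω | ρ ω < r}, k ω * ENNReal.ofReal (N ω ^ s) ∂m ≤
      ENNReal.ofReal (2 ^ |s| * R ^ s) * (C₂ * ENNReal.ofReal (r ^ (d - l) * R ^ l)) := by
  have hR := h.pos
  have hms : MeasurableSet {ω | ρ ω < r} := measurableSet_lt h.meas_ρ measurable_const
  calc _ ≤ ∫⁻ ω in {ω | ρ ω < r}, ENNReal.ofReal (2 ^ |s| * R ^ s) * k ω ∂m := by
        refine setLIntegral_mono' hms fun ω hω => ?_
        have hω' : ρ ω < r := hω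
        have h1 := h.le_add ω
        have h2 := h.add_le ω
        rw [mul_comm]
        gcongr
        exact Real.rpow_le_of_comparable hR one_le_two (by linarith) (by linarith) s
    _ = ENNReal.ofReal (2 ^ |s| * R ^ s) * ∫⁻ ω in {ω | ρ ω < r}, k ω ∂m :=
        lintegral_const_mul' _ _ (by simp)
    _ ≤ _ := by
        gcongr
        exact h.integral_near r hr hrR

/-- Away from the point `ρ` is at least a multiple of `R`, so the kernel is at most a multiple of
`(N/R)^δ`; this form is useful for `N < R`. -/
theorem far_le_of_lt (h : PoissonLike d l δ δ' C₁ C₂ V m N ρ k R) (hδ : 0 < δ) (hδ' : 0 < δ')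
    {ω : Ω} (hω : R / 2 ≤ ρ ω) :
    k ω ≤ ENNReal.ofReal (3 ^ (δ + δ') * R ^ (-δ) * N ω ^ δ) := by
  have hR := h.pos
  refine (h.kernel_le ω).trans (ENNReal.ofReal_le_ofReal ?_)
  have h1 : ρ ω ^ (-(δ + δ')) ≤ 3 ^ (δ + δ') * R ^ (-(δ + δ')) := by
    rw [Real.rpow_neg hR.le, ← Real.inv_rpow hR.le, ← Real.mul_rpow (by norm_num) (by positivity),
      Real.rpow_neg (by linarith), ← Real.inv_rpow (by linarith)]
    refine Real.rpow_le_rpow (by have : 0 < ρ ω := by linarith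
                                 positivity) ?_ (by linarith)
    rw [← div_eq_mul_inv, inv_eq_one_div, div_le_div_iff₀ (by linarith) hR]; linarith
  have hN := Real.rpow_nonneg (h.nonneg_N ω) δ
  calc N ω ^ δ * R ^ δ' * ρ ω ^ (-(δ + δ'))
      ≤ N ω ^ δ * R ^ δ' * (3 ^ (δ + δ') * R ^ (-(δ + δ'))) := by gcongr
    _ = 3 ^ (δ + δ') * (R ^ δ' * R ^ (-(δ + δ'))) * N ω ^ δ := by ring
    _ = _ := by rw [← Real.rpow_add hR]; ring_nf

/-- Here `N ≤ ρ + R ≤ 3ρ`, so `ρ` may be traded for `N` instead of `R`. The bound `(R/N)^{δ'}`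
decays at infinity. -/
theorem far_le_of_ge (h : PoissonLike d l δ δ' C₁ C₂ V m N ρ k R) (hδ : 0 < δ) (hδ' : 0 < δ')
    {ω : Ω} (hω : R / 2 ≤ ρ ω) (hN : 0 < N ω) :
    k ω ≤ ENNReal.ofReal (3 ^ (δ + δ') * R ^ δ' * N ω ^ (-δ')) := by
  have hR := h.pos
  refine (h.kernel_le ω).trans (ENNReal.ofReal_le_ofReal ?_)
  have h1 : ρ ω ^ (-(δ + δ')) ≤ 3 ^ (δ + δ') * N ω ^ (-(δ + δ')) := by
    rw [Real.rpow_neg hN.le, ← Real.inv_rpow hN.le, ← Real.mul_rpow (by norm_num) (by positivity),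
      Real.rpow_neg (by linarith), ← Real.inv_rpow (by linarith)]
    refine Real.rpow_le_rpow (by have : 0 < ρ ω := by linarith
                                 positivity) ?_ (by linarith)
    rw [← div_eq_mul_inv, inv_eq_one_div, div_le_div_iff₀ (by linarith) hN]
    linarith [h.le_add ω]
  have hN' := Real.rpow_nonneg (h.nonneg_N ω) δ
  calc N ω ^ δ * R ^ δ' * ρ ω ^ (-(δ + δ'))
      ≤ N ω ^ δ * R ^ δ' * (3 ^ (δ + δ') * N ω ^ (-(δ + δ'))) := by gcongr
    _ = 3 ^ (δ + δ') * R ^ δ' * (N ω ^ δ * N ω ^ (-(δ + δ'))) := by ring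
    _ = _ := by rw [← Real.rpow_add hN]; ring_nf

theorem far_le (h : PoissonLike d l δ δ' C₁ C₂ V m N ρ k R) (hδ : 0 < δ) (hδ' : 0 < δ')
    {ω : Ω} (hω : R / 2 ≤ ρ ω) : k ω ≤ ENNReal.ofReal (3 ^ (δ + δ')) := by
  have hR := h.pos
  rcases lt_or_ge (N ω) R with hN | hN
  · refine (h.far_le_of_lt hδ hδ' hω).trans (ENNReal.ofReal_le_ofReal ?_)
    calc 3 ^ (δ + δ') * R ^ (-δ) * N ω ^ δ ≤ 3 ^ (δ + δ') * R ^ (-δ) * R ^ δ := by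
          gcongr
          exact h.nonneg_N ω
      _ = 3 ^ (δ + δ') := by rw [mul_assoc, ← Real.rpow_add hR]; simp
  · have hN0 : 0 < N ω := by linarith
    refine (h.far_le_of_ge hδ hδ' hω hN0).trans (ENNReal.ofReal_le_ofReal ?_)
    calc 3 ^ (δ + δ') * R ^ δ' * N ω ^ (-δ') ≤ 3 ^ (δ + δ') * N ω ^ δ' * N ω ^ (-δ') := by
          gcongr
      _ = 3 ^ (δ + δ') := by rw [mul_assoc, ← Real.rpow_add hN0]; simp

/-- A Schur type bound that reflects homogeneity. Far from the point the kernel behaves like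
`(N/R)^δ` inside radius `R` and `(R/N)^{δ'}` outside; against `N^{σ-d}` the first is integrable at
`0` when `σ > -δ`, the second at infinity when `σ < δ'`. Near the point local integrability
suffices. -/
theorem exists_lintegral_mul_rpow_le (hd : 0 < d) (hδ : 0 < δ) (hδ' : 0 < δ') (hC₂ : C₂ ≠ ∞)
    (hV : V ≠ ∞) {σ : ℝ} (h1 : -δ < σ) (h2 : σ < δ') :
    ∃ C : ℝ≥0∞, C ≠ ∞ ∧ ∀ {Ω : Type} [MeasurableSpace Ω] {m : Measure Ω} {N ρ : Ω → ℝ}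
      {k : Ω → ℝ≥0∞} {R : ℝ}, PoissonLike d l δ δ' C₁ C₂ V m N ρ k R →
      ∫⁻ ω, k ω * ENNReal.ofReal (N ω ^ (σ - d)) ∂m ≤ C * ENNReal.ofReal (R ^ σ) := by
  obtain ⟨A, hA, hball⟩ := exists_lintegral_rpow_ball_le (d := d) (s := d - δ - σ) hd (by linarith) hV
  obtain ⟨B, hB, hcompl⟩ := exists_lintegral_rpow_compl_ball_le (d := d) (s := d + δ' - σ) hd
    (by linarith) hV
  refine ⟨ENNReal.ofReal (2 ^ |σ - d|) * (C₂ * ENNReal.ofReal ((1 / 2) ^ (d - l))) +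
    ENNReal.ofReal (3 ^ (δ + δ')) * A + ENNReal.ofReal (3 ^ (δ + δ')) * B, ?_, ?_⟩
  · simp [ENNReal.mul_eq_top, hA, hB, hC₂]
  intro Ω _ m N ρ k R h
  have hR := h.pos
  have hpos : ∀ᵐ ω ∂m, 0 < N ω := by
    rw [ae_iff]; simpa using measure_eq_zero_of_growth hd hV h.growth
  have hcov : (Set.univ : Set Ω) ⊆ ({ω | ρ ω < R / 2} ∪ {ω | R / 2 ≤ ρ ω ∧ N ω < R}) ∪
      {ω | R / 2 ≤ ρ ω ∧ R ≤ N ω} := by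
    intro ω _
    rcases lt_or_ge (ρ ω) (R / 2) with hω | hω
    · exact Or.inl (Or.inl hω)
    · rcases lt_or_ge (N ω) R with hω' | hω'
      · exact Or.inl (Or.inr ⟨hω, hω'⟩)
      · exact Or.inr ⟨hω, hω'⟩
  have hms1 : MeasurableSet {ω | R / 2 ≤ ρ ω ∧ N ω < R} :=
    (measurableSet_le measurable_const h.meas_ρ).inter (measurableSet_lt h.meas_N measurable_const)
  have hms2 : MeasurableSet {ω | R / 2 ≤ ρ ω ∧ R ≤ N ω} :=
    (measurableSet_le measurable_const h.meas_ρ).inter (measurableSet_le measurable_const h.meas_N)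
  have e1 : ∫⁻ ω in {ω | ρ ω < R / 2}, k ω * ENNReal.ofReal (N ω ^ (σ - d)) ∂m ≤
      ENNReal.ofReal (2 ^ |σ - d|) * (C₂ * ENNReal.ofReal ((1 / 2) ^ (d - l))) *
        ENNReal.ofReal (R ^ σ) := by
    refine (h.near_le (σ - d) (by positivity) le_rfl).trans_eq ?_
    have hpw : ENNReal.ofReal (R ^ (σ - d)) * ENNReal.ofReal ((R / 2) ^ (d - l) * R ^ l) =
        ENNReal.ofReal ((1 / 2) ^ (d - l)) * ENNReal.ofReal (R ^ σ) := by
      rw [← ENNReal.ofReal_mul (by positivity), ← ENNReal.ofReal_mul (by positivity),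
        show R / 2 = 1 / 2 * R by ring, Real.mul_rpow (by norm_num) hR.le]
      congr 1
      calc R ^ (σ - d) * ((1 / 2) ^ (d - l) * R ^ (d - l) * R ^ l)
          = (1 / 2) ^ (d - l) * (R ^ (σ - d) * R ^ (d - l) * R ^ l) := by ring
        _ = _ := by rw [← Real.rpow_add hR, ← Real.rpow_add hR]; ring_nf
    rw [ENNReal.ofReal_mul (by positivity), mul_assoc, mul_left_comm _ C₂, hpw]
    ring
  have e2 : ∫⁻ ω in {ω | R / 2 ≤ ρ ω ∧ N ω < R}, k ω * ENNReal.ofReal (N ω ^ (σ - d)) ∂m ≤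
      ENNReal.ofReal (3 ^ (δ + δ')) * A * ENNReal.ofReal (R ^ σ) := by
    calc _ ≤ ∫⁻ ω in {ω | R / 2 ≤ ρ ω ∧ N ω < R}, ENNReal.ofReal (3 ^ (δ + δ') * R ^ (-δ)) *
          ENNReal.ofReal (N ω ^ (-(d - δ - σ))) ∂m := by
          refine lintegral_mono_ae ((ae_restrict_iff' hms1).2 ?_)
          filter_upwards [hpos] with ω hω0 hω
          refine (mul_le_mul_left (h.far_le_of_lt hδ hδ' hω.1) _).trans_eq ?_
          rw [ENNReal.ofReal_mul (by positivity), mul_assoc,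
            ← ENNReal.ofReal_mul (Real.rpow_nonneg hω0.le _), ← Real.rpow_add hω0]
          ring_nf
      _ = ENNReal.ofReal (3 ^ (δ + δ') * R ^ (-δ)) *
          ∫⁻ ω in {ω | R / 2 ≤ ρ ω ∧ N ω < R}, ENNReal.ofReal (N ω ^ (-(d - δ - σ))) ∂m :=
          lintegral_const_mul' _ _ (by simp)
      _ ≤ ENNReal.ofReal (3 ^ (δ + δ') * R ^ (-δ)) *
          (A * ENNReal.ofReal (R ^ (d - (d - δ - σ)))) := by
          gcongr
          exact (lintegral_mono_set fun ω hω => hω.2).trans (hball m N h.meas_N h.growth R hR)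
      _ = _ := by
          rw [ENNReal.ofReal_mul (by positivity), mul_mul_mul_comm,
            ← ENNReal.ofReal_mul (by positivity), ← Real.rpow_add hR]
          ring_nf
  have e3 : ∫⁻ ω in {ω | R / 2 ≤ ρ ω ∧ R ≤ N ω}, k ω * ENNReal.ofReal (N ω ^ (σ - d)) ∂m ≤
      ENNReal.ofReal (3 ^ (δ + δ')) * B * ENNReal.ofReal (R ^ σ) := by
    calc _ ≤ ∫⁻ ω in {ω | R / 2 ≤ ρ ω ∧ R ≤ N ω}, ENNReal.ofReal (3 ^ (δ + δ') * R ^ δ') *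
          ENNReal.ofReal (N ω ^ (-(d + δ' - σ))) ∂m := by
          refine lintegral_mono_ae ((ae_restrict_iff' hms2).2 ?_)
          filter_upwards [hpos] with ω hω0 hω
          refine (mul_le_mul_left (h.far_le_of_ge hδ hδ' hω.1 hω0) _).trans_eq ?_
          rw [ENNReal.ofReal_mul (by positivity), mul_assoc,
            ← ENNReal.ofReal_mul (Real.rpow_nonneg hω0.le _), ← Real.rpow_add hω0]
          ring_nf
      _ = ENNReal.ofReal (3 ^ (δ + δ') * R ^ δ') *
          ∫⁻ ω in {ω | R / 2 ≤ ρ ω ∧ R ≤ N ω}, ENNReal.ofReal (N ω ^ (-(d + δ' - σ))) ∂m :=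
          lintegral_const_mul' _ _ (by simp)
      _ ≤ ENNReal.ofReal (3 ^ (δ + δ') * R ^ δ') *
          (B * ENNReal.ofReal (R ^ (d - (d + δ' - σ)))) := by
          gcongr
          exact (lintegral_mono_set fun ω hω => hω.2).trans (hcompl m N h.meas_N h.growth R hR)
      _ = _ := by
          rw [ENNReal.ofReal_mul (by positivity), mul_mul_mul_comm,
            ← ENNReal.ofReal_mul (by positivity), ← Real.rpow_add hR]
          ring_nf
  rw [← setLIntegral_univ]
  refine (lintegral_mono_set hcov).trans ((lintegral_union_le _ _ _).trans ?_)
  rw [add_mul, add_mul]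
  exact add_le_add ((lintegral_union_le _ _ _).trans (add_le_add e1 e2)) e3

/-- A large value `h` is attained only in a ball of radius about `h^{-1/l} R` around the point, and
the mass of that ball is of order `h^{-(d-l)/l}`, independently of `R`. For bounded `h` the total
mass is enough. -/
theorem exists_lintegral_tail_le (hd : 0 < d) (hl : 0 < l) (hδ : 0 < δ) (hδ' : 0 < δ')
    (hC₁ : 0 < C₁) (hC₂ : C₂ ≠ ∞) (hV : V ≠ ∞) {e : ℝ} (he : 0 ≤ e) (hel : e * l ≤ d - l) :
    ∃ C : ℝ≥0∞, C ≠ ∞ ∧ ∀ {Ω : Type} [MeasurableSpace Ω] {m : Measure Ω} {N ρ : Ω → ℝ}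
      {k : Ω → ℝ≥0∞} {R : ℝ}, PoissonLike d l δ δ' C₁ C₂ V m N ρ k R →
      ∀ h : ℝ≥0∞, h ≠ 0 → h ≠ ∞ →
      ∫⁻ ω in {ω | h < k ω}, k ω * ENNReal.ofReal (N ω ^ (-d)) ∂m ≤ C * h ^ (-e) := by
  obtain ⟨A, hA, htot⟩ := exists_lintegral_mul_rpow_le (d := d) (l := l) (δ := δ) (δ' := δ')
    (C₁ := C₁) (C₂ := C₂) (V := V) hd hδ hδ' hC₂ hV (σ := 0) (by linarith) hδ'
  -- Each summand has its use for `H ≥ h₀`: `1` allows the exponent `(d-l)/l` to be lowered to `e`,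
  -- `3^{δ+δ'}` exceeds the kernel far from the point, and `C₁ 2^l` makes `r ≤ R/2`.
  set h₀ : ℝ := 1 + 3 ^ (δ + δ') + C₁ * 2 ^ l with hh₀
  have h3 : (0 : ℝ) < 3 ^ (δ + δ') := by positivity
  have h2l : (0 : ℝ) < C₁ * 2 ^ l := by positivity
  have hh₀0 : 0 < h₀ := by positivity
  refine ⟨A * ENNReal.ofReal (h₀ ^ e) +
    ENNReal.ofReal (2 ^ |-d|) * (C₂ * ENNReal.ofReal (C₁ ^ ((d - l) / l))), ?_, ?_⟩
  · simp [ENNReal.mul_eq_top, hA, hC₂]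
  intro Ω _ m N ρ k R hk h h0 ht
  have hR := hk.pos
  obtain ⟨H, rfl⟩ : ∃ H : ℝ, h = ENNReal.ofReal H := ⟨h.toReal, (ENNReal.ofReal_toReal ht).symm⟩
  have hH : 0 < H := by simpa using h0
  rw [ENNReal.ofReal_rpow_of_pos hH, add_mul]
  rcases lt_or_ge H h₀ with hlt | hge
  · refine le_trans ((setLIntegral_le_lintegral _ _).trans ?_) le_self_add
    have := htot hk
    simp only [zero_sub, Real.rpow_zero, ENNReal.ofReal_one, mul_one] at this
    refine this.trans ?_
    rw [mul_assoc, ← ENNReal.ofReal_mul (by positivity)]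
    refine le_mul_of_one_le_right' ?_
    rw [ENNReal.one_le_ofReal, Real.rpow_neg hH.le, ← div_eq_mul_inv, one_le_div (by positivity)]
    exact Real.rpow_le_rpow hH.le hlt.le he
  · refine le_trans ?_ le_add_self
    have hH1 : 1 ≤ H := by linarith
    -- The radius at which the near bound `C₁ (R/ρ)^l` equals `H`.
    set r : ℝ := (C₁ / H) ^ (1 / l) * R with hr
    have hr0 : 0 < r := by positivity
    have hrR : r ≤ R / 2 := by
      have : (C₁ / H) ^ (1 / l) ≤ 1 / 2 := by
        calc (C₁ / H) ^ (1 / l) ≤ ((1 / 2) ^ l) ^ (1 / l) := by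
              refine Real.rpow_le_rpow (by positivity) ?_ (by positivity)
              rw [Real.div_rpow (by norm_num) (by norm_num), Real.one_rpow,
                div_le_div_iff₀ hH (by positivity)]
              linarith
          _ = 1 / 2 := by rw [← Real.rpow_mul (by norm_num), mul_one_div_cancel hl.ne', Real.rpow_one]
      rw [hr]; nlinarith
    have hsub : {ω | ENNReal.ofReal H < k ω} ⊆ {ω | ρ ω < r} := by
      intro ω hω
      have hω' : ENNReal.ofReal H < k ω := hω
      have hρ : 0 < ρ ω := hk.pos_near ω (zero_le.trans_lt hω').ne'
      have hnear : ρ ω < R / 2 := by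
        by_contra hc
        have h5 := hω'.trans_le (hk.far_le hδ hδ' (not_lt.1 hc))
        rw [ENNReal.ofReal_lt_ofReal_iff h3] at h5
        linarith
      have h5 := hω'.trans_le (hk.kernel_near ω hnear)
      rw [ENNReal.ofReal_lt_ofReal_iff_of_nonneg hH.le] at h5
      show ρ ω < r
      have h6 : (ρ ω / R) ^ l < C₁ / H := by
        rw [Real.div_rpow hR.le hρ.le] at h5
        rw [Real.div_rpow hρ.le hR.le, div_lt_div_iff₀ (by positivity) hH]
        rw [← mul_div_assoc, lt_div_iff₀ (by positivity)] at h5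
        linarith
      have h7 : ρ ω / R < (C₁ / H) ^ (1 / l) := by
        have := Real.rpow_lt_rpow (by positivity) h6 (show 0 < 1 / l by positivity)
        rwa [← Real.rpow_mul (by positivity), mul_one_div_cancel hl.ne', Real.rpow_one] at this
      rwa [div_lt_iff₀ hR] at h7
    refine (lintegral_mono_set hsub).trans ((hk.near_le (-d) hr0 hrR).trans ?_)
    have hpw : R ^ (-d) * (r ^ (d - l) * R ^ l) = C₁ ^ ((d - l) / l) * H ^ (-((d - l) / l)) := by
      rw [hr, Real.mul_rpow (by positivity) hR.le, ← Real.rpow_mul (by positivity),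
        Real.div_rpow hC₁.le hH.le, Real.rpow_neg hH.le, ← div_eq_mul_inv,
        show 1 / l * (d - l) = (d - l) / l by ring]
      have : R ^ (-d) * R ^ (d - l) * R ^ l = 1 := by
        rw [← Real.rpow_add hR, ← Real.rpow_add hR, show -d + (d - l) + l = 0 by ring, Real.rpow_zero]
      calc _ = (C₁ ^ ((d - l) / l) / H ^ ((d - l) / l)) * (R ^ (-d) * R ^ (d - l) * R ^ l) := by ring
        _ = _ := by rw [this, mul_one]
    calc _ = ENNReal.ofReal (2 ^ |-d|) * (C₂ *
          ENNReal.ofReal (R ^ (-d) * (r ^ (d - l) * R ^ l))) := by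
          rw [ENNReal.ofReal_mul (by positivity), ENNReal.ofReal_mul (p := R ^ (-d)) (by positivity)]
          ring
      _ = ENNReal.ofReal (2 ^ |-d|) * (C₂ * ENNReal.ofReal (C₁ ^ ((d - l) / l))) *
          ENNReal.ofReal (H ^ (-((d - l) / l))) := by
          rw [hpw, ENNReal.ofReal_mul (by positivity)]; ring
      _ ≤ _ := by
          gcongr
          · rw [le_div_iff₀ hl]; exact hel

end PoissonLike

/-! ### Distances and volumes in the half space -/

/-- The distance `|x - ξ|` from a point of the ambient space to a point of the boundary. -/
noncomputable def bdryDist {n : ℕ} (x : Ambient n) (ξ : Boundary n) : ℝ :=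
  √(‖x.1 - ξ‖ ^ 2 + x.2 ^ 2)

section geometry

variable {n : ℕ}

theorem bdryDist_nonneg (x : Ambient n) (ξ : Boundary n) : 0 ≤ bdryDist x ξ := Real.sqrt_nonneg _

theorem euclNorm_nonneg (x : Ambient n) : 0 ≤ euclNorm x := Real.sqrt_nonneg _

theorem bdryDist_zero (x : Ambient n) : bdryDist x 0 = euclNorm x := by
  simp [bdryDist, euclNorm]

theorem norm_sub_le_bdryDist (x : Ambient n) (ξ : Boundary n) : ‖x.1 - ξ‖ ≤ bdryDist x ξ :=
  Real.le_sqrt_of_sq_le (by nlinarith [sq_nonneg x.2])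

theorem abs_snd_le_bdryDist (x : Ambient n) (ξ : Boundary n) : |x.2| ≤ bdryDist x ξ :=
  Real.le_sqrt_of_sq_le (by rw [sq_abs]; nlinarith [sq_nonneg ‖x.1 - ξ‖])

theorem snd_le_bdryDist (x : Ambient n) (ξ : Boundary n) : x.2 ≤ bdryDist x ξ :=
  (le_abs_self _).trans (abs_snd_le_bdryDist x ξ)

theorem snd_le_euclNorm (x : Ambient n) : x.2 ≤ euclNorm x := by
  rw [← bdryDist_zero]; exact snd_le_bdryDist x 0

theorem norm_fst_le_euclNorm (x : Ambient n) : ‖x.1‖ ≤ euclNorm x := by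
  have := norm_sub_le_bdryDist x 0
  rwa [bdryDist_zero, sub_zero] at this

theorem bdryDist_le_add (x : Ambient n) (ξ η : Boundary n) :
    bdryDist x ξ ≤ bdryDist x η + ‖η - ξ‖ := by
  have h1 : ‖x.1 - ξ‖ ≤ ‖x.1 - η‖ + ‖η - ξ‖ := norm_sub_le_norm_sub_add_norm_sub _ _ _
  have h2 := norm_sub_le_bdryDist x η
  have h3 : bdryDist x η ^ 2 = ‖x.1 - η‖ ^ 2 + x.2 ^ 2 := Real.sq_sqrt (by positivity)
  refine (Real.sqrt_le_left (add_nonneg (bdryDist_nonneg _ _) (norm_nonneg _))).2 ?_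
  have h4 : ‖x.1 - ξ‖ ^ 2 ≤ (‖x.1 - η‖ + ‖η - ξ‖) ^ 2 := by gcongr
  nlinarith [mul_le_mul_of_nonneg_right h2 (norm_nonneg (η - ξ))]

theorem euclNorm_le_add (x : Ambient n) (ξ : Boundary n) : euclNorm x ≤ ‖ξ‖ + bdryDist x ξ := by
  have := bdryDist_le_add x 0 ξ
  rw [bdryDist_zero, sub_zero] at this
  linarith

theorem norm_le_add (x : Ambient n) (ξ : Boundary n) : ‖ξ‖ ≤ bdryDist x ξ + euclNorm x := by
  have h1 : ‖ξ‖ ≤ ‖x.1 - ξ‖ + ‖x.1‖ := by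
    have := norm_sub_le (x.1) (x.1 - ξ)
    rw [sub_sub_cancel] at this; linarith
  linarith [norm_sub_le_bdryDist x ξ, norm_fst_le_euclNorm x]

theorem bdryDist_pos {x : Ambient n} (hx : x ∈ upperHalf n) (ξ : Boundary n) : 0 < bdryDist x ξ :=
  lt_of_lt_of_le (show 0 < x.2 from hx) (snd_le_bdryDist x ξ)

theorem euclNorm_pos {x : Ambient n} (hx : x ∈ upperHalf n) : 0 < euclNorm x :=
  lt_of_lt_of_le (show 0 < x.2 from hx) (snd_le_euclNorm x)

theorem continuous_bdryDist : Continuous fun z : Ambient n × Boundary n => bdryDist z.1 z.2 := by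
  unfold bdryDist; fun_prop

theorem continuous_euclNorm : Continuous (euclNorm : Ambient n → ℝ) := by
  unfold euclNorm; fun_prop

theorem measurableSet_upperHalf : MeasurableSet (upperHalf n) :=
  measurableSet_lt measurable_const measurable_snd

theorem measurable_bdryDist_left (ξ : Boundary n) : Measurable fun x : Ambient n => bdryDist x ξ :=
  (continuous_bdryDist.comp (Continuous.prodMk continuous_id continuous_const)).measurable

theorem measurable_bdryDist_right (x : Ambient n) : Measurable fun ξ : Boundary n => bdryDist x ξ :=
  (continuous_bdryDist.comp (Continuous.prodMk continuous_const continuous_id)).measurable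

theorem volume_ball_boundary (hn : 1 ≤ n) (ξ : Boundary n) {r : ℝ} (hr : 0 < r) :
    volume (Metric.ball ξ r) =
      volume (Metric.ball (0 : Boundary n) 1) * ENNReal.ofReal (r ^ ((n : ℝ) - 1)) := by
  rw [Measure.addHaar_ball_of_pos _ _ hr, mul_comm, finrank_euclideanSpace_fin, ← Real.rpow_natCast,
    Nat.cast_sub hn, Nat.cast_one]

theorem volume_bdryDist_lt_le (hn : 1 ≤ n) (x : Ambient n) {r : ℝ} (hr : 0 < r) :
    volume {ξ : Boundary n | bdryDist x ξ < r} ≤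
      volume (Metric.ball (0 : Boundary n) 1) * ENNReal.ofReal (r ^ ((n : ℝ) - 1)) := by
  rw [← volume_ball_boundary hn x.1 hr]
  refine measure_mono fun ξ hξ => ?_
  rw [Metric.mem_ball, dist_comm, dist_eq_norm]
  exact (norm_sub_le_bdryDist x ξ).trans_lt hξ

theorem volume_norm_lt_le (hn : 1 ≤ n) {r : ℝ} (hr : 0 < r) :
    volume {ξ : Boundary n | ‖ξ‖ < r} ≤
      volume (Metric.ball (0 : Boundary n) 1) * ENNReal.ofReal (r ^ ((n : ℝ) - 1)) := by
  rw [← volume_ball_boundary hn 0 hr]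
  refine measure_mono fun ξ hξ => ?_
  rw [mem_ball_zero_iff]; exact hξ

theorem volume_ambient_bdryDist_lt_le (hn : 1 ≤ n) (ξ : Boundary n) {r : ℝ} (hr : 0 < r) :
    volume {x : Ambient n | bdryDist x ξ < r} ≤
      2 * volume (Metric.ball (0 : Boundary n) 1) * ENNReal.ofReal (r ^ (n : ℝ)) := by
  have h1 : {x : Ambient n | bdryDist x ξ < r} ⊆ Metric.ball ξ r ×ˢ Set.Ioo (-r) r := by
    intro x hx
    have hx' : bdryDist x ξ < r := hx
    refine ⟨?_, abs_lt.1 ((abs_snd_le_bdryDist x ξ).trans_lt hx')⟩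
    rw [Metric.mem_ball, dist_eq_norm]
    exact (norm_sub_le_bdryDist x ξ).trans_lt hx'
  refine (measure_mono h1).trans_eq ?_
  rw [Measure.volume_eq_prod, Measure.prod_prod, volume_ball_boundary hn ξ hr, Real.volume_Ioo,
    show r - -r = 2 * r by ring, ENNReal.ofReal_mul (by norm_num),
    show r ^ (n : ℝ) = r ^ ((n : ℝ) - 1) * r by rw [← Real.rpow_add_one hr.ne']; ring_nf,
    ENNReal.ofReal_mul (by positivity)]
  simp only [ENNReal.ofReal_ofNat]
  ring

theorem volume_euclNorm_lt_le (hn : 1 ≤ n) {r : ℝ} (hr : 0 < r) :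
    volume {x : Ambient n | euclNorm x < r} ≤
      2 * volume (Metric.ball (0 : Boundary n) 1) * ENNReal.ofReal (r ^ (n : ℝ)) := by
  have := volume_ambient_bdryDist_lt_le hn (0 : Boundary n) hr
  simpa only [bdryDist_zero] using this

/-- The Poisson type kernel `xₙ |x - ξ|^{-D}` is locally integrable on the boundary, uniformly up to
the boundary, for all `D ≤ n`. -/
theorem exists_lintegral_poisson_near_le (hn : 2 ≤ n) {D : ℝ} (hDn : D ≤ n) :
    ∃ C : ℝ≥0∞, C ≠ ∞ ∧ ∀ x ∈ upperHalf n, ∀ r : ℝ, 0 < r →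
      ∫⁻ ξ in {ξ : Boundary n | bdryDist x ξ < r},
        ENNReal.ofReal (x.2 * bdryDist x ξ ^ (-D)) ≤ C * ENNReal.ofReal (r ^ ((n : ℝ) - D)) := by
  have hn1 : 1 ≤ n := by omega
  have hd : 0 < (n : ℝ) - 1 := by
    have : (2 : ℝ) ≤ n := by exact_mod_cast hn
    linarith
  have hV : volume (Metric.ball (0 : Boundary n) 1) ≠ ∞ := measure_ball_lt_top.ne
  -- For `D < n` the crude bound `xₙ ≤ |x-ξ|` leaves an integrable power. At `D = n` it would leave
  -- the borderline exponent `n-1`; there `xₙ` is kept, and since `|x-ξ| ≥ xₙ` everywhere the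
  -- integral over the whole boundary is bounded, as for the classical Poisson kernel.
  rcases lt_or_eq_of_le hDn with hlt | heq
  · obtain ⟨C, hC, h⟩ := exists_lintegral_rpow_ball_le (d := (n : ℝ) - 1) (s := D - 1) hd
      (by linarith) hV
    refine ⟨C, hC, fun x hx r hr => ?_⟩
    have := h volume (fun ξ => bdryDist x ξ) (measurable_bdryDist_right x)
      (fun r hr => volume_bdryDist_lt_le hn1 x hr) r hr
    rw [show (n : ℝ) - 1 - (D - 1) = n - D by ring] at this
    refine le_trans (lintegral_mono fun ξ => ENNReal.ofReal_le_ofReal ?_) this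
    have hρ := bdryDist_pos hx ξ
    calc x.2 * bdryDist x ξ ^ (-D) ≤ bdryDist x ξ * bdryDist x ξ ^ (-D) := by
          gcongr
          exact snd_le_bdryDist x ξ
      _ = _ := by rw [mul_comm, ← Real.rpow_add_one hρ.ne']; ring_nf
  · obtain ⟨C, hC, h⟩ := exists_lintegral_rpow_compl_ball_le (d := (n : ℝ) - 1) (s := D) hd
      (by linarith) hV
    refine ⟨C, hC, fun x hx r hr => ?_⟩
    have hx2 : 0 < x.2 := hx
    have := h volume (fun ξ => bdryDist x ξ) (measurable_bdryDist_right x)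
      (fun r hr => volume_bdryDist_lt_le hn1 x hr) x.2 hx2
    have huniv : {ξ : Boundary n | x.2 ≤ bdryDist x ξ} = Set.univ :=
      Set.eq_univ_of_forall fun ξ => snd_le_bdryDist x ξ
    rw [huniv, setLIntegral_univ] at this
    rw [heq, sub_self, Real.rpow_zero, ENNReal.ofReal_one, mul_one]
    rw [heq] at this
    calc _ ≤ ∫⁻ ξ : Boundary n, ENNReal.ofReal x.2 * ENNReal.ofReal (bdryDist x ξ ^ (-(n : ℝ))) := by
          refine (setLIntegral_le_lintegral _ _).trans (lintegral_mono fun ξ => ?_)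
          rw [ENNReal.ofReal_mul hx2.le]
      _ = ENNReal.ofReal x.2 * ∫⁻ ξ : Boundary n, ENNReal.ofReal (bdryDist x ξ ^ (-(n : ℝ))) :=
          lintegral_const_mul' _ _ (by simp)
      _ ≤ ENNReal.ofReal x.2 * (C * ENNReal.ofReal (x.2 ^ ((n : ℝ) - 1 - n))) := by gcongr
      _ = C := by
          rw [mul_left_comm, ← ENNReal.ofReal_mul hx2.le, show (n : ℝ) - 1 - n = -1 by ring,
            Real.rpow_neg_one, mul_inv_cancel₀ hx2.ne', ENNReal.ofReal_one, mul_one]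

end geometry

/-! ### Power bounds and tails of the conjugated kernel -/

/-- The fractional Poisson kernel conjugated by the powers that make the system scale invariant. -/
noncomputable def scaledKernel {n : ℕ} (δ₁ δ₂ : ℝ) (x : Ambient n) (ξ : Boundary n) : ℝ≥0∞ :=
  ENNReal.ofReal (x.2 * euclNorm x ^ (δ₁ - 1) * ‖ξ‖ ^ δ₂ * bdryDist x ξ ^ (-(δ₁ + δ₂)))

/-- The scale invariant measure `|ξ|^{-(n-1)} dξ` on the boundary. -/
noncomputable def bdryMeasure (n : ℕ) : Measure (Boundary n) :=
  volume.withDensity fun ξ => ENNReal.ofReal (‖ξ‖ ^ (-((n : ℝ) - 1)))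

/-- The scale invariant measure `|x|^{-n} dx` on the half space. -/
noncomputable def halfMeasure (n : ℕ) : Measure (Ambient n) :=
  (volume.restrict (upperHalf n)).withDensity fun x => ENNReal.ofReal (euclNorm x ^ (-(n : ℝ)))

section kernel

variable {n : ℕ} {δ₁ δ₂ : ℝ}

theorem measurable_scaledKernel :
    Measurable (Function.uncurry (scaledKernel (n := n) δ₁ δ₂)) := by
  have h1 : Measurable fun z : Ambient n × Boundary n => euclNorm z.1 :=
    continuous_euclNorm.measurable.comp measurable_fst
  have h2 := (continuous_bdryDist (n := n)).measurable
  unfold scaledKernel Function.uncurry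
  exact (((measurable_fst.snd.mul (h1.pow_const _)).mul (measurable_snd.norm.pow_const _)).mul
    (h2.pow_const _)).ennreal_ofReal

theorem measurable_scaledKernel_left (ξ : Boundary n) :
    Measurable fun x : Ambient n => scaledKernel δ₁ δ₂ x ξ :=
  measurable_scaledKernel.comp measurable_prodMk_right

theorem measurable_scaledKernel_right (x : Ambient n) :
    Measurable fun ξ : Boundary n => scaledKernel δ₁ δ₂ x ξ :=
  measurable_scaledKernel.comp measurable_prodMk_left

theorem measurable_bdryDensity :
    Measurable fun ξ : Boundary n => ENNReal.ofReal (‖ξ‖ ^ (-((n : ℝ) - 1))) :=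
  (measurable_norm.pow_const _).ennreal_ofReal

theorem measurable_halfDensity :
    Measurable fun x : Ambient n => ENNReal.ofReal (euclNorm x ^ (-(n : ℝ))) :=
  (continuous_euclNorm.measurable.pow_const _).ennreal_ofReal

theorem scaledKernel_eq_zero_of_notMem {x : Ambient n} (hx : x ∉ upperHalf n) (ξ : Boundary n) :
    scaledKernel δ₁ δ₂ x ξ = 0 := by
  refine ENNReal.ofReal_of_nonpos ?_
  have h1 : x.2 ≤ 0 := not_lt.1 hx
  have h2 := Real.rpow_nonneg (euclNorm_nonneg x) (δ₁ - 1)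
  have h3 := Real.rpow_nonneg (norm_nonneg ξ) δ₂
  have h4 := Real.rpow_nonneg (bdryDist_nonneg x ξ) (-(δ₁ + δ₂))
  exact mul_nonpos_of_nonpos_of_nonneg (mul_nonpos_of_nonpos_of_nonneg
    (mul_nonpos_of_nonpos_of_nonneg h1 h2) h3) h4

theorem scaledKernel_zero_right (hδ₂ : δ₂ ≠ 0) (x : Ambient n) :
    scaledKernel δ₁ δ₂ x 0 = 0 := by
  simp [scaledKernel, Real.zero_rpow hδ₂]

theorem scaledKernel_le_near {x : Ambient n} (hx : x ∈ upperHalf n) {ξ : Boundary n} {R : ℝ}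
    (hR : 0 < R) (h1 : R ≤ 2 * euclNorm x) (h2 : euclNorm x ≤ 2 * R) (h3 : R ≤ 2 * ‖ξ‖)
    (h4 : ‖ξ‖ ≤ 2 * R) :
    scaledKernel δ₁ δ₂ x ξ ≤ ENNReal.ofReal (2 ^ |δ₁ - 1| * 2 ^ |δ₂| * R ^ (δ₁ + δ₂ - 1) *
      (x.2 * bdryDist x ξ ^ (-(δ₁ + δ₂)))) := by
  refine ENNReal.ofReal_le_ofReal ?_
  have hx2 : 0 < x.2 := hx
  have hρ := bdryDist_pos hx ξ
  have e1 := Real.rpow_le_of_comparable hR one_le_two h1 h2 (δ₁ - 1)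
  have e2 := Real.rpow_le_of_comparable hR one_le_two h3 h4 δ₂
  calc x.2 * euclNorm x ^ (δ₁ - 1) * ‖ξ‖ ^ δ₂ * bdryDist x ξ ^ (-(δ₁ + δ₂))
      ≤ x.2 * (2 ^ |δ₁ - 1| * R ^ (δ₁ - 1)) * (2 ^ |δ₂| * R ^ δ₂) *
        bdryDist x ξ ^ (-(δ₁ + δ₂)) := by gcongr
    _ = 2 ^ |δ₁ - 1| * 2 ^ |δ₂| * (R ^ (δ₁ - 1) * R ^ δ₂) *
      (x.2 * bdryDist x ξ ^ (-(δ₁ + δ₂))) := by ring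
    _ = _ := by rw [← Real.rpow_add hR]; ring_nf

/-- The factor `xₙ ≤ |x-ξ|` lowers the order of the singularity from `D` to `D - 1`, the exponent
`l` that governs the tails. -/
theorem scaledKernel_le_near' {x : Ambient n} (hx : x ∈ upperHalf n) {ξ : Boundary n} {R : ℝ}
    (hR : 0 < R) (h1 : R ≤ 2 * euclNorm x) (h2 : euclNorm x ≤ 2 * R) (h3 : R ≤ 2 * ‖ξ‖)
    (h4 : ‖ξ‖ ≤ 2 * R) :
    scaledKernel δ₁ δ₂ x ξ ≤ ENNReal.ofReal (2 ^ |δ₁ - 1| * 2 ^ |δ₂| *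
      (R / bdryDist x ξ) ^ (δ₁ + δ₂ - 1)) := by
  refine (scaledKernel_le_near hx hR h1 h2 h3 h4).trans (ENNReal.ofReal_le_ofReal ?_)
  have hρ := bdryDist_pos hx ξ
  rw [Real.div_rpow hR.le hρ.le, mul_assoc, div_eq_mul_inv, ← Real.rpow_neg hρ.le]
  gcongr
  calc x.2 * bdryDist x ξ ^ (-(δ₁ + δ₂)) ≤ bdryDist x ξ * bdryDist x ξ ^ (-(δ₁ + δ₂)) := by
        gcongr
        exact snd_le_bdryDist x ξ
    _ = _ := by rw [mul_comm, ← Real.rpow_add_one hρ.ne']; ring_nf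

theorem scaledKernel_le {x : Ambient n} (hx : x ∈ upperHalf n) (ξ : Boundary n) :
    scaledKernel δ₁ δ₂ x ξ ≤
      ENNReal.ofReal (euclNorm x ^ δ₁ * ‖ξ‖ ^ δ₂ * bdryDist x ξ ^ (-(δ₁ + δ₂))) := by
  refine ENNReal.ofReal_le_ofReal ?_
  have hx1 := euclNorm_pos hx
  have hρ := bdryDist_pos hx ξ
  have : x.2 * euclNorm x ^ (δ₁ - 1) ≤ euclNorm x ^ δ₁ := by
    calc x.2 * euclNorm x ^ (δ₁ - 1) ≤ euclNorm x * euclNorm x ^ (δ₁ - 1) := by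
          gcongr
          exact snd_le_euclNorm x
      _ = _ := by rw [mul_comm, ← Real.rpow_add_one hx1.ne']; ring_nf
  gcongr

/-- Fixed `x`, integration over the boundary of dimension `n - 1`. The mass near `x` is estimated
with the factor `xₙ` retained, because the singularity `D - 1` may equal the dimension. -/
theorem exists_poissonLike_row (hn : 2 ≤ n) (hDn : δ₁ + δ₂ ≤ n) :
    ∃ C₂ : ℝ≥0∞, C₂ ≠ ∞ ∧ ∀ x ∈ upperHalf n,
      PoissonLike ((n : ℝ) - 1) (δ₁ + δ₂ - 1) δ₂ δ₁ (2 ^ |δ₁ - 1| * 2 ^ |δ₂|) C₂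
        (volume (Metric.ball (0 : Boundary n) 1)) volume (fun ξ : Boundary n => ‖ξ‖)
        (fun ξ => bdryDist x ξ) (fun ξ => scaledKernel δ₁ δ₂ x ξ) (euclNorm x) := by
  obtain ⟨C, hC, h⟩ := exists_lintegral_poisson_near_le hn hDn
  refine ⟨ENNReal.ofReal (2 ^ |δ₁ - 1| * 2 ^ |δ₂|) * C, ENNReal.mul_ne_top (by simp) hC,
    fun x hx => ?_⟩
  have hR := euclNorm_pos hx
  have hcomp : ∀ ξ, bdryDist x ξ < euclNorm x / 2 →
      euclNorm x ≤ 2 * ‖ξ‖ ∧ ‖ξ‖ ≤ 2 * euclNorm x := fun ξ hξ => by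
    constructor <;> linarith [norm_le_add x ξ, euclNorm_le_add x ξ]
  refine ⟨hR, fun ξ => norm_nonneg ξ, measurable_norm, measurable_bdryDist_right x,
    fun r hr => volume_norm_lt_le (by omega) hr, norm_le_add x, euclNorm_le_add x, fun ξ => ?_,
    fun ξ hξ => ?_, fun ξ _ => bdryDist_pos hx ξ, fun r hr hrR => ?_⟩
  · refine (scaledKernel_le hx ξ).trans_eq ?_
    rw [mul_comm (‖ξ‖ ^ δ₂), add_comm δ₂]
  · obtain ⟨h3, h4⟩ := hcomp ξ hξ
    exact scaledKernel_le_near' hx hR (by linarith) (by linarith) h3 h4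
  · have hms : MeasurableSet {ξ : Boundary n | bdryDist x ξ < r} :=
      measurableSet_lt (measurable_bdryDist_right x) measurable_const
    calc ∫⁻ ξ in {ξ : Boundary n | bdryDist x ξ < r}, scaledKernel δ₁ δ₂ x ξ
        ≤ ∫⁻ ξ in {ξ : Boundary n | bdryDist x ξ < r},
          ENNReal.ofReal (2 ^ |δ₁ - 1| * 2 ^ |δ₂| * euclNorm x ^ (δ₁ + δ₂ - 1)) *
            ENNReal.ofReal (x.2 * bdryDist x ξ ^ (-(δ₁ + δ₂))) := by
          refine setLIntegral_mono' hms fun ξ hξ => ?_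
          obtain ⟨h3, h4⟩ := hcomp ξ (lt_of_lt_of_le (by exact hξ) hrR)
          rw [← ENNReal.ofReal_mul (by positivity)]
          exact scaledKernel_le_near hx hR (by linarith) (by linarith) h3 h4
      _ = ENNReal.ofReal (2 ^ |δ₁ - 1| * 2 ^ |δ₂| * euclNorm x ^ (δ₁ + δ₂ - 1)) *
          ∫⁻ ξ in {ξ : Boundary n | bdryDist x ξ < r},
            ENNReal.ofReal (x.2 * bdryDist x ξ ^ (-(δ₁ + δ₂))) :=
          lintegral_const_mul' _ _ (by simp)
      _ ≤ ENNReal.ofReal (2 ^ |δ₁ - 1| * 2 ^ |δ₂| * euclNorm x ^ (δ₁ + δ₂ - 1)) *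
          (C * ENNReal.ofReal (r ^ ((n : ℝ) - (δ₁ + δ₂)))) := by
          gcongr
          exact h x hx r hr
      _ = _ := by
          rw [ENNReal.ofReal_mul (by positivity), ENNReal.ofReal_mul (p := r ^ _) (by positivity),
            show (n : ℝ) - 1 - (δ₁ + δ₂ - 1) = n - (δ₁ + δ₂) by ring]
          ring

/-- Fixed `ξ`, integration over the half space. The dimension `n` exceeds `D - 1`, so the factor
`xₙ` can be discarded. -/
theorem exists_poissonLike_col (hn : 2 ≤ n) (hD : δ₁ + δ₂ - 1 < n) :
    ∃ C₂ : ℝ≥0∞, C₂ ≠ ∞ ∧ ∀ ξ : Boundary n, ξ ≠ 0 →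
      PoissonLike (n : ℝ) (δ₁ + δ₂ - 1) δ₁ δ₂ (2 ^ |δ₁ - 1| * 2 ^ |δ₂|) C₂
        (2 * volume (Metric.ball (0 : Boundary n) 1)) (volume.restrict (upperHalf n)) euclNorm
        (fun x => bdryDist x ξ) (fun x => scaledKernel δ₁ δ₂ x ξ) ‖ξ‖ := by
  have hn0 : (0 : ℝ) < n := by positivity
  have hV : 2 * volume (Metric.ball (0 : Boundary n) 1) ≠ ∞ :=
    ENNReal.mul_ne_top (by simp) measure_ball_lt_top.ne
  obtain ⟨C, hC, h⟩ := exists_lintegral_rpow_ball_le (d := (n : ℝ)) (s := δ₁ + δ₂ - 1) hn0 hD hV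
  refine ⟨ENNReal.ofReal (2 ^ |δ₁ - 1| * 2 ^ |δ₂|) * C, ENNReal.mul_ne_top (by simp) hC,
    fun ξ hξ => ?_⟩
  have hR : 0 < ‖ξ‖ := norm_pos_iff.2 hξ
  have hmem : ∀ x : Ambient n, scaledKernel δ₁ δ₂ x ξ ≠ 0 → x ∈ upperHalf n := fun x hx => by
    by_contra hc
    exact hx (scaledKernel_eq_zero_of_notMem hc ξ)
  have hnear : ∀ x : Ambient n, bdryDist x ξ < ‖ξ‖ / 2 → scaledKernel δ₁ δ₂ x ξ ≤
      ENNReal.ofReal (2 ^ |δ₁ - 1| * 2 ^ |δ₂| * (‖ξ‖ / bdryDist x ξ) ^ (δ₁ + δ₂ - 1)) := by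
    intro x hx
    by_cases h0 : scaledKernel δ₁ δ₂ x ξ = 0
    · rw [h0]; exact zero_le
    · have h1 := norm_le_add x ξ
      have h2 := euclNorm_le_add x ξ
      exact scaledKernel_le_near' (hmem x h0) hR (by linarith) (by linarith) (by linarith)
        (by linarith)
  refine ⟨hR, euclNorm_nonneg, continuous_euclNorm.measurable, measurable_bdryDist_left ξ,
    fun r hr => (Measure.restrict_le_self _).trans (volume_euclNorm_lt_le (by omega) hr),
    fun x => ?_, fun x => ?_, fun x => ?_,
    hnear, fun x hx => bdryDist_pos (hmem x hx) ξ, fun r hr hrR => ?_⟩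
  · linarith [euclNorm_le_add x ξ]
  · linarith [norm_le_add x ξ]
  · by_cases h0 : scaledKernel δ₁ δ₂ x ξ = 0
    · rw [h0]; exact zero_le
    · exact scaledKernel_le (hmem x h0) ξ
  · have hms : MeasurableSet {x : Ambient n | bdryDist x ξ < r} :=
      measurableSet_lt (measurable_bdryDist_left ξ) measurable_const
    calc ∫⁻ x in {x : Ambient n | bdryDist x ξ < r}, scaledKernel δ₁ δ₂ x ξ
          ∂(volume.restrict (upperHalf n))
        ≤ ∫⁻ x in {x : Ambient n | bdryDist x ξ < r},
          ENNReal.ofReal (2 ^ |δ₁ - 1| * 2 ^ |δ₂| * ‖ξ‖ ^ (δ₁ + δ₂ - 1)) *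
            ENNReal.ofReal (bdryDist x ξ ^ (-(δ₁ + δ₂ - 1))) ∂(volume.restrict (upperHalf n)) := by
          refine setLIntegral_mono' hms fun x hx => ?_
          refine (hnear x (lt_of_lt_of_le (by exact hx) hrR)).trans_eq ?_
          rw [← ENNReal.ofReal_mul (by positivity), Real.div_rpow hR.le (bdryDist_nonneg x ξ),
            Real.rpow_neg (bdryDist_nonneg x ξ), div_eq_mul_inv]
          ring_nf
      _ = ENNReal.ofReal (2 ^ |δ₁ - 1| * 2 ^ |δ₂| * ‖ξ‖ ^ (δ₁ + δ₂ - 1)) *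
          ∫⁻ x in {x : Ambient n | bdryDist x ξ < r},
            ENNReal.ofReal (bdryDist x ξ ^ (-(δ₁ + δ₂ - 1))) ∂(volume.restrict (upperHalf n)) :=
          lintegral_const_mul' _ _ (by simp)
      _ ≤ ENNReal.ofReal (2 ^ |δ₁ - 1| * 2 ^ |δ₂| * ‖ξ‖ ^ (δ₁ + δ₂ - 1)) *
          (C * ENNReal.ofReal (r ^ ((n : ℝ) - (δ₁ + δ₂ - 1)))) := by
          gcongr
          exact h _ (fun x => bdryDist x ξ) (measurable_bdryDist_left ξ) (fun r hr =>
            (Measure.restrict_le_self _).trans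
              (volume_ambient_bdryDist_lt_le (by omega) ξ hr)) r hr
      _ = _ := by
          rw [ENNReal.ofReal_mul (by positivity), ENNReal.ofReal_mul (p := r ^ _) (by positivity)]
          ring

theorem lintegral_bdryMeasure {F : Boundary n → ℝ≥0∞} (hF : AEMeasurable F) :
    ∫⁻ ξ, F ξ ∂(bdryMeasure n) = ∫⁻ ξ, F ξ * ENNReal.ofReal (‖ξ‖ ^ (-((n : ℝ) - 1))) := by
  rw [bdryMeasure, lintegral_withDensity_eq_lintegral_mul₀ measurable_bdryDensity.aemeasurable hF]
  exact lintegral_congr fun ξ => mul_comm _ _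

theorem lintegral_halfMeasure {F : Ambient n → ℝ≥0∞}
    (hF : AEMeasurable F (volume.restrict (upperHalf n))) :
    ∫⁻ x, F x ∂(halfMeasure n) =
      ∫⁻ x in upperHalf n, F x * ENNReal.ofReal (euclNorm x ^ (-(n : ℝ))) := by
  rw [halfMeasure, lintegral_withDensity_eq_lintegral_mul₀ measurable_halfDensity.aemeasurable hF]
  exact lintegral_congr fun ξ => mul_comm _ _

theorem ae_bdryMeasure_ne_zero (hn : 2 ≤ n) : ∀ᵐ ξ ∂(bdryMeasure n), ξ ≠ 0 := by
  have : Nontrivial (Boundary n) := by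
    have : Nonempty (Fin (n - 1)) := ⟨⟨0, by omega⟩⟩
    infer_instance
  refine (withDensity_absolutelyContinuous _ _).ae_le ?_
  exact Measure.ae_ne volume 0

theorem ae_halfMeasure_mem : ∀ᵐ x ∂(halfMeasure n), x ∈ upperHalf n :=
  (withDensity_absolutelyContinuous _ _).ae_le (ae_restrict_mem measurableSet_upperHalf)

theorem exists_lintegral_row_le (hn : 2 ≤ n) (hδ₁ : 0 < δ₁) (hδ₂ : 0 < δ₂) (hDn : δ₁ + δ₂ ≤ n)
    {σ : ℝ} (h1 : -δ₂ < σ) (h2 : σ < δ₁) :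
    ∃ C : ℝ≥0∞, C ≠ ∞ ∧ ∀ x ∈ upperHalf n,
      ∫⁻ ξ, scaledKernel δ₁ δ₂ x ξ * ENNReal.ofReal (‖ξ‖ ^ σ) ∂(bdryMeasure n) ≤
        C * ENNReal.ofReal (euclNorm x ^ σ) := by
  have hd : 0 < (n : ℝ) - 1 := by
    have : (2 : ℝ) ≤ n := by exact_mod_cast hn
    linarith
  obtain ⟨C₂, hC₂, hP⟩ := exists_poissonLike_row hn hDn
  obtain ⟨C, hC, h⟩ := PoissonLike.exists_lintegral_mul_rpow_le (l := δ₁ + δ₂ - 1)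
    (C₁ := 2 ^ |δ₁ - 1| * 2 ^ |δ₂|) hd hδ₂ hδ₁ hC₂
    (measure_ball_lt_top (μ := volume) (x := (0 : Boundary n)) (r := 1)).ne h1 h2
  refine ⟨C, hC, fun x hx => ?_⟩
  refine le_trans (le_of_eq ?_) (h (hP x hx))
  have hm : Measurable fun ξ : Boundary n => ENNReal.ofReal (‖ξ‖ ^ σ) :=
    (measurable_norm.pow_const _).ennreal_ofReal
  have hF : Measurable fun ξ : Boundary n => scaledKernel δ₁ δ₂ x ξ * ENNReal.ofReal (‖ξ‖ ^ σ) :=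
    (measurable_scaledKernel_right x).mul hm
  rw [lintegral_bdryMeasure hF.aemeasurable]
  refine lintegral_congr_ae ?_
  have : Nontrivial (Boundary n) := by
    have : Nonempty (Fin (n - 1)) := ⟨⟨0, by omega⟩⟩
    infer_instance
  filter_upwards [Measure.ae_ne volume (0 : Boundary n)] with ξ hξ
  rw [mul_assoc, ← ENNReal.ofReal_mul (by positivity), ← Real.rpow_add (norm_pos_iff.2 hξ),
    ← sub_eq_add_neg]

theorem exists_lintegral_col_le (hn : 2 ≤ n) (hδ₁ : 0 < δ₁) (hδ₂ : 0 < δ₂) (hDn : δ₁ + δ₂ ≤ n)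
    {σ : ℝ} (h1 : -δ₁ < σ) (h2 : σ < δ₂) :
    ∃ C : ℝ≥0∞, C ≠ ∞ ∧ ∀ ξ : Boundary n, ξ ≠ 0 →
      ∫⁻ x, scaledKernel δ₁ δ₂ x ξ * ENNReal.ofReal (euclNorm x ^ σ) ∂(halfMeasure n) ≤
        C * ENNReal.ofReal (‖ξ‖ ^ σ) := by
  have hd : 0 < (n : ℝ) := by positivity
  have hV : 2 * volume (Metric.ball (0 : Boundary n) 1) ≠ ∞ :=
    ENNReal.mul_ne_top (by simp) measure_ball_lt_top.ne
  obtain ⟨C₂, hC₂, hP⟩ := exists_poissonLike_col (δ₁ := δ₁) (δ₂ := δ₂) hn (by linarith)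
  obtain ⟨C, hC, h⟩ := PoissonLike.exists_lintegral_mul_rpow_le (l := δ₁ + δ₂ - 1)
    (C₁ := 2 ^ |δ₁ - 1| * 2 ^ |δ₂|) hd hδ₁ hδ₂ hC₂ hV h1 h2
  refine ⟨C, hC, fun ξ hξ => ?_⟩
  refine le_trans (le_of_eq ?_) (h (hP ξ hξ))
  have hm : Measurable fun x : Ambient n => ENNReal.ofReal (euclNorm x ^ σ) :=
    (continuous_euclNorm.measurable.pow_const _).ennreal_ofReal
  have hF : Measurable fun x : Ambient n => scaledKernel δ₁ δ₂ x ξ * ENNReal.ofReal (euclNorm x ^ σ) :=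
    (measurable_scaledKernel_left ξ).mul hm
  rw [lintegral_halfMeasure hF.aemeasurable]
  refine setLIntegral_congr_fun measurableSet_upperHalf fun x hx => ?_
  have hx0 := euclNorm_pos hx
  simp only [mul_assoc]
  rw [← ENNReal.ofReal_mul (by positivity), ← Real.rpow_add hx0, ← sub_eq_add_neg]

/-- The natural exponent is `(n-D)/(D-1)`. Smaller ones are admitted so that the tail exponents can
be adjusted to the critical relation between `p` and `q`. -/
theorem exists_lintegral_row_tail_le (hn : 2 ≤ n) (hδ₁ : 0 < δ₁) (hδ₂ : 0 < δ₂)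
    (hD1 : 1 < δ₁ + δ₂) (hDn : δ₁ + δ₂ ≤ n) {e : ℝ} (he : 0 ≤ e)
    (heD : e * (δ₁ + δ₂ - 1) ≤ n - (δ₁ + δ₂)) :
    ∃ C : ℝ≥0∞, C ≠ ∞ ∧ ∀ (x : Ambient n) (h : ℝ≥0∞), h ≠ 0 → h ≠ ∞ →
      ∫⁻ ξ in {ξ | h < scaledKernel δ₁ δ₂ x ξ}, scaledKernel δ₁ δ₂ x ξ ∂(bdryMeasure n) ≤
        C * h ^ (-e) := by
  have hd : 0 < (n : ℝ) - 1 := by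
    have : (2 : ℝ) ≤ n := by exact_mod_cast hn
    linarith
  obtain ⟨C₂, hC₂, hP⟩ := exists_poissonLike_row hn hDn
  obtain ⟨C, hC, H⟩ := PoissonLike.exists_lintegral_tail_le (l := δ₁ + δ₂ - 1)
    (C₁ := 2 ^ |δ₁ - 1| * 2 ^ |δ₂|) hd (by linarith) hδ₂ hδ₁ (by positivity) hC₂
    (measure_ball_lt_top (μ := volume) (x := (0 : Boundary n)) (r := 1)).ne he (by linarith)
  refine ⟨C, hC, fun x h h0 ht => ?_⟩
  by_cases hx : x ∈ upperHalf n
  · refine le_trans (le_of_eq ?_) (H (hP x hx) h h0 ht)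
    have hms : MeasurableSet {ξ | h < scaledKernel δ₁ δ₂ x ξ} :=
      measurableSet_lt measurable_const (measurable_scaledKernel_right x)
    rw [← lintegral_indicator hms, ← lintegral_indicator hms,
      lintegral_bdryMeasure ((measurable_scaledKernel_right x).indicator hms).aemeasurable]
    refine lintegral_congr fun ξ => ?_
    by_cases hξ : ξ ∈ {ξ | h < scaledKernel δ₁ δ₂ x ξ} <;> simp [hξ]
  · simp [scaledKernel_eq_zero_of_notMem hx]

theorem exists_lintegral_col_tail_le (hn : 2 ≤ n) (hδ₁ : 0 < δ₁) (hδ₂ : 0 < δ₂)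
    (hD1 : 1 < δ₁ + δ₂) (hDn : δ₁ + δ₂ ≤ n) {e : ℝ} (he : 0 ≤ e)
    (heD : e * (δ₁ + δ₂ - 1) ≤ n - (δ₁ + δ₂) + 1) :
    ∃ C : ℝ≥0∞, C ≠ ∞ ∧ ∀ (ξ : Boundary n) (h : ℝ≥0∞), h ≠ 0 → h ≠ ∞ →
      ∫⁻ x in {x | h < scaledKernel δ₁ δ₂ x ξ}, scaledKernel δ₁ δ₂ x ξ ∂(halfMeasure n) ≤
        C * h ^ (-e) := by
  have hd : 0 < (n : ℝ) := by positivity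
  have hV : 2 * volume (Metric.ball (0 : Boundary n) 1) ≠ ∞ :=
    ENNReal.mul_ne_top (by simp) measure_ball_lt_top.ne
  obtain ⟨C₂, hC₂, hP⟩ := exists_poissonLike_col (δ₁ := δ₁) (δ₂ := δ₂) hn (by linarith)
  obtain ⟨C, hC, H⟩ := PoissonLike.exists_lintegral_tail_le (l := δ₁ + δ₂ - 1)
    (C₁ := 2 ^ |δ₁ - 1| * 2 ^ |δ₂|) hd (by linarith) hδ₁ hδ₂ (by positivity) hC₂ hV he (by linarith)
  refine ⟨C, hC, fun ξ h h0 ht => ?_⟩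
  -- The kernel vanishes at `ξ = 0` because `δ₂ > 0`, so the bound holds for every `ξ`.
  by_cases hξ : ξ = 0
  · simp [hξ, scaledKernel_zero_right hδ₂.ne']
  · refine le_trans (le_of_eq ?_) (H (hP ξ hξ) h h0 ht)
    have hms : MeasurableSet {x | h < scaledKernel δ₁ δ₂ x ξ} :=
      measurableSet_lt measurable_const (measurable_scaledKernel_left ξ)
    rw [← lintegral_indicator hms, ← lintegral_indicator hms,
      lintegral_halfMeasure ((measurable_scaledKernel_left ξ).indicator hms).aemeasurable]
    refine lintegral_congr fun x => ?_
    by_cases hx : x ∈ {x | h < scaledKernel δ₁ δ₂ x ξ} <;> simp [hx]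

end kernel

/-! ### Lower bounds and the scaled system -/

/-- The system satisfied by `f = |ξ|^{(n-1)/(p+1)} u` and `g = |x|^{n/(q+1)} v`. -/
structure ScaledSystem {n : ℕ} (δ₁ δ₂ p q : ℝ) (f : Boundary n → ℝ≥0∞) (g : Ambient n → ℝ≥0∞) :
    Prop where
  aemeas_f : AEMeasurable f (bdryMeasure n)
  aemeas_g : AEMeasurable g (halfMeasure n)
  lintegral_f : ∫⁻ ξ, f ξ ^ (p + 1) ∂(bdryMeasure n) ≠ ∞
  lintegral_g : ∫⁻ x, g x ^ (q + 1) ∂(halfMeasure n) ≠ ∞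
  eq_f : ∀ ξ, ξ ≠ 0 → f ξ = ∫⁻ x, scaledKernel δ₁ δ₂ x ξ * g x ^ q ∂(halfMeasure n)
  eq_g : ∀ x ∈ upperHalf n, g x = ∫⁻ ξ, scaledKernel δ₁ δ₂ x ξ * f ξ ^ p ∂(bdryMeasure n)

theorem nontrivial_boundary {n : ℕ} (hn : 2 ≤ n) : Nontrivial (Boundary n) := by
  have : Nonempty (Fin (n - 1)) := ⟨⟨0, by omega⟩⟩
  infer_instance

theorem fracPoisson_eq {n : ℕ} (γ : ℝ) (x : Ambient n) (ξ : Boundary n) :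
    fracPoisson γ x ξ = x.2 * bdryDist x ξ ^ (-((n : ℝ) + 2 - γ)) := by
  have h0 : 0 ≤ ‖x.1 - ξ‖ ^ 2 + x.2 ^ 2 := by positivity
  rw [fracPoisson, Real.rpow_neg (bdryDist_nonneg x ξ), ← div_eq_mul_inv, bdryDist,
    Real.sqrt_eq_rpow, ← Real.rpow_mul h0]
  congr 2; ring

theorem MeasureTheory.MemLp.lintegral_rpow_ne_top {X : Type} [MeasurableSpace X] {μ : Measure X}
    {f : X → ℝ≥0∞} {r : ℝ} (hr : 0 < r) (h : MemLp f (ENNReal.ofReal r) μ) :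
    ∫⁻ x, f x ^ r ∂μ ≠ ∞ := by
  have := (eLpNorm_lt_top_iff_lintegral_rpow_enorm_lt_top (by simpa using hr) (by simp)).1 h.2
  simpa [ENNReal.toReal_ofReal hr.le] using this.ne

/-- A nonnegative function that dominates `|ξ|^{-(n-1)}` on annuli escaping to `0` or to infinity is
not integrable. -/
theorem lintegral_eq_top_of_annuli {n : ℕ} (hn : 2 ≤ n) {F : Boundary n → ℝ≥0∞} (hF : AEMeasurable F)
    {r : ℕ → ℝ} (hr : ∀ k, 0 < r k)
    (hesc : ∀ ξ : Boundary n, ξ ≠ 0 → ∀ᶠ k in atTop, ¬ (r k ≤ ‖ξ‖ ∧ ‖ξ‖ ≤ 2 * r k))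
    {c : ℝ≥0∞} (hc : c ≠ 0)
    (hlow : ∀ k, ∀ ξ : Boundary n, r k ≤ ‖ξ‖ → ‖ξ‖ ≤ 2 * r k →
      c * ENNReal.ofReal (r k ^ (-((n : ℝ) - 1))) ≤ F ξ) :
    ∫⁻ ξ, F ξ = ∞ := by
  by_contra hfin
  have := nontrivial_boundary hn
  set A : ℕ → Set (Boundary n) := fun k => {ξ | r k ≤ ‖ξ‖ ∧ ‖ξ‖ ≤ 2 * r k} with hA
  have hAm : ∀ k, MeasurableSet (A k) := fun k =>
    (measurableSet_le measurable_const measurable_norm).inter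
      (measurableSet_le measurable_norm measurable_const)
  -- If `F` were integrable, its integrals over the escaping annuli would tend to `0`; but each of
  -- them is at least the constant `c₀`.
  have hlim : Tendsto (fun k => ∫⁻ ξ, (A k).indicator F ξ) atTop (𝓝 (∫⁻ _ : Boundary n, 0)) := by
    refine tendsto_lintegral_of_dominated_convergence' F (fun k => hF.indicator (hAm k))
      (fun k => ae_of_all _ fun ξ => Set.indicator_le_self _ _ _) hfin ?_
    filter_upwards [Measure.ae_ne volume (0 : Boundary n)] with ξ hξ
    refine tendsto_const_nhds.congr' ?_
    filter_upwards [hesc ξ hξ] with k hk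
    rw [Set.indicator_of_notMem (by exact hk)]
  rw [lintegral_zero] at hlim
  set V : ℝ≥0∞ := volume (Metric.ball (0 : Boundary n) 1) with hV
  have hV0 : V ≠ 0 := (Metric.measure_ball_pos volume _ one_pos).ne'
  set c₀ : ℝ≥0∞ := c * (V * ENNReal.ofReal ((1 / 2) ^ ((n : ℝ) - 1))) with hc₀
  have hc₀0 : 0 < c₀ := by
    rw [pos_iff_ne_zero]
    refine mul_ne_zero hc (mul_ne_zero hV0 ?_)
    have : (0 : ℝ) < (1 / 2) ^ ((n : ℝ) - 1) := by positivity
    simpa using this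
  have hge : ∀ k, c₀ ≤ ∫⁻ ξ, (A k).indicator F ξ := by
    intro k
    -- A ball of radius `r/2` centred on the sphere of radius `3r/2` lies in the annulus from `r` to
    -- `2r`.
    obtain ⟨η, hη⟩ := exists_norm_eq (Boundary n) (show 0 ≤ 3 / 2 * r k by linarith [hr k])
    have hsub : Metric.ball η (1 / 2 * r k) ⊆ A k := by
      intro ξ hξ
      rw [Metric.mem_ball, dist_eq_norm] at hξ
      have h1 : ‖ξ‖ ≤ ‖ξ - η‖ + ‖η‖ := by simpa using norm_add_le (ξ - η) η
      have h2 : ‖η‖ ≤ ‖ξ‖ + ‖ξ - η‖ := by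
        have := norm_sub_le ξ (ξ - η); rwa [sub_sub_cancel] at this
      exact ⟨by linarith, by linarith⟩
    rw [lintegral_indicator (hAm k)]
    calc c₀ = c * ENNReal.ofReal (r k ^ (-((n : ℝ) - 1))) * volume (Metric.ball η (1 / 2 * r k)) := by
          rw [volume_ball_boundary (by omega) η (by linarith [hr k]), Real.mul_rpow (by norm_num)
            (hr k).le, ENNReal.ofReal_mul (by positivity), hc₀]
          have : ENNReal.ofReal (r k ^ (-((n : ℝ) - 1))) * ENNReal.ofReal (r k ^ ((n : ℝ) - 1)) = 1 := by
            rw [← ENNReal.ofReal_mul (by have := hr k; positivity), ← Real.rpow_add (hr k)]; simp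
          calc _ = c * (V * ENNReal.ofReal ((1 / 2) ^ ((n : ℝ) - 1))) *
                (ENNReal.ofReal (r k ^ (-((n : ℝ) - 1))) * ENNReal.ofReal (r k ^ ((n : ℝ) - 1))) := by
                rw [this, mul_one]
            _ = _ := by ring
      _ ≤ c * ENNReal.ofReal (r k ^ (-((n : ℝ) - 1))) * volume (A k) := by gcongr
      _ = ∫⁻ _ in A k, c * ENNReal.ofReal (r k ^ (-((n : ℝ) - 1))) := (setLIntegral_const _ _).symm
      _ ≤ ∫⁻ ξ in A k, F ξ := setLIntegral_mono' (hAm k) fun ξ hξ => hlow k ξ hξ.1 hξ.2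
  exact absurd (ge_of_tendsto hlim (Eventually.of_forall hge)) (not_le.2 hc₀0)

namespace IsPositiveSolution

variable {n : ℕ} {α β γ p q : ℝ} {u : Boundary n → ℝ≥0∞} {v : Ambient n → ℝ≥0∞}

/-- Only the half unit ball is kept in the equation for `u`. There `v > 0` and `|x-ξ| ≤ 2
max(1,|ξ|)`, which bounds the kernel from below. -/
theorem exists_lower_bound (huv : IsPositiveSolution α β γ p q u v) (hγ : γ < n) (hq : 0 < q) :
    ∃ c : ℝ≥0∞, c ≠ 0 ∧ c ≠ ∞ ∧
      (∀ ξ : Boundary n, ξ ≠ 0 → ‖ξ‖ ≤ 1 → c * ENNReal.ofReal (‖ξ‖ ^ (-α)) ≤ u ξ) ∧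
      ∀ ξ : Boundary n, 1 ≤ ‖ξ‖ →
        c * ENNReal.ofReal (‖ξ‖ ^ (-(α + ((n : ℝ) + 2 - γ)))) ≤ u ξ := by
  set D : ℝ := (n : ℝ) + 2 - γ with hD
  have hD0 : 0 < D := by linarith
  set E : Set (Ambient n) := {x | 0 < x.2 ∧ euclNorm x < 1} with hE
  have hEo : IsOpen E := (isOpen_lt continuous_const continuous_snd).inter
    (isOpen_lt continuous_euclNorm continuous_const)
  have hEU : E ⊆ upperHalf n := fun x hx => hx.1
  have hEpos : volume E ≠ 0 := by
    refine (hEo.measure_pos volume ⟨(0, 1 / 2), by norm_num, ?_⟩).ne'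
    simp only [euclNorm, norm_zero]
    rw [Real.sqrt_lt' one_pos]; norm_num
  set w : Ambient n → ℝ≥0∞ := fun x =>
    ENNReal.ofReal (x.2 * 2 ^ (-D) * euclNorm x ^ (-β)) * v x ^ q with hw
  have hwm : AEMeasurable w (volume.restrict E) := by
    have h1 : AEMeasurable v (volume.restrict E) :=
      (huv.memLp_v.1.aemeasurable).mono_measure (Measure.restrict_mono hEU le_rfl)
    have h2 : Measurable fun x : Ambient n => ENNReal.ofReal (x.2 * 2 ^ (-D) * euclNorm x ^ (-β)) :=
      ((measurable_snd.mul_const _).mul (continuous_euclNorm.measurable.pow_const _)).ennreal_ofReal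
    exact h2.aemeasurable.mul (h1.pow_const q)
  have hw0 : ∫⁻ x in E, w x ≠ 0 := by
    intro h0
    rw [lintegral_eq_zero_iff' hwm] at h0
    have h1 : ∀ᵐ x ∂(volume.restrict E), False := by
      filter_upwards [h0, ae_restrict_mem hEo.measurableSet] with x hx hxE
      have h2 : 0 < x.2 := hxE.1
      have h3 := euclNorm_pos (hEU hxE)
      have h4 : 0 < x.2 * 2 ^ (-D) * euclNorm x ^ (-β) := by positivity
      have h5 := ENNReal.rpow_pos_of_nonneg (huv.pos_v x (hEU hxE)) hq.le
      simp only [hw, Pi.zero_apply, mul_eq_zero, ENNReal.ofReal_eq_zero] at hx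
      rcases hx with hx | hx
      · linarith
      · exact h5.ne' hx
    simp only [ae_iff, not_false_eq_true, Set.ofPred_true, Measure.restrict_apply_univ] at h1
    exact hEpos h1
  have hP : ∀ x ∈ E, ∀ ξ : Boundary n, ∀ t : ℝ, 1 ≤ t → ‖ξ‖ ≤ t →
      x.2 * 2 ^ (-D) * t ^ (-D) ≤ fracPoisson γ x ξ := by
    intro x hx ξ t ht hξ
    have hx0 : 0 < x.2 := hx.1
    rw [fracPoisson_eq, mul_assoc, ← Real.mul_rpow (by norm_num) (by linarith)]
    refine mul_le_mul_of_nonneg_left ?_ hx0.le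
    refine Real.rpow_le_rpow_of_nonpos (bdryDist_pos (hEU hx) ξ) ?_ (by linarith)
    have h1 := bdryDist_le_add x ξ 0
    rw [bdryDist_zero, zero_sub, norm_neg] at h1
    linarith [hx.2]
  have hu : ∀ ξ : Boundary n, ξ ≠ 0 → ∀ t : ℝ, 1 ≤ t → ‖ξ‖ ≤ t →
      (∫⁻ x in E, w x) * ENNReal.ofReal (‖ξ‖ ^ (-α) * t ^ (-D)) ≤ u ξ := by
    intro ξ hξ t ht hξt
    rw [huv.eq_u ξ hξ, mul_comm, ← lintegral_const_mul' _ _ (by simp)]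
    refine le_trans (setLIntegral_mono' hEo.measurableSet fun x hx => ?_) (lintegral_mono_set hEU)
    have h3 := euclNorm_pos (hEU hx)
    rw [hw, ← mul_assoc, ← ENNReal.ofReal_mul (by positivity)]
    refine mul_le_mul_left (ENNReal.ofReal_le_ofReal ?_) _
    calc ‖ξ‖ ^ (-α) * t ^ (-D) * (x.2 * 2 ^ (-D) * euclNorm x ^ (-β))
        = ‖ξ‖ ^ (-α) * (x.2 * 2 ^ (-D) * t ^ (-D)) * euclNorm x ^ (-β) := by ring
      _ ≤ _ := by
        gcongr
        exact hP x hx ξ t ht hξt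
  -- The minimum with `1` keeps the constant finite; the integral over `E` may be infinite.
  refine ⟨min 1 (∫⁻ x in E, w x), ?_, ne_top_of_le_ne_top ENNReal.one_ne_top (min_le_left _ _), ?_, ?_⟩
  · rw [← pos_iff_ne_zero]; exact lt_min one_pos (pos_iff_ne_zero.2 hw0)
  · intro ξ hξ h1
    refine le_trans ?_ (hu ξ hξ 1 le_rfl h1)
    rw [Real.one_rpow, mul_one]
    gcongr
    exact min_le_right _ _
  · intro ξ h1
    have hξ : ξ ≠ 0 := by
      rintro rfl
      rw [norm_zero] at h1; linarith
    refine le_trans ?_ (hu ξ hξ ‖ξ‖ h1 le_rfl)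
    rw [← Real.rpow_add (norm_pos_iff.2 hξ), ← neg_add]
    gcongr
    exact min_le_right _ _

theorem lower_bound_annulus {s r : ℝ} (hp : 0 < p + 1) (hs : 0 ≤ s) (hr : 0 < r)
    (h : r ^ (-((n : ℝ) - 1)) ≤ r ^ (-(s * (p + 1)))) {c : ℝ≥0∞} {ξ : Boundary n} (h1 : r ≤ ‖ξ‖)
    (h2 : ‖ξ‖ ≤ 2 * r) (hu : c * ENNReal.ofReal (‖ξ‖ ^ (-s)) ≤ u ξ) :
    c ^ (p + 1) * ENNReal.ofReal (2 ^ (-(s * (p + 1)))) * ENNReal.ofReal (r ^ (-((n : ℝ) - 1))) ≤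
      u ξ ^ (p + 1) := by
  have hξ : 0 < ‖ξ‖ := by linarith
  refine le_trans ?_ (ENNReal.rpow_le_rpow hu hp.le)
  rw [ENNReal.mul_rpow_of_nonneg _ _ hp.le, ENNReal.ofReal_rpow_of_nonneg (by positivity) hp.le,
    mul_assoc, ← ENNReal.ofReal_mul (by positivity), ← Real.rpow_mul hξ.le]
  gcongr
  calc (2 : ℝ) ^ (-(s * (p + 1))) * r ^ (-((n : ℝ) - 1))
      ≤ 2 ^ (-(s * (p + 1))) * r ^ (-(s * (p + 1))) := by gcongr
    _ = (2 * r) ^ (-(s * (p + 1))) := by rw [Real.mul_rpow (by norm_num) hr.le]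
    _ ≤ ‖ξ‖ ^ (-(s * (p + 1))) :=
        Real.rpow_le_rpow_of_nonpos hξ h2 (by nlinarith)
    _ = ‖ξ‖ ^ (-s * (p + 1)) := by ring_nf

/-- Otherwise `u^{p+1} ≳ |ξ|^{-α(p+1)}` would not be integrable at the origin. In terms of the
scaled system this is `δ₂ > 0`. -/
theorem alpha_lt (huv : IsPositiveSolution α β γ p q u v) (hn : 2 ≤ n) (hγ : γ < n) (hα : 0 ≤ α)
    (hp : 0 < p) (hq : 0 < q) : α * (p + 1) < (n : ℝ) - 1 := by
  by_contra hcon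
  rw [not_lt] at hcon
  obtain ⟨c, hc0, hct, hc, -⟩ := huv.exists_lower_bound hγ hq
  have hp1 : 0 < p + 1 := by linarith
  -- The radii start at `1/2`, so that each annulus, reaching up to twice its radius, stays in the
  -- unit ball.
  refine huv.memLp_u.lintegral_rpow_ne_top hp1 (lintegral_eq_top_of_annuli hn
    (huv.memLp_u.1.aemeasurable.pow_const _) (r := fun k => (1 / 2) ^ (k + 1)) (fun k => by positivity)
    ?_ (c := c ^ (p + 1) * ENNReal.ofReal (2 ^ (-(α * (p + 1))))) ?_ ?_)
  · intro ξ hξ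
    have h1 : Tendsto (fun k : ℕ => 2 * ((1 : ℝ) / 2) ^ (k + 1)) atTop (𝓝 (2 * 0)) :=
      ((tendsto_pow_atTop_nhds_zero_of_lt_one (by norm_num) (by norm_num)).comp
        (tendsto_add_atTop_nat 1)).const_mul 2
    rw [mul_zero] at h1
    filter_upwards [h1.eventually_lt_const (norm_pos_iff.2 hξ)] with k hk
    exact fun h => absurd h.2 (not_le.2 hk)
  · have : (0 : ℝ) < 2 ^ (-(α * (p + 1))) := by positivity
    simp [ENNReal.rpow_eq_zero_iff, hc0, hct, this]
  · intro k ξ h1 h2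
    have hr : (0 : ℝ) < (1 / 2) ^ (k + 1) := by positivity
    have hr1 : ((1 : ℝ) / 2) ^ k ≤ 1 := pow_le_one₀ (by norm_num) (by norm_num)
    have hξ : 0 < ‖ξ‖ := by linarith
    refine lower_bound_annulus hp1 hα hr ?_ h1 h2 (hc ξ (norm_pos_iff.1 hξ) ?_)
    · exact Real.rpow_le_rpow_of_exponent_ge hr (by rw [pow_succ]; linarith) (by linarith)
    · rw [pow_succ] at h2; linarith

/-- Otherwise `u^{p+1}` would not be integrable at infinity. In terms of the scaled system this is
`δ₁ > 0`. -/
theorem lt_alpha_add (huv : IsPositiveSolution α β γ p q u v) (hn : 2 ≤ n) (hγ : γ < n)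
    (hα : 0 ≤ α) (hp : 0 < p) (hq : 0 < q) :
    (n : ℝ) - 1 < (α + ((n : ℝ) + 2 - γ)) * (p + 1) := by
  by_contra hcon
  rw [not_lt] at hcon
  obtain ⟨c, hc0, hct, -, hc⟩ := huv.exists_lower_bound hγ hq
  have hp1 : 0 < p + 1 := by linarith
  refine huv.memLp_u.lintegral_rpow_ne_top hp1 (lintegral_eq_top_of_annuli hn
    (huv.memLp_u.1.aemeasurable.pow_const _) (r := fun k => 2 ^ k) (fun k => by positivity)
    ?_ (c := c ^ (p + 1) * ENNReal.ofReal (2 ^ (-((α + ((n : ℝ) + 2 - γ)) * (p + 1))))) ?_ ?_)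
  · intro ξ hξ
    have h1 : Tendsto (fun k : ℕ => (2 : ℝ) ^ k) atTop atTop :=
      tendsto_pow_atTop_atTop_of_one_lt (by norm_num)
    filter_upwards [h1.eventually_gt_atTop ‖ξ‖] with k hk
    exact fun h => absurd h.1 (not_le.2 hk)
  · have : (0 : ℝ) < 2 ^ (-((α + ((n : ℝ) + 2 - γ)) * (p + 1))) := by positivity
    simp [ENNReal.rpow_eq_zero_iff, hc0, hct, this]
  · intro k ξ h1 h2
    have hr1 : (1 : ℝ) ≤ 2 ^ k := one_le_pow₀ (by norm_num)
    refine lower_bound_annulus hp1 (by linarith) (by positivity) ?_ h1 h2 (hc ξ (by linarith))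
    exact Real.rpow_le_rpow_of_exponent_le hr1 (by linarith)

/-- Exponent bookkeeping: `A(q+1) = n` and `B(p+1) = n-1` make the powers absorbed by `f`, `g`, the
kernel and the measures cancel to `|x|^{-β}` and `|ξ|^{-α}`. -/
theorem scaledSystem (huv : IsPositiveSolution α β γ p q u v) (hp : 0 < p) (hq : 0 < q) (hn : 2 ≤ n)
    {A B δ₁ δ₂ : ℝ} (hA : A * (q + 1) = n) (hB : B * (p + 1) = (n : ℝ) - 1) (h1 : δ₁ = A - β + 1)
    (h2 : δ₂ = B - α) (hD : δ₁ + δ₂ = (n : ℝ) + 2 - γ) :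
    ScaledSystem δ₁ δ₂ p q (fun ξ : Boundary n => u ξ * ENNReal.ofReal (‖ξ‖ ^ B))
      (fun x => v x * ENNReal.ofReal (euclNorm x ^ A)) := by
  have := nontrivial_boundary hn
  have hp1 : 0 < p + 1 := by linarith
  have hq1 : 0 < q + 1 := by linarith
  have mu : AEMeasurable u := huv.memLp_u.1.aemeasurable
  have mv : AEMeasurable v (volume.restrict (upperHalf n)) := huv.memLp_v.1.aemeasurable
  have mf : AEMeasurable fun ξ : Boundary n => u ξ * ENNReal.ofReal (‖ξ‖ ^ B) :=
    mu.mul (measurable_norm.pow_const _).ennreal_ofReal.aemeasurable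
  have mg : AEMeasurable (fun x => v x * ENNReal.ofReal (euclNorm x ^ A))
      (volume.restrict (upperHalf n)) :=
    mv.mul (continuous_euclNorm.measurable.pow_const _).ennreal_ofReal.aemeasurable
  refine ⟨mf.mono_ac (withDensity_absolutelyContinuous _ _),
    mg.mono_ac (withDensity_absolutelyContinuous _ _), ?_, ?_, ?_, ?_⟩
  · rw [lintegral_bdryMeasure (mf.pow_const _)]
    refine ne_top_of_le_ne_top (huv.memLp_u.lintegral_rpow_ne_top hp1) (le_of_eq ?_)
    refine lintegral_congr_ae ?_
    filter_upwards [Measure.ae_ne volume (0 : Boundary n)] with ξ hξ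
    have hξ0 := norm_pos_iff.2 hξ
    rw [ENNReal.mul_rpow_of_nonneg _ _ hp1.le, ENNReal.ofReal_rpow_of_pos (by positivity), mul_assoc,
      ← ENNReal.ofReal_mul (by positivity), ← Real.rpow_mul hξ0.le, ← Real.rpow_add hξ0, hB,
      add_neg_cancel, Real.rpow_zero, ENNReal.ofReal_one, mul_one]
  · rw [lintegral_halfMeasure (mg.pow_const _)]
    refine ne_top_of_le_ne_top (huv.memLp_v.lintegral_rpow_ne_top hq1) (le_of_eq ?_)
    refine setLIntegral_congr_fun measurableSet_upperHalf fun x hx => ?_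
    have hx0 := euclNorm_pos hx
    rw [ENNReal.mul_rpow_of_nonneg _ _ hq1.le, ENNReal.ofReal_rpow_of_pos (by positivity), mul_assoc,
      ← ENNReal.ofReal_mul (by positivity), ← Real.rpow_mul hx0.le, ← Real.rpow_add hx0, hA,
      add_neg_cancel, Real.rpow_zero, ENNReal.ofReal_one, mul_one]
  · intro ξ hξ
    have hξ0 := norm_pos_iff.2 hξ
    have hm : AEMeasurable (fun x => scaledKernel δ₁ δ₂ x ξ *
        (v x * ENNReal.ofReal (euclNorm x ^ A)) ^ q) (volume.restrict (upperHalf n)) :=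
      (measurable_scaledKernel_left ξ).aemeasurable.mul (mg.pow_const q)
    rw [lintegral_halfMeasure hm, huv.eq_u ξ hξ, mul_comm, ← lintegral_const_mul' _ _ (by simp)]
    refine setLIntegral_congr_fun measurableSet_upperHalf fun x hx => ?_
    have hx0 := euclNorm_pos hx
    have hx2 : 0 < x.2 := hx
    have hρ := bdryDist_pos hx ξ
    rw [ENNReal.mul_rpow_of_nonneg _ _ hq.le, ENNReal.ofReal_rpow_of_pos (by positivity),
      scaledKernel, ← mul_assoc, ← ENNReal.ofReal_mul (by positivity),
      show ∀ a b c d : ℝ≥0∞, a * (b * c) * d = a * c * d * b from fun a b c d => by ring,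
      ← ENNReal.ofReal_mul (by positivity),
      ← ENNReal.ofReal_mul (by positivity), fracPoisson_eq, hD, ← Real.rpow_mul hx0.le]
    congr 2
    have e1 : ‖ξ‖ ^ B * ‖ξ‖ ^ (-α) = ‖ξ‖ ^ δ₂ := by
      rw [← Real.rpow_add hξ0, h2, sub_eq_add_neg]
    have e2 : euclNorm x ^ (δ₁ - 1) * euclNorm x ^ (A * q) * euclNorm x ^ (-(n : ℝ)) =
        euclNorm x ^ (-β) := by
      rw [← Real.rpow_add hx0, ← Real.rpow_add hx0]
      congr 1; rw [h1, ← hA]; ring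
    rw [← e1, ← e2]; ring
  · intro x hx
    have hx0 := euclNorm_pos hx
    have hx2 : 0 < x.2 := hx
    have hm : AEMeasurable (fun ξ : Boundary n => scaledKernel δ₁ δ₂ x ξ *
        (u ξ * ENNReal.ofReal (‖ξ‖ ^ B)) ^ p) :=
      (measurable_scaledKernel_right x).aemeasurable.mul (mf.pow_const p)
    rw [lintegral_bdryMeasure hm, huv.eq_v x hx, mul_comm, ← lintegral_const_mul' _ _ (by simp)]
    refine lintegral_congr_ae ?_
    filter_upwards [Measure.ae_ne volume (0 : Boundary n)] with ξ hξ
    have hξ0 := norm_pos_iff.2 hξ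
    have hρ := bdryDist_pos hx ξ
    rw [ENNReal.mul_rpow_of_nonneg _ _ hp.le, ENNReal.ofReal_rpow_of_pos (by positivity),
      scaledKernel, ← mul_assoc, ← ENNReal.ofReal_mul (by positivity),
      show ∀ a b c d : ℝ≥0∞, a * (b * c) * d = a * c * d * b from fun a b c d => by ring,
      ← ENNReal.ofReal_mul (by positivity),
      ← ENNReal.ofReal_mul (by positivity), fracPoisson_eq, hD, ← Real.rpow_mul hξ0.le]
    congr 2
    have e1 : euclNorm x ^ A * euclNorm x ^ (-β) = euclNorm x ^ (δ₁ - 1) := by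
      rw [← Real.rpow_add hx0, h1]; ring_nf
    have e2 : ‖ξ‖ ^ δ₂ * ‖ξ‖ ^ (B * p) * ‖ξ‖ ^ (-((n : ℝ) - 1)) = ‖ξ‖ ^ (-α) := by
      rw [← Real.rpow_add hξ0, ← Real.rpow_add hξ0]
      congr 1; rw [h2, ← hB]; ring
    rw [← e1, ← e2]; ring

end IsPositiveSolution

/-! ### Boundedness and decay of the scaled solution -/

instance sFinite_bdryMeasure (n : ℕ) : SFinite (bdryMeasure n) := by
  unfold bdryMeasure; infer_instance

instance sFinite_halfMeasure (n : ℕ) : SFinite (halfMeasure n) := by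
  unfold halfMeasure; infer_instance

namespace ScaledSystem

variable {n : ℕ} {δ₁ δ₂ p q : ℝ} {f : Boundary n → ℝ≥0∞} {g : Ambient n → ℝ≥0∞}

/-- The natural tail exponents `a = (n-1)/l`, `b = n/l` give `a/(p+1) + b/(q+1) ≥ 1` by `hscale`,
whereas `a = b = 1` gives a value below `1` because `p, q > 1`. Interpolation between the two
attains the critical value `1`. -/
theorem ae_bounded (h : ScaledSystem δ₁ δ₂ p q f g) (hn : 2 ≤ n) (hδ₁ : 0 < δ₁) (hδ₂ : 0 < δ₂)
    (hD : 1 < δ₁ + δ₂) (hDn : δ₁ + δ₂ ≤ n) (hp : 1 < p) (hq : 1 < q)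
    (hscale : δ₁ + δ₂ - 1 ≤ ((n : ℝ) - 1) / (p + 1) + n / (q + 1)) :
    ∃ M : ℝ≥0∞, M ≠ ∞ ∧ ∀ᵐ x ∂(halfMeasure n), g x ≤ M := by
  set l : ℝ := δ₁ + δ₂ - 1 with hl
  have hl0 : 0 < l := by linarith
  set s₀ : ℝ := 1 / (p + 1) + 1 / (q + 1) with hs₀
  set t : ℝ := ((n : ℝ) - 1 - l) / l / (p + 1) + ((n : ℝ) - l) / l / (q + 1) with ht
  have hs1 : s₀ < 1 := by
    have h1 : 1 / (p + 1) < 1 / 2 := one_div_lt_one_div_of_lt (by norm_num) (by linarith)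
    have h2 : 1 / (q + 1) < 1 / 2 := one_div_lt_one_div_of_lt (by norm_num) (by linarith)
    linarith
  have hst : 1 ≤ s₀ + t := by
    have : s₀ + t = (((n : ℝ) - 1) / (p + 1) + n / (q + 1)) / l := by
      rw [hs₀, ht]; field_simp; ring
    rw [this, one_le_div hl0]; exact hscale
  have ht0 : 0 < t := by linarith
  -- The interpolation parameter: `s₀ + θ t = 1`. It is positive, so that `b > 1` strictly, while `a
  -- = 1` remains possible when `D = n`.
  set θ : ℝ := (1 - s₀) / t with hθ
  have hθ0 : 0 < θ := div_pos (by linarith) ht0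
  have hθ1 : θ ≤ 1 := (div_le_one ht0).2 (by linarith)
  have ha0 : 0 ≤ θ * (((n : ℝ) - 1 - l) / l) :=
    mul_nonneg hθ0.le (div_nonneg (by linarith) hl0.le)
  have hb0 : 0 < θ * (((n : ℝ) - l) / l) := mul_pos hθ0 (div_pos (by linarith) hl0)
  have hal : θ * (((n : ℝ) - 1 - l) / l) * l ≤ n - (δ₁ + δ₂) := by
    rw [mul_assoc, div_mul_cancel₀ _ hl0.ne']
    nlinarith
  have hbl : θ * (((n : ℝ) - l) / l) * l ≤ n - (δ₁ + δ₂) + 1 := by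
    rw [mul_assoc, div_mul_cancel₀ _ hl0.ne']
    nlinarith
  obtain ⟨C₁, hC₁, hrow⟩ := exists_lintegral_row_tail_le hn hδ₁ hδ₂ hD hDn ha0 hal
  obtain ⟨C₂, hC₂, hcol⟩ := exists_lintegral_col_tail_le hn hδ₁ hδ₂ hD hDn hb0.le hbl
  set f' := h.aemeas_f.mk f
  set g' := h.aemeas_g.mk g
  have hff : f =ᵐ[bdryMeasure n] f' := h.aemeas_f.ae_eq_mk
  have hgg : g =ᵐ[halfMeasure n] g' := h.aemeas_g.ae_eq_mk
  have hsum : (1 + θ * (((n : ℝ) - 1 - l) / l)) / (p + 1) +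
      (1 + θ * (((n : ℝ) - l) / l)) / (q + 1) = 1 := by
    have : (1 + θ * (((n : ℝ) - 1 - l) / l)) / (p + 1) +
      (1 + θ * (((n : ℝ) - l) / l)) / (q + 1) = s₀ + θ * t := by rw [hs₀, ht]; ring
    rw [this, hθ, div_mul_cancel₀ _ ht0.ne']; ring
  obtain ⟨M, hM, -, hgM⟩ := ae_bounded_of_integral_system (K := scaledKernel (n := n) δ₁ δ₂)
    measurable_scaledKernel (f := f') (g := g') h.aemeas_f.measurable_mk h.aemeas_g.measurable_mk
    (a := 1 + θ * (((n : ℝ) - 1 - l) / l)) (b := 1 + θ * (((n : ℝ) - l) / l)) (p := p) (q := q)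
    (by linarith) (by linarith) (by linarith) (by linarith) hsum
    (C := C₁ + C₂) (by simp [hC₁, hC₂])
    (fun x t h0 ht => by
      rw [sub_add_cancel_left]
      exact (hrow x t h0 ht).trans (mul_le_mul_left le_self_add _))
    (fun x t h0 ht => by
      rw [sub_add_cancel_left]
      exact (hcol x t h0 ht).trans (mul_le_mul_left le_add_self _))
    (by
      filter_upwards [hff, ae_bdryMeasure_ne_zero hn] with ξ h1 h2
      rw [← h1, h.eq_f ξ h2]
      exact lintegral_congr_ae (hgg.mono fun x hx => by simp only; rw [hx]))
    (by
      filter_upwards [hgg, ae_halfMeasure_mem] with x h1 h2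
      rw [← h1, h.eq_g x h2]
      exact lintegral_congr_ae (hff.mono fun x hx => by simp only; rw [hx]))
    (by
      rw [← lintegral_congr_ae (hff.mono fun x hx => congrArg (· ^ (p + 1)) hx)]
      exact h.lintegral_f)
    (by
      rw [← lintegral_congr_ae (hgg.mono fun x hx => congrArg (· ^ (q + 1)) hx)]
      exact h.lintegral_g)
  exact ⟨M, hM, by filter_upwards [hgg, hgM] with x h1 h2; rw [h1]; exact h2⟩

/-- The almost everywhere bound on `g` is inserted into the equations, which hold at every point;
the kernel has bounded total mass in each variable. -/
theorem bounded (h : ScaledSystem δ₁ δ₂ p q f g) (hn : 2 ≤ n) (hδ₁ : 0 < δ₁) (hδ₂ : 0 < δ₂)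
    (hD : 1 < δ₁ + δ₂) (hDn : δ₁ + δ₂ ≤ n) (hp : 1 < p) (hq : 1 < q)
    (hscale : δ₁ + δ₂ - 1 ≤ ((n : ℝ) - 1) / (p + 1) + n / (q + 1)) :
    ∃ M : ℝ≥0∞, M ≠ ∞ ∧ (∀ ξ, ξ ≠ 0 → f ξ ≤ M) ∧ ∀ x ∈ upperHalf n, g x ≤ M := by
  obtain ⟨M, hM, hg⟩ := h.ae_bounded hn hδ₁ hδ₂ hD hDn hp hq hscale
  obtain ⟨C, hC, hcol⟩ := exists_lintegral_col_le hn hδ₁ hδ₂ hDn (σ := 0) (by linarith) hδ₂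
  obtain ⟨C', hC', hrow⟩ := exists_lintegral_row_le hn hδ₁ hδ₂ hDn (σ := 0) (by linarith) hδ₁
  simp only [Real.rpow_zero, ENNReal.ofReal_one, mul_one] at hcol hrow
  have hp0 : 0 ≤ p := by linarith
  have hq0 : 0 ≤ q := by linarith
  have hMq : M ^ q ≠ ∞ := ENNReal.rpow_ne_top_of_nonneg hq0 hM
  have hf : ∀ ξ, ξ ≠ 0 → f ξ ≤ C * M ^ q := by
    intro ξ hξ
    calc f ξ = ∫⁻ x, scaledKernel δ₁ δ₂ x ξ * g x ^ q ∂(halfMeasure n) := h.eq_f ξ hξ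
      _ ≤ ∫⁻ x, scaledKernel δ₁ δ₂ x ξ * M ^ q ∂(halfMeasure n) := by
          refine lintegral_mono_ae ?_
          filter_upwards [hg] with x hx
          gcongr
      _ ≤ _ := by
          rw [lintegral_mul_const' _ _ hMq]
          gcongr
          exact hcol ξ hξ
  have hMp : (C * M ^ q) ^ p ≠ ∞ := ENNReal.rpow_ne_top_of_nonneg hp0 (ENNReal.mul_ne_top hC hMq)
  refine ⟨max (C * M ^ q) (C' * (C * M ^ q) ^ p), ?_, fun ξ hξ => (hf ξ hξ).trans (le_max_left _ _),
    fun x hx => le_trans ?_ (le_max_right _ _)⟩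
  · simp only [ne_eq, max_eq_top, not_or]
    exact ⟨ENNReal.mul_ne_top hC hMq, ENNReal.mul_ne_top hC' hMp⟩
  · calc g x = ∫⁻ ξ, scaledKernel δ₁ δ₂ x ξ * f ξ ^ p ∂(bdryMeasure n) := h.eq_g x hx
      _ ≤ ∫⁻ ξ, scaledKernel δ₁ δ₂ x ξ * (C * M ^ q) ^ p ∂(bdryMeasure n) := by
          refine lintegral_mono_ae ?_
          filter_upwards [ae_bdryMeasure_ne_zero hn] with ξ hξ
          gcongr
          exact hf ξ hξ
      _ ≤ _ := by
          rw [lintegral_mul_const' _ _ hMp]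
          gcongr
          exact hrow x hx

theorem exists_lintegral_ball_le (hg : AEMeasurable g (halfMeasure n)) {r : ℝ}
    (hgr : ∫⁻ x, g x ^ r ∂(halfMeasure n) ≠ ∞) {ε : ℝ≥0∞} (hε : ε ≠ 0) :
    ∃ t : ℝ, 0 < t ∧ ∫⁻ x in {x | euclNorm x < t}, g x ^ r ∂(halfMeasure n) ≤ ε := by
  have hms : ∀ t : ℝ, MeasurableSet {x : Ambient n | euclNorm x < t} := fun t =>
    measurableSet_lt continuous_euclNorm.measurable measurable_const
  have h1 : Tendsto (fun k : ℕ => ∫⁻ x, {x | euclNorm x < 1 / ((k : ℝ) + 1)}.indicator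
      (fun x => g x ^ r) x ∂(halfMeasure n)) atTop (𝓝 (∫⁻ _, 0 ∂(halfMeasure n))) := by
    refine tendsto_lintegral_of_dominated_convergence' (fun x => g x ^ r)
      (fun k => (hg.pow_const r).indicator (hms _)) (fun k => ae_of_all _ fun x =>
        Set.indicator_le_self _ _ _) hgr ?_
    filter_upwards [ae_halfMeasure_mem] with x hx
    refine tendsto_const_nhds.congr' ?_
    filter_upwards [tendsto_one_div_add_atTop_nhds_zero_nat.eventually_lt_const (euclNorm_pos hx)]
      with k hk
    rw [Set.indicator_of_notMem]
    exact not_lt.2 hk.le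
  rw [lintegral_zero] at h1
  obtain ⟨k, hk⟩ := (h1.eventually_lt_const (pos_iff_ne_zero.2 hε)).exists
  refine ⟨1 / ((k : ℝ) + 1), by positivity, ?_⟩
  rw [lintegral_indicator (hms _)] at hk
  exact hk.le

/-- For `|x| < t` the energy of `g` is small, and the truncated estimate makes its contribution to
`f` small uniformly in `ξ`. For `|x| ≥ t` the bound on `g` and the decay of the kernel as `ξ → 0`
are enough. -/
theorem exists_small_near_zero (h : ScaledSystem δ₁ δ₂ p q f g) (hn : 2 ≤ n) (hδ₁ : 0 < δ₁)
    (hδ₂ : 0 < δ₂) (hD : 1 < δ₁ + δ₂) (hDn : δ₁ + δ₂ ≤ n) (hq : 1 < q) {M : ℝ≥0∞} (hM : M ≠ ∞)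
    (hgM : ∀ x ∈ upperHalf n, g x ≤ M) {η : ℝ≥0∞} (hη : η ≠ 0) :
    ∃ r : ℝ, 0 < r ∧ ∀ ξ, ξ ≠ 0 → ‖ξ‖ < r → f ξ ≤ η := by
  have hl0 : 0 < δ₁ + δ₂ - 1 := by linarith
  have hq0 : 0 < q := by linarith
  -- Any positive `e` within the tail range and below `q` would do; no critical relation is needed
  -- here since `g` is already bounded.
  set e : ℝ := min (q / 2) (((n : ℝ) - (δ₁ + δ₂) + 1) / (δ₁ + δ₂ - 1)) with he
  have he0 : 0 < e := lt_min (by linarith) (div_pos (by linarith) hl0)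
  have heD : e * (δ₁ + δ₂ - 1) ≤ n - (δ₁ + δ₂) + 1 := by
    rw [← le_div_iff₀ hl0]; exact min_le_right _ _
  have heq : 1 + e < q + 1 := by
    have := min_le_left (q / 2) (((n : ℝ) - (δ₁ + δ₂) + 1) / (δ₁ + δ₂ - 1))
    rw [← he] at this; linarith
  obtain ⟨C, hC, hcol⟩ := exists_lintegral_col_tail_le hn hδ₁ hδ₂ hD hDn he0.le heD
  obtain ⟨c, hc, htr⟩ := exists_lintegral_mul_rpow_truncated_le (a := 1 + e) (p := q) (by linarith)
    hq0 heq
  -- A level above the bound of `g`, so that the truncation removes only a null set; the `1` ensures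
  -- that it is nonzero.
  set S : ℝ≥0∞ := M + 1 with hS
  have hS0 : S ≠ 0 := by simp [hS]
  have hSt : S ≠ ∞ := by simp [hS, hM]
  set κ : ℝ := (q + 1) / (1 + e) - 1
  have hSκ0 : S ^ κ ≠ 0 := by simp [ENNReal.rpow_eq_zero_iff, hS0, hSt]
  have hSκt : S ^ κ ≠ ∞ := ENNReal.rpow_ne_top_of_ne_zero hS0 hSt
  have hη3 : η / 3 ≠ 0 := by simp [ENNReal.div_eq_zero_iff, hη]
  obtain ⟨L, hL0, hLt, hL⟩ := ENNReal.exists_mul_rpow_neg_le (C := c * C * S ^ κ) (s := 1 - (1 + e))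
    (ENNReal.mul_ne_top (ENNReal.mul_ne_top hc hC) hSκt) hη3 (by linarith)
  set g' := h.aemeas_g.mk g
  have hgg : g =ᵐ[halfMeasure n] g' := h.aemeas_g.ae_eq_mk
  have hg'm : Measurable g' := h.aemeas_g.measurable_mk
  have hg'M : ∀ᵐ x ∂(halfMeasure n), g' x ≤ M := by
    filter_upwards [hgg, ae_halfMeasure_mem] with x h1 h2
    rw [← h1]; exact hgM x h2
  obtain ⟨t, ht, htint⟩ := exists_lintegral_ball_le (g := g') hg'm.aemeasurable (r := q + 1) (by
      rw [← lintegral_congr_ae (hgg.mono fun x hx => congrArg (· ^ (q + 1)) hx)]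
      exact h.lintegral_g) (ε := η / 3 / (L * S ^ κ))
    (by simp [ENNReal.div_eq_zero_iff, hη, ENNReal.mul_eq_top, hL0, hLt, hSκ0, hSκt])
  -- For `|x| ≥ t` one has `1 ≤ (|x|/t)^{δ₂/2}`, and the bound for the power `δ₂/2` supplies a
  -- factor `|ξ|^{δ₂/2}`.
  obtain ⟨C', hC', hcol'⟩ := exists_lintegral_col_le hn hδ₁ hδ₂ hDn (σ := δ₂ / 2) (by linarith)
    (by linarith)
  have hσ : 0 < δ₂ / 2 := by linarith
  -- radius for the contribution of `|x| ≥ t`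
  have hlim : Tendsto (fun r : ℝ => M ^ q * ENNReal.ofReal (t ^ (-(δ₂ / 2))) * C' *
      ENNReal.ofReal (r ^ (δ₂ / 2))) (𝓝[>] 0) (𝓝 0) := by
    have h1 : Tendsto (fun r : ℝ => ENNReal.ofReal (r ^ (δ₂ / 2))) (𝓝[>] 0) (𝓝 0) := by
      have := ENNReal.tendsto_ofReal
        ((Real.continuousAt_rpow_const 0 (δ₂ / 2) (Or.inr hσ.le)).tendsto)
      rw [Real.zero_rpow hσ.ne', ENNReal.ofReal_zero] at this
      exact this.mono_left nhdsWithin_le_nhds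
    have h2 := ENNReal.Tendsto.const_mul h1 (a := M ^ q * ENNReal.ofReal (t ^ (-(δ₂ / 2))) * C')
      (Or.inr (ENNReal.mul_ne_top (ENNReal.mul_ne_top (ENNReal.rpow_ne_top_of_nonneg hq0.le hM)
        (by simp)) hC'))
    rwa [mul_zero] at h2
  obtain ⟨r, hr1, hr0⟩ := ((hlim.eventually_lt_const (pos_iff_ne_zero.2 hη3)).and
    self_mem_nhdsWithin).exists
  have hr0' : 0 < r := hr0
  refine ⟨r, hr0', fun ξ hξ hξr => ?_⟩
  have hms : MeasurableSet {x : Ambient n | euclNorm x < t} :=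
    measurableSet_lt continuous_euclNorm.measurable measurable_const
  set g₁ : Ambient n → ℝ≥0∞ := {x | euclNorm x < t}.indicator g' with hg₁
  have hg₁m : Measurable g₁ := hg'm.indicator hms
  have near : ∫⁻ x in {x | euclNorm x < t}, scaledKernel δ₁ δ₂ x ξ * g x ^ q ∂(halfMeasure n) ≤
      η / 3 + η / 3 := by
    calc _ ≤ ∫⁻ x in {x | g₁ x ≤ S}, scaledKernel δ₁ δ₂ x ξ * g₁ x ^ q ∂(halfMeasure n) := by
          rw [← lintegral_indicator hms, ← lintegral_indicator (measurableSet_le hg₁m measurable_const)]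
          refine lintegral_mono_ae ?_
          filter_upwards [hgg, hg'M] with x h1 h2
          by_cases hx : x ∈ {x : Ambient n | euclNorm x < t}
          · have h3 : g₁ x = g' x := Set.indicator_of_mem hx _
            have h4 : x ∈ {x | g₁ x ≤ S} := by
              show g₁ x ≤ S
              rw [h3]; exact h2.trans le_self_add
            rw [Set.indicator_of_mem hx, Set.indicator_of_mem h4, h3, h1]
          · rw [Set.indicator_of_notMem hx]; exact zero_le
      _ ≤ (c * C * L ^ (1 - (1 + e)) + L * ∫⁻ x in {x | g₁ x ≤ S}, g₁ x ^ (q + 1) ∂(halfMeasure n)) *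
            S ^ κ := by
          refine htr (halfMeasure n) (fun x => scaledKernel δ₁ δ₂ x ξ) g₁ C
            (measurable_scaledKernel_left ξ) hg₁m (fun t h0 ht => ?_) L S hL0 hLt hS0 hSt
          rw [sub_add_cancel_left]
          exact hcol ξ t h0 ht
      _ ≤ (c * C * L ^ (1 - (1 + e)) + L * (η / 3 / (L * S ^ κ))) * S ^ κ := by
          gcongr
          refine le_trans ((setLIntegral_le_lintegral _ _).trans ?_) htint
          rw [← lintegral_indicator hms]
          refine lintegral_mono fun x => ?_
          by_cases hx : x ∈ {x : Ambient n | euclNorm x < t}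
          · simp [hg₁, hx]
          · simp [hg₁, hx, show 0 < q + 1 by linarith]
      _ = c * C * S ^ κ * L ^ (1 - (1 + e)) + L * S ^ κ * (η / 3 / (L * S ^ κ)) := by ring
      _ ≤ η / 3 + η / 3 := by
          refine add_le_add hL (le_of_eq ?_)
          exact ENNReal.mul_div_cancel (mul_ne_zero hL0 hSκ0) (ENNReal.mul_ne_top hLt hSκt)
  have far : ∫⁻ x in {x | euclNorm x < t}ᶜ, scaledKernel δ₁ δ₂ x ξ * g x ^ q ∂(halfMeasure n) ≤
      η / 3 := by
    calc _ ≤ ∫⁻ x, M ^ q * ENNReal.ofReal (t ^ (-(δ₂ / 2))) *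
          (scaledKernel δ₁ δ₂ x ξ * ENNReal.ofReal (euclNorm x ^ (δ₂ / 2))) ∂(halfMeasure n) := by
          rw [← lintegral_indicator hms.compl]
          refine lintegral_mono_ae ?_
          filter_upwards [ae_halfMeasure_mem] with x hx
          by_cases hxt : x ∈ {x : Ambient n | euclNorm x < t}ᶜ
          · rw [Set.indicator_of_mem hxt]
            have hxt' : t ≤ euclNorm x := not_lt.1 hxt
            have h1 : (1 : ℝ≥0∞) ≤ ENNReal.ofReal (t ^ (-(δ₂ / 2))) *
                ENNReal.ofReal (euclNorm x ^ (δ₂ / 2)) := by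
              rw [← ENNReal.ofReal_mul (by positivity), ENNReal.one_le_ofReal, mul_comm,
                Real.rpow_neg ht.le, ← div_eq_mul_inv, one_le_div (by positivity)]
              exact Real.rpow_le_rpow ht.le hxt' hσ.le
            calc scaledKernel δ₁ δ₂ x ξ * g x ^ q ≤ scaledKernel δ₁ δ₂ x ξ * M ^ q * 1 := by
                  rw [mul_one]
                  gcongr
                  exact hgM x hx
              _ ≤ scaledKernel δ₁ δ₂ x ξ * M ^ q * (ENNReal.ofReal (t ^ (-(δ₂ / 2))) *
                ENNReal.ofReal (euclNorm x ^ (δ₂ / 2))) := by gcongr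
              _ = _ := by ring
          · rw [Set.indicator_of_notMem hxt]; exact zero_le
      _ ≤ M ^ q * ENNReal.ofReal (t ^ (-(δ₂ / 2))) * (C' * ENNReal.ofReal (‖ξ‖ ^ (δ₂ / 2))) := by
          rw [lintegral_const_mul' _ _ (ENNReal.mul_ne_top
            (ENNReal.rpow_ne_top_of_nonneg hq0.le hM) (by simp))]
          gcongr
          exact hcol' ξ hξ
      _ ≤ M ^ q * ENNReal.ofReal (t ^ (-(δ₂ / 2))) * (C' * ENNReal.ofReal (r ^ (δ₂ / 2))) := by
          gcongr
      _ ≤ η / 3 := by rw [← mul_assoc]; exact hr1.le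
  rw [h.eq_f ξ hξ, ← lintegral_add_compl _ hms]
  calc _ ≤ η / 3 + η / 3 + η / 3 := add_le_add near far
    _ = η := ENNReal.add_thirds η

/-- Power decay at the origin of the scaled solution, at every rate below `min δ₁ δ₂`. -/
theorem exists_decay (h : ScaledSystem δ₁ δ₂ p q f g) (hn : 2 ≤ n) (hδ₁ : 0 < δ₁) (hδ₂ : 0 < δ₂)
    (hD : 1 < δ₁ + δ₂) (hDn : δ₁ + δ₂ ≤ n) (hp : 1 < p) (hq : 1 < q)
    (hscale : δ₁ + δ₂ - 1 ≤ ((n : ℝ) - 1) / (p + 1) + n / (q + 1)) {σ : ℝ} (hσ : 0 < σ)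
    (hσ₁ : σ < δ₁) (hσ₂ : σ < δ₂) :
    ∃ C : ℝ≥0∞, C ≠ ∞ ∧ (∀ ξ, ξ ≠ 0 → f ξ ≤ C * ENNReal.ofReal (‖ξ‖ ^ σ)) ∧
      ∀ x ∈ upperHalf n, g x ≤ C * ENNReal.ofReal (euclNorm x ^ σ) := by
  obtain ⟨M, hM, hfM, hgM⟩ := h.bounded hn hδ₁ hδ₂ hD hDn hp hq hscale
  have hp0 : 0 < p - 1 := by linarith
  have hq0 : 0 < q - 1 := by linarith
  obtain ⟨Ar, hAr, hrow0⟩ := exists_lintegral_row_le hn hδ₁ hδ₂ hDn (σ := 0) (by linarith) hδ₁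
  obtain ⟨Br, hBr, hrow1⟩ := exists_lintegral_row_le hn hδ₁ hδ₂ hDn (σ := σ) (by linarith) hσ₁
  obtain ⟨Ac, hAc, hcol0⟩ := exists_lintegral_col_le hn hδ₁ hδ₂ hDn (σ := 0) (by linarith) hδ₂
  obtain ⟨Bc, hBc, hcol1⟩ := exists_lintegral_col_le hn hδ₁ hδ₂ hDn (σ := σ) (by linarith) hσ₂
  simp only [Real.rpow_zero, ENNReal.ofReal_one, mul_one] at hrow0 hcol0
  -- The exponents `σ` and `0` are both admissible, so the kernel also preserves the weights `|·|^σ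
  -- + ε`, with a constant independent of `ε`.
  have hrow : ∀ x ∈ upperHalf n, ∀ ε : ℝ≥0∞, ε ≠ ∞ →
      ∫⁻ ξ, scaledKernel δ₁ δ₂ x ξ * (ENNReal.ofReal (‖ξ‖ ^ σ) + ε) ∂(bdryMeasure n) ≤
        (Ar + Br) * (ENNReal.ofReal (euclNorm x ^ σ) + ε) := by
    intro x hx ε hε
    simp only [mul_add]
    rw [lintegral_add_right _ ((measurable_scaledKernel_right x).mul_const ε),
      lintegral_mul_const' _ _ hε]
    refine add_le_add ((hrow1 x hx).trans ?_) ?_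
    · gcongr; exact le_add_self
    · gcongr; exact (hrow0 x hx).trans le_self_add
  have hcol : ∀ ξ, ξ ≠ 0 → ∀ ε : ℝ≥0∞, ε ≠ ∞ →
      ∫⁻ x, scaledKernel δ₁ δ₂ x ξ * (ENNReal.ofReal (euclNorm x ^ σ) + ε) ∂(halfMeasure n) ≤
        (Ac + Bc) * (ENNReal.ofReal (‖ξ‖ ^ σ) + ε) := by
    intro ξ hξ ε hε
    simp only [mul_add]
    rw [lintegral_add_right _ ((measurable_scaledKernel_left ξ).mul_const ε),
      lintegral_mul_const' _ _ hε]
    refine add_le_add ((hcol1 ξ hξ).trans ?_) ?_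
    · gcongr; exact le_add_self
    · gcongr; exact (hcol0 ξ hξ).trans le_self_add
  set Cr := Ar + Br
  set Cc := Ac + Bc
  have hCr : Cr ≠ ∞ := by simp [Cr, hAr, hBr]
  have hCc : Cc ≠ ∞ := by simp [Cc, hAc, hBc]
  have hMq : M ^ (q - 1) ≠ ∞ := ENNReal.rpow_ne_top_of_nonneg hq0.le hM
  have hMp : M ^ p ≠ ∞ := ENNReal.rpow_ne_top_of_nonneg (by linarith) hM
  set Q : ℝ≥0∞ := M ^ (q - 1) * (Cr * Cc) with hQ
  have hQt : Q ≠ ∞ := ENNReal.mul_ne_top hMq (ENNReal.mul_ne_top hCr hCc)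
  -- `L⁻¹` is the smallness required of `f` near the origin: then `f^{p-1} ≤ ζ` with `Q ζ ≤ 1/2`,
  -- where `Q` is the cost of one passage through both equations.
  obtain ⟨L, hL0, hLt, hL⟩ := ENNReal.exists_mul_rpow_neg_le (C := Q) (ε := 2⁻¹) (s := -(p - 1))
    hQt (by simp) (by linarith)
  obtain ⟨r, hr, hsmall⟩ := h.exists_small_near_zero hn hδ₁ hδ₂ hD hDn hq hM hgM (η := L⁻¹)
    (by simp [hLt])
  set ζ : ℝ≥0∞ := L⁻¹ ^ (p - 1) with hζ
  have hζQ : Q * ζ ≤ 2⁻¹ := by rwa [hζ, ENNReal.inv_rpow, ← ENNReal.rpow_neg]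
  have hζt : ζ ≠ ∞ := ENNReal.rpow_ne_top_of_nonneg hp0.le (by simp [hL0])
  set E : ℝ≥0∞ := M ^ p * ENNReal.ofReal (r ^ (-σ)) with hE
  have hEt : E ≠ ∞ := ENNReal.mul_ne_top hMp (by simp)
  have hout : ∀ s : ℝ, r ≤ s → (1 : ℝ≥0∞) ≤ ENNReal.ofReal (r ^ (-σ)) * ENNReal.ofReal (s ^ σ) := by
    intro s hs
    have hs0 : 0 < s := by linarith
    rw [← ENNReal.ofReal_mul (by positivity), ENNReal.one_le_ofReal, mul_comm,
      Real.rpow_neg hr.le, ← div_eq_mul_inv, one_le_div (by positivity)]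
    exact Real.rpow_le_rpow hr.le hs hσ.le
  have key : ∀ ε : ℝ≥0∞, ε ≠ 0 → ε ≠ ∞ →
      (∀ ξ, ξ ≠ 0 → f ξ ^ p ≤ (ζ * (2 * (Q * E)) + E) * (ENNReal.ofReal (‖ξ‖ ^ σ) + ε)) := by
    intro ε hε0 hεt
    -- The summand `ε` makes the weighted supremum `N` finite in advance, since `f` is bounded. The
    -- final bound on `N` is free of `ε`.
    set w : Boundary n → ℝ≥0∞ := fun ξ => ENNReal.ofReal (‖ξ‖ ^ σ) + ε with hw
    have hw0 : ∀ ξ, w ξ ≠ 0 := fun ξ => by simp [hw, hε0]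
    have hwt : ∀ ξ, w ξ ≠ ∞ := fun ξ => by simp [hw, hεt]
    set N : ℝ≥0∞ := ⨆ (ξ : Boundary n) (_ : ξ ≠ 0 ∧ ‖ξ‖ < r), f ξ / w ξ with hN
    have hNle : ∀ ξ, ξ ≠ 0 → ‖ξ‖ < r → f ξ ≤ N * w ξ := by
      intro ξ h1 h2
      rw [← ENNReal.div_le_iff (hw0 ξ) (hwt ξ)]
      exact le_iSup₂ (f := fun (ξ : Boundary n) (_ : ξ ≠ 0 ∧ ‖ξ‖ < r) => f ξ / w ξ) ξ ⟨h1, h2⟩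
    have hNt : N ≠ ∞ := by
      refine ne_top_of_le_ne_top (ENNReal.div_ne_top hM hε0) (iSup₂_le fun ξ hξ => ?_)
      exact ENNReal.div_le_div (hfM ξ hξ.1) le_add_self
    -- Inside radius `r` the factor `f^{p-1}` is small; outside, the weight is bounded below and the
    -- bound `M` suffices.
    have hfp : ∀ ξ, ξ ≠ 0 → f ξ ^ p ≤ (ζ * N + E) * w ξ := by
      intro ξ hξ
      rcases lt_or_ge ‖ξ‖ r with h1 | h1
      · calc f ξ ^ p = f ξ ^ (p - 1) * f ξ := by
              conv_lhs => rw [show p = p - 1 + 1 by ring]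
              rw [ENNReal.rpow_add_of_nonneg _ _ hp0.le zero_le_one, ENNReal.rpow_one]
          _ ≤ ζ * (N * w ξ) := by
              gcongr
              · exact ENNReal.rpow_le_rpow (hsmall ξ hξ h1) hp0.le
              · exact hNle ξ hξ h1
          _ = ζ * N * w ξ := by ring
          _ ≤ _ := by gcongr; exact le_self_add
      · calc f ξ ^ p ≤ M ^ p * 1 := by
              rw [mul_one]
              exact ENNReal.rpow_le_rpow (hfM ξ hξ) (by linarith)
          _ ≤ M ^ p * (ENNReal.ofReal (r ^ (-σ)) * ENNReal.ofReal (‖ξ‖ ^ σ)) := by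
              gcongr; exact hout _ h1
          _ = E * ENNReal.ofReal (‖ξ‖ ^ σ) := by rw [hE]; ring
          _ ≤ _ := by
              gcongr
              · exact le_add_self
              · exact le_self_add
    have hcst : ζ * N + E ≠ ∞ := by simp [ENNReal.mul_eq_top, hζt, hNt, hEt]
    have hgx : ∀ x ∈ upperHalf n, g x ≤
        (ζ * N + E) * (Cr * (ENNReal.ofReal (euclNorm x ^ σ) + ε)) := by
      intro x hx
      calc g x = ∫⁻ ξ, scaledKernel δ₁ δ₂ x ξ * f ξ ^ p ∂(bdryMeasure n) := h.eq_g x hx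
        _ ≤ ∫⁻ ξ, (ζ * N + E) * (scaledKernel δ₁ δ₂ x ξ * w ξ) ∂(bdryMeasure n) := by
            refine lintegral_mono_ae ?_
            filter_upwards [ae_bdryMeasure_ne_zero hn] with ξ hξ
            rw [mul_left_comm]
            gcongr
            exact hfp ξ hξ
        _ ≤ _ := by
            rw [lintegral_const_mul' _ _ hcst]
            gcongr
            exact hrow x hx ε hεt
    have hfx : ∀ ξ, ξ ≠ 0 → f ξ ≤ Q * (ζ * N + E) * w ξ := by
      intro ξ hξ
      have hcst' : M ^ (q - 1) * ((ζ * N + E) * Cr) ≠ ∞ :=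
        ENNReal.mul_ne_top hMq (ENNReal.mul_ne_top hcst hCr)
      calc f ξ = ∫⁻ x, scaledKernel δ₁ δ₂ x ξ * g x ^ q ∂(halfMeasure n) := h.eq_f ξ hξ
        _ ≤ ∫⁻ x, M ^ (q - 1) * ((ζ * N + E) * Cr) *
            (scaledKernel δ₁ δ₂ x ξ * (ENNReal.ofReal (euclNorm x ^ σ) + ε)) ∂(halfMeasure n) := by
            refine lintegral_mono_ae ?_
            filter_upwards [ae_halfMeasure_mem] with x hx
            rw [mul_left_comm]
            gcongr
            calc g x ^ q = g x ^ (q - 1) * g x := by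
                  conv_lhs => rw [show q = q - 1 + 1 by ring]
                  rw [ENNReal.rpow_add_of_nonneg _ _ hq0.le zero_le_one, ENNReal.rpow_one]
              _ ≤ M ^ (q - 1) * ((ζ * N + E) * (Cr * (ENNReal.ofReal (euclNorm x ^ σ) + ε))) := by
                  gcongr
                  · exact hgM x hx
                  · exact hgx x hx
              _ = _ := by ring
        _ ≤ M ^ (q - 1) * ((ζ * N + E) * Cr) * (Cc * w ξ) := by
            rw [lintegral_const_mul' _ _ hcst']
            gcongr
            exact hcol ξ hξ ε hεt
        _ = _ := by rw [hQ]; ring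
    -- One round through both equations gives `N ≤ N/2 + Q E`, and `N` is finite.
    have hN2 : N ≤ 2 * (Q * E) := by
      refine ENNReal.le_two_mul_of_le_half_add hNt (iSup₂_le fun ξ hξ => ?_)
      refine ENNReal.div_le_of_le_mul ((hfx ξ hξ.1).trans ?_)
      gcongr
      calc Q * (ζ * N + E) = Q * ζ * N + Q * E := by ring
        _ ≤ 2⁻¹ * N + Q * E := by gcongr
        _ = N / 2 + Q * E := by rw [ENNReal.div_eq_inv_mul]
    intro ξ hξ
    refine (hfp ξ hξ).trans ?_
    gcongr
  set G : ℝ≥0∞ := ζ * (2 * (Q * E)) + E with hG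
  have hGt : G ≠ ∞ := by simp [hG, ENNReal.mul_eq_top, hζt, hQt, hEt]
  have hpos : ∀ s : ℝ, 0 < s → ENNReal.ofReal (s ^ σ) ≠ 0 := fun s hs => by
    have : 0 < s ^ σ := by positivity
    simpa using this
  -- Instead of letting `ε` tend to `0`, the uniform bound is used with `ε = |x|^σ`, which is of the
  -- size of the desired bound.
  have hgx : ∀ x ∈ upperHalf n, g x ≤ 2 * G * Cr * ENNReal.ofReal (euclNorm x ^ σ) := by
    intro x hx
    have hε := hpos _ (euclNorm_pos hx)
    calc g x = ∫⁻ ξ, scaledKernel δ₁ δ₂ x ξ * f ξ ^ p ∂(bdryMeasure n) := h.eq_g x hx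
      _ ≤ ∫⁻ ξ, G * (scaledKernel δ₁ δ₂ x ξ * (ENNReal.ofReal (‖ξ‖ ^ σ) +
          ENNReal.ofReal (euclNorm x ^ σ))) ∂(bdryMeasure n) := by
          refine lintegral_mono_ae ?_
          filter_upwards [ae_bdryMeasure_ne_zero hn] with ξ hξ
          rw [mul_left_comm]
          gcongr
          exact key _ hε (by simp) ξ hξ
      _ ≤ G * (Cr * (ENNReal.ofReal (euclNorm x ^ σ) + ENNReal.ofReal (euclNorm x ^ σ))) := by
          rw [lintegral_const_mul' _ _ hGt]
          gcongr
          exact hrow x hx _ (by simp)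
      _ = _ := by ring
  have hcst : M ^ (q - 1) * (2 * G * Cr) ≠ ∞ := by
    simp [ENNReal.mul_eq_top, hMq, hGt, hCr]
  have hfx : ∀ ξ, ξ ≠ 0 → f ξ ≤ M ^ (q - 1) * (2 * G * Cr) * Bc * ENNReal.ofReal (‖ξ‖ ^ σ) := by
    intro ξ hξ
    calc f ξ = ∫⁻ x, scaledKernel δ₁ δ₂ x ξ * g x ^ q ∂(halfMeasure n) := h.eq_f ξ hξ
      _ ≤ ∫⁻ x, M ^ (q - 1) * (2 * G * Cr) *
          (scaledKernel δ₁ δ₂ x ξ * ENNReal.ofReal (euclNorm x ^ σ)) ∂(halfMeasure n) := by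
          refine lintegral_mono_ae ?_
          filter_upwards [ae_halfMeasure_mem] with x hx
          rw [mul_left_comm]
          gcongr
          calc g x ^ q = g x ^ (q - 1) * g x := by
                conv_lhs => rw [show q = q - 1 + 1 by ring]
                rw [ENNReal.rpow_add_of_nonneg _ _ hq0.le zero_le_one, ENNReal.rpow_one]
            _ ≤ M ^ (q - 1) * (2 * G * Cr * ENNReal.ofReal (euclNorm x ^ σ)) := by
                gcongr
                · exact hgM x hx
                · exact hgx x hx
            _ = _ := by ring
      _ ≤ M ^ (q - 1) * (2 * G * Cr) * (Bc * ENNReal.ofReal (‖ξ‖ ^ σ)) := by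
          rw [lintegral_const_mul' _ _ hcst]
          gcongr
          exact hcol1 ξ hξ
      _ = _ := by ring
  refine ⟨M ^ (q - 1) * (2 * G * Cr) * Bc + 2 * G * Cr, ?_, fun ξ hξ => (hfx ξ hξ).trans ?_,
    fun x hx => (hgx x hx).trans ?_⟩
  · exact ENNReal.add_ne_top.2 ⟨ENNReal.mul_ne_top hcst hBc, by simp [ENNReal.mul_eq_top, hGt, hCr]⟩
  · gcongr; exact le_self_add
  · gcongr; exact le_add_self

end ScaledSystem

/-! ### Passage to the limit at the origin -/

/-- Dominated convergence for integrands that are dominated off small moving sets. -/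
theorem tendsto_lintegral_of_dominated_off {Ω ι : Type} [MeasurableSpace Ω] {m : Measure Ω}
    {l : Filter ι} [l.IsCountablyGenerated] {k : ι → Ω → ℝ≥0∞} {k₀ : Ω → ℝ≥0∞} {N : ι → Set Ω}
    {c : ℝ≥0∞} (hc : c ≠ ∞) (hk : ∀ t, AEMeasurable (k t) m) (hN : ∀ t, MeasurableSet (N t))
    (hfar : ∀ᶠ t in l, ∀ᵐ ω ∂m, ω ∉ N t → k t ω ≤ c * k₀ ω) (hfin : ∫⁻ ω, k₀ ω ∂m ≠ ∞)
    (hnear : Tendsto (fun t => ∫⁻ ω in N t, k t ω ∂m) l (𝓝 0))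
    (hlim : ∀ᵐ ω ∂m, Tendsto (fun t => k t ω) l (𝓝 (k₀ ω)))
    (hout : ∀ᵐ ω ∂m, ∀ᶠ t in l, ω ∉ N t) :
    Tendsto (fun t => ∫⁻ ω, k t ω ∂m) l (𝓝 (∫⁻ ω, k₀ ω ∂m)) := by
  have h1 : Tendsto (fun t => ∫⁻ ω, (N t)ᶜ.indicator (k t) ω ∂m) l (𝓝 (∫⁻ ω, k₀ ω ∂m)) := by
    refine tendsto_lintegral_filter_of_dominated_convergence' (fun ω => c * k₀ ω)
      (Eventually.of_forall fun t => (hk t).indicator (hN t).compl) ?_ ?_ ?_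
    · filter_upwards [hfar] with t ht
      filter_upwards [ht] with ω hω
      by_cases h : ω ∈ N t
      · simp [h]
      · rw [Set.indicator_of_mem (by exact h)]; exact hω h
    · rw [lintegral_const_mul' _ _ hc]; exact ENNReal.mul_ne_top hc hfin
    · filter_upwards [hlim, hout] with ω h2 h3
      refine h2.congr' ?_
      filter_upwards [h3] with t ht
      rw [Set.indicator_of_mem (by exact ht)]
  have h2 := hnear.add h1
  rw [zero_add] at h2
  refine h2.congr fun t => ?_
  rw [lintegral_indicator (hN t).compl, lintegral_add_compl _ (hN t)]

theorem tendsto_const_mul_ofReal_rpow_zero {C : ℝ≥0∞} (hC : C ≠ ∞) {s : ℝ} (hs : 0 < s) {ι : Type}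
    {l : Filter ι} {φ : ι → ℝ} (hφ : Tendsto φ l (𝓝 0)) :
    Tendsto (fun t => C * ENNReal.ofReal (φ t ^ s)) l (𝓝 0) := by
  have h1 := ENNReal.tendsto_ofReal
    (((Real.continuousAt_rpow_const 0 s (Or.inr hs.le)).tendsto).comp hφ)
  rw [Real.zero_rpow hs.ne', ENNReal.ofReal_zero] at h1
  have h2 := ENNReal.Tendsto.const_mul h1 (a := C) (Or.inr hC)
  rwa [mul_zero] at h2

theorem ENNReal.le_of_mul_ofReal_rpow_le {a C : ℝ≥0∞} {t A σ : ℝ} (ht : 0 < t)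
    (h : a * ENNReal.ofReal (t ^ A) ≤ C * ENNReal.ofReal (t ^ σ)) :
    a ≤ C * ENNReal.ofReal (t ^ (σ - A)) := by
  have h1 : ENNReal.ofReal (t ^ A) * ENNReal.ofReal (t ^ (-A)) = 1 := by
    rw [← ENNReal.ofReal_mul (by positivity), ← Real.rpow_add ht]; simp
  calc a = a * ENNReal.ofReal (t ^ A) * ENNReal.ofReal (t ^ (-A)) := by rw [mul_assoc, h1, mul_one]
    _ ≤ C * ENNReal.ofReal (t ^ σ) * ENNReal.ofReal (t ^ (-A)) := by gcongr
    _ = _ := by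
      rw [mul_assoc, ← ENNReal.ofReal_mul (by positivity), ← Real.rpow_add ht, ← sub_eq_add_neg]

theorem continuous_bdryDist_left {n : ℕ} (ξ : Boundary n) :
    Continuous fun x : Ambient n => bdryDist x ξ := by
  unfold bdryDist; fun_prop

theorem continuous_bdryDist_right {n : ℕ} (x : Ambient n) :
    Continuous fun ξ : Boundary n => bdryDist x ξ := by
  unfold bdryDist; fun_prop

namespace IsPositiveSolution

variable {n : ℕ} {α β γ p q : ℝ} {u : Boundary n → ℝ≥0∞} {v : Ambient n → ℝ≥0∞}

theorem mul_norm_rpow_eq (huv : IsPositiveSolution α β γ p q u v) {ξ : Boundary n} (hξ : ξ ≠ 0) :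
    u ξ * ENNReal.ofReal (‖ξ‖ ^ α) = ∫⁻ x in upperHalf n, v x ^ q *
      ENNReal.ofReal (x.2 * bdryDist x ξ ^ (-((n : ℝ) + 2 - γ)) * euclNorm x ^ (-β)) := by
  have hξ0 := norm_pos_iff.2 hξ
  rw [huv.eq_u ξ hξ, mul_comm, ← lintegral_const_mul' _ _ (by simp)]
  refine lintegral_congr fun x => ?_
  rw [← mul_assoc, ← ENNReal.ofReal_mul (by positivity), mul_comm, fracPoisson_eq]
  congr 2
  have : ‖ξ‖ ^ α * ‖ξ‖ ^ (-α) = 1 := by rw [← Real.rpow_add hξ0]; simp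
  calc _ = ‖ξ‖ ^ α * ‖ξ‖ ^ (-α) * (x.2 * bdryDist x ξ ^ (-((n : ℝ) + 2 - γ)) *
        euclNorm x ^ (-β)) := by ring
    _ = _ := by rw [this, one_mul]

theorem mul_euclNorm_rpow_div_eq (huv : IsPositiveSolution α β γ p q u v) {x : Ambient n}
    (hx : x ∈ upperHalf n) :
    v x * ENNReal.ofReal (euclNorm x ^ β / x.2) = ∫⁻ ξ : Boundary n, u ξ ^ p *
      ENNReal.ofReal (bdryDist x ξ ^ (-((n : ℝ) + 2 - γ)) * ‖ξ‖ ^ (-α)) := by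
  have hx0 := euclNorm_pos hx
  have hx2 : 0 < x.2 := hx
  rw [huv.eq_v x hx, mul_comm, ← lintegral_const_mul' _ _ (by simp)]
  refine lintegral_congr fun ξ => ?_
  rw [← mul_assoc, ← ENNReal.ofReal_mul (by positivity), mul_comm, fracPoisson_eq]
  congr 2
  have : euclNorm x ^ β * euclNorm x ^ (-β) = 1 := by rw [← Real.rpow_add hx0]; simp
  calc _ = euclNorm x ^ β * euclNorm x ^ (-β) * (x.2 / x.2) *
        (bdryDist x ξ ^ (-((n : ℝ) + 2 - γ)) * ‖ξ‖ ^ (-α)) := by ring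
    _ = _ := by rw [this, div_self hx2.ne', one_mul, one_mul]

/-- Off the set `|x-ξ| < |x|/2` the integrand is at most `2^D` times its limit. On that set `|x| ≤
2|ξ|`, and the decay of `v` together with the bounded mass of the conjugated kernel gives a
contribution of order `|ξ|^{qσ-δ₂}`. -/
theorem tendsto_boundary (huv : IsPositiveSolution α β γ p q u v) (hn : 2 ≤ n) (hγ : 2 ≤ γ)
    (hγn : γ < n) (hq : 0 < q) {A δ₁ δ₂ σ : ℝ} (hδ₁ : 0 < δ₁) (hδ₂ : 0 < δ₂)
    (hA : A * (q + 1) = n) (h1 : δ₁ = A - β + 1) (hD : δ₁ + δ₂ = (n : ℝ) + 2 - γ)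
    (hσ0 : 0 < σ) (hσ : δ₂ < q * σ) {C : ℝ≥0∞} (hC : C ≠ ∞) (hufin : ∀ ξ, ξ ≠ 0 → u ξ ≠ ∞)
    (hv : ∀ x ∈ upperHalf n, v x ≤ C * ENNReal.ofReal (euclNorm x ^ (σ - A))) :
    (∫⁻ x in upperHalf n,
        v x ^ q * ENNReal.ofReal (x.2 / euclNorm x ^ ((n : ℝ) + 2 - γ + β))) < ∞ ∧
    Tendsto (fun ξ : Boundary n => u ξ * ENNReal.ofReal (‖ξ‖ ^ α)) (𝓝[≠] 0)
      (𝓝 (∫⁻ x in upperHalf n,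
        v x ^ q * ENNReal.ofReal (x.2 / euclNorm x ^ ((n : ℝ) + 2 - γ + β)))) := by
  have := nontrivial_boundary hn
  set D : ℝ := (n : ℝ) + 2 - γ with hDdef
  have hD0 : 0 < D := by linarith
  have hn0 : (0 : ℝ) < n := by positivity
  have hvq : ∀ x ∈ upperHalf n,
      v x ^ q ≤ C ^ q * ENNReal.ofReal (euclNorm x ^ ((σ - A) * q)) := by
    intro x hx
    have hx0 := euclNorm_pos hx
    refine (ENNReal.rpow_le_rpow (hv x hx) hq.le).trans_eq ?_
    rw [ENNReal.mul_rpow_of_nonneg _ _ hq.le, ENNReal.ofReal_rpow_of_pos (by positivity),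
      ← Real.rpow_mul hx0.le]
  have hCq : C ^ q ≠ ∞ := ENNReal.rpow_ne_top_of_nonneg hq.le hC
  set k : Boundary n → Ambient n → ℝ≥0∞ := fun ξ x =>
    v x ^ q * ENNReal.ofReal (x.2 * bdryDist x ξ ^ (-D) * euclNorm x ^ (-β)) with hk
  set k₀ : Ambient n → ℝ≥0∞ := fun x =>
    v x ^ q * ENNReal.ofReal (x.2 / euclNorm x ^ (D + β)) with hk₀
  have hk₀' : ∀ x ∈ upperHalf n,
      k₀ x = v x ^ q * ENNReal.ofReal (x.2 * euclNorm x ^ (-D) * euclNorm x ^ (-β)) := by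
    intro x hx
    have hx0 := euclNorm_pos hx
    rw [hk₀]
    simp only
    rw [mul_assoc x.2, ← Real.rpow_add hx0, ← neg_add, Real.rpow_neg hx0.le, ← div_eq_mul_inv]
  have mv : AEMeasurable v (volume.restrict (upperHalf n)) := huv.memLp_v.1.aemeasurable
  have hkm : ∀ ξ, AEMeasurable (k ξ) (volume.restrict (upperHalf n)) := fun ξ =>
    (mv.pow_const q).mul ((measurable_snd.mul ((measurable_bdryDist_left ξ).pow_const _)).mul
      (continuous_euclNorm.measurable.pow_const _)).ennreal_ofReal.aemeasurable
  have hfin : ∫⁻ x in upperHalf n, k₀ x ≠ ∞ := by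
    have hV : 2 * volume (Metric.ball (0 : Boundary n) 1) ≠ ∞ :=
      ENNReal.mul_ne_top (by simp) measure_ball_lt_top.ne
    -- With `A(q+1) = n` the resulting power of the radius is `n + (σ-A)q + 1 - D - β = qσ - δ₂ >
    -- 0`, so the limiting integrand is integrable at the origin.
    obtain ⟨B, hB, hball⟩ := exists_lintegral_rpow_ball_le (d := (n : ℝ))
      (s := -((σ - A) * q + 1 - D - β)) hn0 (by nlinarith) hV
    have hms : MeasurableSet {x : Ambient n | euclNorm x < 1} :=
      measurableSet_lt continuous_euclNorm.measurable measurable_const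
    rw [← lintegral_add_compl _ hms]
    refine ENNReal.add_ne_top.2 ⟨?_, ?_⟩
    · refine ne_top_of_le_ne_top (ENNReal.mul_ne_top hCq (ENNReal.mul_ne_top hB ENNReal.ofReal_ne_top))
        (b := C ^ q * (B * ENNReal.ofReal (1 ^ ((n : ℝ) - -((σ - A) * q + 1 - D - β))))) ?_
      calc _ ≤ ∫⁻ x in {x : Ambient n | euclNorm x < 1}, C ^ q *
            ENNReal.ofReal (euclNorm x ^ (-(-((σ - A) * q + 1 - D - β))))
              ∂(volume.restrict (upperHalf n)) := by
            refine lintegral_mono_ae (ae_restrict_of_ae ?_)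
            filter_upwards [ae_restrict_mem measurableSet_upperHalf] with x hx
            have hx0 := euclNorm_pos hx
            have hx2 : 0 < x.2 := hx
            rw [hk₀' x hx]
            refine (mul_le_mul_left (hvq x hx) _).trans ?_
            rw [mul_assoc, ← ENNReal.ofReal_mul (by positivity)]
            gcongr
            calc euclNorm x ^ ((σ - A) * q) * (x.2 * euclNorm x ^ (-D) * euclNorm x ^ (-β))
                ≤ euclNorm x ^ ((σ - A) * q) *
                  (euclNorm x ^ (1 : ℝ) * euclNorm x ^ (-D) * euclNorm x ^ (-β)) := by
                  gcongr
                  rw [Real.rpow_one]; exact snd_le_euclNorm x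
              _ = _ := by
                  rw [← Real.rpow_add hx0, ← Real.rpow_add hx0, ← Real.rpow_add hx0]
                  ring_nf
        _ ≤ _ := by
            rw [lintegral_const_mul' _ _ hCq]
            gcongr
            exact hball _ euclNorm continuous_euclNorm.measurable (fun r hr =>
              (Measure.restrict_le_self _).trans (volume_euclNorm_lt_le (by omega) hr)) 1 one_pos
    -- For `|x| ≥ 1` and a unit vector `ξ`, `|x-ξ| ≤ 2|x|`; hence finiteness of `u ξ` controls the
    -- integral at infinity.
    · obtain ⟨ξ, hξ1⟩ := exists_norm_eq (Boundary n) zero_le_one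
      have hξ : ξ ≠ 0 := by rw [← norm_pos_iff, hξ1]; exact one_pos
      have hfin1 : ∫⁻ x in upperHalf n, k ξ x ≠ ∞ := by
        rw [hk, ← huv.mul_norm_rpow_eq hξ]
        exact ENNReal.mul_ne_top (hufin ξ hξ) (by simp)
      refine ne_top_of_le_ne_top (ENNReal.mul_ne_top ENNReal.ofReal_ne_top hfin1)
        (b := ENNReal.ofReal (2 ^ D) * ∫⁻ x in upperHalf n, k ξ x) ?_
      rw [← lintegral_const_mul' _ _ (by simp), ← lintegral_indicator hms.compl]
      refine lintegral_mono_ae ?_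
      filter_upwards [ae_restrict_mem measurableSet_upperHalf] with x hx
      by_cases hx1 : x ∈ {x : Ambient n | euclNorm x < 1}ᶜ
      · rw [Set.indicator_of_mem hx1, hk₀' x hx, hk]
        have hx1' : 1 ≤ euclNorm x := not_lt.1 hx1
        have hx0 := euclNorm_pos hx
        have hx2 : 0 < x.2 := hx
        have hρ := bdryDist_pos hx ξ
        have hρ2 : bdryDist x ξ ≤ 2 * euclNorm x := by
          have := bdryDist_le_add x ξ 0
          rw [bdryDist_zero, zero_sub, norm_neg, hξ1] at this
          linarith
        simp only
        rw [mul_left_comm, ← ENNReal.ofReal_mul (by positivity)]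
        refine mul_le_mul_right (ENNReal.ofReal_le_ofReal ?_) _
        have h3 : euclNorm x ^ (-D) ≤ 2 ^ D * bdryDist x ξ ^ (-D) := by
          have h4 := Real.rpow_le_rpow_of_nonpos hρ hρ2 (z := -D) (by linarith)
          rw [Real.mul_rpow (by norm_num) hx0.le, Real.rpow_neg (by norm_num : (0 : ℝ) ≤ 2),
            inv_mul_le_iff₀ (by positivity)] at h4
          exact h4
        calc x.2 * euclNorm x ^ (-D) * euclNorm x ^ (-β)
            ≤ x.2 * (2 ^ D * bdryDist x ξ ^ (-D)) * euclNorm x ^ (-β) := by gcongr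
          _ = _ := by ring
      · rw [Set.indicator_of_notMem hx1]; exact zero_le
  refine ⟨lt_top_iff_ne_top.2 hfin, ?_⟩
  obtain ⟨Cc, hCc, hcol⟩ := exists_lintegral_col_le hn hδ₁ hδ₂ (by linarith) (σ := 0) (by linarith)
    hδ₂
  simp only [Real.rpow_zero, ENNReal.ofReal_one, mul_one] at hcol
  have hms : ∀ ξ : Boundary n, MeasurableSet {x : Ambient n | bdryDist x ξ < euclNorm x / 2} :=
    fun ξ => measurableSet_lt (measurable_bdryDist_left ξ)
      (continuous_euclNorm.measurable.div_const 2)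
  have hnear : ∀ ξ : Boundary n, ξ ≠ 0 →
      ∫⁻ x in {x | bdryDist x ξ < euclNorm x / 2}, k ξ x ∂(volume.restrict (upperHalf n)) ≤
        C ^ q * ENNReal.ofReal (2 ^ (σ * q)) * Cc * ENNReal.ofReal (‖ξ‖ ^ (q * σ - δ₂)) := by
    intro ξ hξ
    have hξ0 := norm_pos_iff.2 hξ
    calc _ ≤ ∫⁻ x in upperHalf n, C ^ q * ENNReal.ofReal (2 ^ (σ * q) * ‖ξ‖ ^ (q * σ - δ₂)) *
          (scaledKernel δ₁ δ₂ x ξ * ENNReal.ofReal (euclNorm x ^ (-(n : ℝ)))) := by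
          rw [← lintegral_indicator (hms ξ)]
          refine lintegral_mono_ae ?_
          filter_upwards [ae_restrict_mem measurableSet_upperHalf] with x hx
          by_cases hx1 : x ∈ {x | bdryDist x ξ < euclNorm x / 2}
          · rw [Set.indicator_of_mem hx1, hk]
            have hx1' : bdryDist x ξ < euclNorm x / 2 := hx1
            have hx0 := euclNorm_pos hx
            have hx2 : 0 < x.2 := hx
            have hρ := bdryDist_pos hx ξ
            simp only
            refine (mul_le_mul_left (hvq x hx) _).trans ?_
            rw [scaledKernel, mul_assoc (C ^ q), mul_assoc (C ^ q),
              ← ENNReal.ofReal_mul (by positivity), ← ENNReal.ofReal_mul (by positivity),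
              ← ENNReal.ofReal_mul (by positivity), hD]
            refine mul_le_mul_right (ENNReal.ofReal_le_ofReal ?_) _
            have h3 : euclNorm x ^ (σ * q) ≤ 2 ^ (σ * q) * ‖ξ‖ ^ (q * σ) := by
              rw [mul_comm q, ← Real.mul_rpow (by norm_num) hξ0.le]
              exact Real.rpow_le_rpow hx0.le (by linarith [euclNorm_le_add x ξ]) (by positivity)
            have e1 : euclNorm x ^ ((σ - A) * q) * euclNorm x ^ (-β) =
                euclNorm x ^ (σ * q) * (euclNorm x ^ (δ₁ - 1) * euclNorm x ^ (-(n : ℝ))) := by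
              rw [← Real.rpow_add hx0, ← Real.rpow_add hx0, ← Real.rpow_add hx0]
              congr 1; rw [h1, ← hA]; ring
            have e2 : ‖ξ‖ ^ (q * σ) = ‖ξ‖ ^ (q * σ - δ₂) * ‖ξ‖ ^ δ₂ := by
              rw [← Real.rpow_add hξ0, sub_add_cancel]
            calc euclNorm x ^ ((σ - A) * q) * (x.2 * bdryDist x ξ ^ (-D) * euclNorm x ^ (-β))
                = (euclNorm x ^ ((σ - A) * q) * euclNorm x ^ (-β)) *
                  (x.2 * bdryDist x ξ ^ (-D)) := by ring
              _ = euclNorm x ^ (σ * q) * (euclNorm x ^ (δ₁ - 1) * euclNorm x ^ (-(n : ℝ))) *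
                  (x.2 * bdryDist x ξ ^ (-D)) := by rw [e1]
              _ ≤ 2 ^ (σ * q) * ‖ξ‖ ^ (q * σ) * (euclNorm x ^ (δ₁ - 1) * euclNorm x ^ (-(n : ℝ))) *
                  (x.2 * bdryDist x ξ ^ (-D)) := by gcongr
              _ = _ := by rw [e2]; ring
          · rw [Set.indicator_of_notMem hx1]; exact zero_le
      _ = C ^ q * ENNReal.ofReal (2 ^ (σ * q) * ‖ξ‖ ^ (q * σ - δ₂)) *
          ∫⁻ x, scaledKernel δ₁ δ₂ x ξ ∂(halfMeasure n) := by
          rw [lintegral_const_mul' _ _ (ENNReal.mul_ne_top hCq (by simp)),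
            lintegral_halfMeasure (measurable_scaledKernel_left ξ).aemeasurable]
      _ ≤ C ^ q * ENNReal.ofReal (2 ^ (σ * q) * ‖ξ‖ ^ (q * σ - δ₂)) * Cc := by
          gcongr
          exact hcol ξ hξ
      _ = _ := by rw [ENNReal.ofReal_mul (by positivity)]; ring
  have hn0' : Tendsto (fun ξ : Boundary n => ‖ξ‖) (𝓝[≠] 0) (𝓝 0) :=
    (tendsto_norm_zero).mono_left nhdsWithin_le_nhds
  have hmain : Tendsto (fun ξ : Boundary n => ∫⁻ x in upperHalf n, k ξ x) (𝓝[≠] 0)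
      (𝓝 (∫⁻ x in upperHalf n, k₀ x)) := by
    refine tendsto_lintegral_of_dominated_off (c := ENNReal.ofReal (2 ^ D)) (by simp) hkm hms ?_ hfin
      ?_ ?_ ?_
    · refine Eventually.of_forall fun ξ => ?_
      filter_upwards [ae_restrict_mem measurableSet_upperHalf] with x hx hxN
      have hx0 := euclNorm_pos hx
      have hx2 : 0 < x.2 := hx
      have hρ := bdryDist_pos hx ξ
      have hxN' : euclNorm x / 2 ≤ bdryDist x ξ := not_lt.1 hxN
      rw [hk₀' x hx, hk]
      simp only
      rw [mul_left_comm, ← ENNReal.ofReal_mul (by positivity)]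
      refine mul_le_mul_right (ENNReal.ofReal_le_ofReal ?_) _
      have h3 : bdryDist x ξ ^ (-D) ≤ 2 ^ D * euclNorm x ^ (-D) := by
        have h4 := Real.rpow_le_rpow_of_nonpos (by positivity) hxN' (z := -D) (by linarith)
        refine h4.trans_eq ?_
        rw [div_eq_inv_mul, Real.mul_rpow (by norm_num) hx0.le, Real.inv_rpow (by norm_num),
          Real.rpow_neg (by norm_num : (0 : ℝ) ≤ 2), inv_inv]
      calc x.2 * bdryDist x ξ ^ (-D) * euclNorm x ^ (-β)
          ≤ x.2 * (2 ^ D * euclNorm x ^ (-D)) * euclNorm x ^ (-β) := by gcongr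
        _ = _ := by ring
    · have hCc' : C ^ q * ENNReal.ofReal (2 ^ (σ * q)) * Cc ≠ ∞ :=
        ENNReal.mul_ne_top (ENNReal.mul_ne_top hCq ENNReal.ofReal_ne_top) hCc
      have hz := tendsto_const_mul_ofReal_rpow_zero hCc' (sub_pos.2 hσ) hn0'
      refine tendsto_of_tendsto_of_tendsto_of_le_of_le' tendsto_const_nhds hz
        (Eventually.of_forall fun _ => zero_le) ?_
      filter_upwards [self_mem_nhdsWithin] with ξ hξ
      exact hnear ξ hξ
    · filter_upwards [ae_restrict_mem measurableSet_upperHalf] with x hx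
      have hx0 := euclNorm_pos hx
      rw [hk₀' x hx]
      refine ENNReal.Tendsto.const_mul (ENNReal.tendsto_ofReal ?_) (Or.inr
        (ne_top_of_le_ne_top (ENNReal.mul_ne_top hCq (by simp)) (hvq x hx)))
      refine Tendsto.mul_const _ (Tendsto.const_mul _ ?_)
      have h3 : Tendsto (fun ξ : Boundary n => bdryDist x ξ) (𝓝[≠] 0) (𝓝 (euclNorm x)) := by
        have h5 := (continuous_bdryDist_right x).tendsto 0
        rw [bdryDist_zero] at h5
        exact h5.mono_left nhdsWithin_le_nhds
      exact h3.rpow_const (Or.inl hx0.ne')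
    · filter_upwards [ae_restrict_mem measurableSet_upperHalf] with x hx
      have hx0 := euclNorm_pos hx
      filter_upwards [hn0'.eventually_lt_const (show 0 < euclNorm x / 2 by linarith)] with ξ hξ
      refine not_lt.2 ?_
      linarith [euclNorm_le_add x ξ]
  refine hmain.congr' ?_
  filter_upwards [self_mem_nhdsWithin] with ξ hξ
  rw [huv.mul_norm_rpow_eq hξ]

/-- The same scheme, but division by `xₙ` removes the factor that weakened the singularity. The
kernel is now `|x-ξ|^{-D}`, integrable on the boundary only because `D < n - 1`; the near part is of
order `|x|^{pσ-δ₁}`. -/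
theorem tendsto_half (huv : IsPositiveSolution α β γ p q u v) (hn : 2 ≤ n)
    (hp : 0 < p) {B δ₁ δ₂ σ : ℝ}
    (hB : B * (p + 1) = (n : ℝ) - 1) (h2 : δ₂ = B - α) (hD : δ₁ + δ₂ = (n : ℝ) + 2 - γ)
    (hD0 : 0 < δ₁ + δ₂) (hDn : δ₁ + δ₂ < (n : ℝ) - 1) (hσ : δ₁ < p * σ) {C : ℝ≥0∞} (hC : C ≠ ∞)
    (hvfin : ∀ x ∈ upperHalf n, v x ≠ ∞)
    (hu : ∀ ξ, ξ ≠ 0 → u ξ ≤ C * ENNReal.ofReal (‖ξ‖ ^ (σ - B))) :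
    (∫⁻ ξ : Boundary n,
        u ξ ^ p * ENNReal.ofReal (1 / ‖ξ‖ ^ ((n : ℝ) + 2 - γ + α))) < ∞ ∧
    Tendsto (fun x : Ambient n => v x * ENNReal.ofReal (euclNorm x ^ β / x.2))
      (𝓝[upperHalf n] 0)
      (𝓝 (∫⁻ ξ : Boundary n,
        u ξ ^ p * ENNReal.ofReal (1 / ‖ξ‖ ^ ((n : ℝ) + 2 - γ + α)))) := by
  have := nontrivial_boundary hn
  rw [hD] at hD0 hDn
  set D : ℝ := (n : ℝ) + 2 - γ with hDdef
  have hd : 0 < (n : ℝ) - 1 := by linarith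
  have hV : volume (Metric.ball (0 : Boundary n) 1) ≠ ∞ := measure_ball_lt_top.ne
  have hae : ∀ᵐ ξ : Boundary n, ξ ≠ 0 := Measure.ae_ne volume 0
  have hup : ∀ ξ : Boundary n, ξ ≠ 0 →
      u ξ ^ p ≤ C ^ p * ENNReal.ofReal (‖ξ‖ ^ ((σ - B) * p)) := by
    intro ξ hξ
    have hξ0 := norm_pos_iff.2 hξ
    refine (ENNReal.rpow_le_rpow (hu ξ hξ) hp.le).trans_eq ?_
    rw [ENNReal.mul_rpow_of_nonneg _ _ hp.le, ENNReal.ofReal_rpow_of_pos (by positivity),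
      ← Real.rpow_mul hξ0.le]
  have hCp : C ^ p ≠ ∞ := ENNReal.rpow_ne_top_of_nonneg hp.le hC
  set k : Ambient n → Boundary n → ℝ≥0∞ := fun x ξ =>
    u ξ ^ p * ENNReal.ofReal (bdryDist x ξ ^ (-D) * ‖ξ‖ ^ (-α)) with hk
  set k₀ : Boundary n → ℝ≥0∞ := fun ξ => u ξ ^ p * ENNReal.ofReal (1 / ‖ξ‖ ^ (D + α)) with hk₀
  have hk₀' : ∀ ξ : Boundary n, ξ ≠ 0 →
      k₀ ξ = u ξ ^ p * ENNReal.ofReal (‖ξ‖ ^ (-D) * ‖ξ‖ ^ (-α)) := by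
    intro ξ hξ
    have hξ0 := norm_pos_iff.2 hξ
    rw [hk₀]
    simp only
    rw [← Real.rpow_add hξ0, ← neg_add, Real.rpow_neg hξ0.le, one_div]
  have hexp : (σ - B) * p - α + ((n : ℝ) - 1 - D) = p * σ - δ₁ := by
    rw [← hB, ← hD, h2]; ring
  have hfin : ∫⁻ ξ, k₀ ξ ≠ ∞ := by
    obtain ⟨E, hE, hball⟩ := exists_lintegral_rpow_ball_le (d := (n : ℝ) - 1)
      (s := -((σ - B) * p - D - α)) hd (by linarith) hV
    have hms : MeasurableSet {ξ : Boundary n | ‖ξ‖ < 1} :=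
      measurableSet_lt measurable_norm measurable_const
    rw [← lintegral_add_compl _ hms]
    refine ENNReal.add_ne_top.2 ⟨?_, ?_⟩
    · refine ne_top_of_le_ne_top (ENNReal.mul_ne_top hCp (ENNReal.mul_ne_top hE ENNReal.ofReal_ne_top))
        (b := C ^ p * (E * ENNReal.ofReal (1 ^ ((n : ℝ) - 1 - -((σ - B) * p - D - α))))) ?_
      calc _ ≤ ∫⁻ ξ in {ξ : Boundary n | ‖ξ‖ < 1}, C ^ p *
            ENNReal.ofReal (‖ξ‖ ^ (-(-((σ - B) * p - D - α)))) := by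
            refine lintegral_mono_ae (ae_restrict_of_ae ?_)
            filter_upwards [hae] with ξ hξ
            have hξ0 := norm_pos_iff.2 hξ
            rw [hk₀' ξ hξ]
            refine (mul_le_mul_left (hup ξ hξ) _).trans_eq ?_
            rw [mul_assoc, ← ENNReal.ofReal_mul (by positivity), ← Real.rpow_add hξ0,
              ← Real.rpow_add hξ0]
            ring_nf
        _ ≤ _ := by
            rw [lintegral_const_mul' _ _ hCp]
            gcongr
            exact hball volume (fun ξ : Boundary n => ‖ξ‖) measurable_norm
              (fun r hr => volume_norm_lt_le (by omega) hr) 1 one_pos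
    -- The finite value of `v` at this one point controls the integral over `|ξ| ≥ 1`.
    · set x : Ambient n := (0, 1) with hx_def
      have hx : x ∈ upperHalf n := show (0 : ℝ) < 1 from one_pos
      have hx1 : euclNorm x = 1 := by simp [euclNorm, hx_def]
      have hfin1 : ∫⁻ ξ, k x ξ ≠ ∞ := by
        rw [hk, ← huv.mul_euclNorm_rpow_div_eq hx]
        exact ENNReal.mul_ne_top (hvfin x hx) (by simp)
      refine ne_top_of_le_ne_top (ENNReal.mul_ne_top ENNReal.ofReal_ne_top hfin1)
        (b := ENNReal.ofReal (2 ^ D) * ∫⁻ ξ, k x ξ) ?_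
      rw [← lintegral_const_mul' _ _ (by simp), ← lintegral_indicator hms.compl]
      refine lintegral_mono_ae ?_
      filter_upwards [hae] with ξ hξ
      by_cases hξ1 : ξ ∈ {ξ : Boundary n | ‖ξ‖ < 1}ᶜ
      · rw [Set.indicator_of_mem hξ1, hk₀' ξ hξ, hk]
        have hξ1' : 1 ≤ ‖ξ‖ := not_lt.1 hξ1
        have hξ0 := norm_pos_iff.2 hξ
        have hρ := bdryDist_pos hx ξ
        have hρ2 : bdryDist x ξ ≤ 2 * ‖ξ‖ := by
          have := bdryDist_le_add x ξ 0
          rw [bdryDist_zero, zero_sub, norm_neg, hx1] at this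
          linarith
        simp only
        rw [mul_left_comm, ← ENNReal.ofReal_mul (by positivity), ← mul_assoc]
        gcongr
        have h4 := Real.rpow_le_rpow_of_nonpos hρ hρ2 (z := -D) (by linarith)
        rw [Real.mul_rpow (by norm_num) hξ0.le, Real.rpow_neg (by norm_num : (0 : ℝ) ≤ 2),
          inv_mul_le_iff₀ (by positivity)] at h4
        exact h4
      · rw [Set.indicator_of_notMem hξ1]; exact zero_le
  refine ⟨lt_top_iff_ne_top.2 hfin, ?_⟩
  obtain ⟨E, hE, hball⟩ := exists_lintegral_rpow_ball_le (d := (n : ℝ) - 1) (s := D) hd hDn hV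
  have mu : AEMeasurable u := huv.memLp_u.1.aemeasurable
  have hkm : ∀ x, AEMeasurable (k x) := fun x =>
    (mu.pow_const p).mul (((measurable_bdryDist_right x).pow_const _).mul
      (measurable_norm.pow_const _)).ennreal_ofReal.aemeasurable
  have hms : ∀ x : Ambient n, MeasurableSet {ξ : Boundary n | bdryDist x ξ < ‖ξ‖ / 2} :=
    fun x => measurableSet_lt (measurable_bdryDist_right x) (measurable_norm.div_const 2)
  have hnear : ∀ x ∈ upperHalf n, ∫⁻ ξ in {ξ : Boundary n | bdryDist x ξ < ‖ξ‖ / 2}, k x ξ ≤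
      C ^ p * ENNReal.ofReal (2 ^ |(σ - B) * p - α|) * E *
        ENNReal.ofReal (euclNorm x ^ (p * σ - δ₁)) := by
    intro x hx
    have hx0 := euclNorm_pos hx
    -- From `|ξ| ≤ |x-ξ| + |x|`: the near set shrinks to the origin together with `x`.
    have hsub : {ξ : Boundary n | bdryDist x ξ < ‖ξ‖ / 2} ⊆ {ξ | bdryDist x ξ < euclNorm x} := by
      intro ξ hξ
      have hξ' : bdryDist x ξ < ‖ξ‖ / 2 := hξ
      show bdryDist x ξ < euclNorm x
      linarith [norm_le_add x ξ]
    calc _ ≤ ∫⁻ ξ in {ξ : Boundary n | bdryDist x ξ < ‖ξ‖ / 2},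
          C ^ p * ENNReal.ofReal (2 ^ |(σ - B) * p - α| * euclNorm x ^ ((σ - B) * p - α)) *
          ENNReal.ofReal (bdryDist x ξ ^ (-D)) := by
          refine lintegral_mono_ae ((ae_restrict_iff' (hms x)).2 ?_)
          filter_upwards [hae] with ξ hξ hξN
          have hξ0 := norm_pos_iff.2 hξ
          have hρ := bdryDist_pos hx ξ
          have hξN' : bdryDist x ξ < ‖ξ‖ / 2 := hξN
          refine (mul_le_mul_left (hup ξ hξ) _).trans ?_
          rw [mul_assoc, mul_assoc, ← ENNReal.ofReal_mul (by positivity),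
            ← ENNReal.ofReal_mul (by positivity)]
          refine mul_le_mul_right (ENNReal.ofReal_le_ofReal ?_) _
          have h3 := Real.rpow_le_of_comparable hx0 one_le_two (N := ‖ξ‖)
            (by linarith [euclNorm_le_add x ξ]) (by linarith [norm_le_add x ξ]) ((σ - B) * p - α)
          calc ‖ξ‖ ^ ((σ - B) * p) * (bdryDist x ξ ^ (-D) * ‖ξ‖ ^ (-α))
              = ‖ξ‖ ^ ((σ - B) * p) * ‖ξ‖ ^ (-α) * bdryDist x ξ ^ (-D) := by ring
            _ = ‖ξ‖ ^ ((σ - B) * p - α) * bdryDist x ξ ^ (-D) := by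
                rw [← Real.rpow_add hξ0, ← sub_eq_add_neg]
            _ ≤ _ := by gcongr
      _ ≤ ∫⁻ ξ in {ξ : Boundary n | bdryDist x ξ < euclNorm x},
          C ^ p * ENNReal.ofReal (2 ^ |(σ - B) * p - α| * euclNorm x ^ ((σ - B) * p - α)) *
          ENNReal.ofReal (bdryDist x ξ ^ (-D)) := lintegral_mono_set hsub
      _ ≤ C ^ p * ENNReal.ofReal (2 ^ |(σ - B) * p - α| * euclNorm x ^ ((σ - B) * p - α)) *
          (E * ENNReal.ofReal (euclNorm x ^ ((n : ℝ) - 1 - D))) := by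
          rw [lintegral_const_mul' _ _ (ENNReal.mul_ne_top hCp (by simp))]
          gcongr
          exact hball volume (fun ξ : Boundary n => bdryDist x ξ) (measurable_bdryDist_right x)
            (fun r hr => volume_bdryDist_lt_le (by omega) x hr) _ hx0
      _ = C ^ p * ENNReal.ofReal (2 ^ |(σ - B) * p - α|) * E *
          (ENNReal.ofReal (euclNorm x ^ ((σ - B) * p - α)) *
            ENNReal.ofReal (euclNorm x ^ ((n : ℝ) - 1 - D))) := by
          rw [ENNReal.ofReal_mul (by positivity)]; ring
      _ = _ := by
          rw [← ENNReal.ofReal_mul (by positivity), ← Real.rpow_add hx0, hexp]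
  have hx0' : Tendsto (fun x : Ambient n => euclNorm x) (𝓝[upperHalf n] 0) (𝓝 0) := by
    have h5 := (continuous_euclNorm (n := n)).tendsto 0
    have h6 : euclNorm (0 : Ambient n) = 0 := by simp [euclNorm]
    rw [h6] at h5
    exact h5.mono_left nhdsWithin_le_nhds
  have hmain : Tendsto (fun x : Ambient n => ∫⁻ ξ, k x ξ) (𝓝[upperHalf n] 0)
      (𝓝 (∫⁻ ξ, k₀ ξ)) := by
    refine tendsto_lintegral_of_dominated_off (c := ENNReal.ofReal (2 ^ D)) (by simp) hkm hms ?_ hfin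
      ?_ ?_ ?_
    · filter_upwards [self_mem_nhdsWithin] with x hx
      filter_upwards [hae] with ξ hξ hξN
      have hξ0 := norm_pos_iff.2 hξ
      have hρ := bdryDist_pos hx ξ
      have hξN' : ‖ξ‖ / 2 ≤ bdryDist x ξ := not_lt.1 hξN
      rw [hk₀' ξ hξ, hk]
      simp only
      rw [mul_left_comm, ← ENNReal.ofReal_mul (by positivity), ← mul_assoc]
      gcongr
      have h4 := Real.rpow_le_rpow_of_nonpos (by positivity) hξN' (z := -D) (by linarith)
      refine h4.trans_eq ?_
      rw [div_eq_inv_mul, Real.mul_rpow (by norm_num) hξ0.le, Real.inv_rpow (by norm_num),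
        Real.rpow_neg (by norm_num : (0 : ℝ) ≤ 2), inv_inv]
    · have hE' : C ^ p * ENNReal.ofReal (2 ^ |(σ - B) * p - α|) * E ≠ ∞ :=
        ENNReal.mul_ne_top (ENNReal.mul_ne_top hCp ENNReal.ofReal_ne_top) hE
      have hz := tendsto_const_mul_ofReal_rpow_zero hE' (sub_pos.2 hσ) hx0'
      refine tendsto_of_tendsto_of_tendsto_of_le_of_le' tendsto_const_nhds hz
        (Eventually.of_forall fun _ => zero_le) ?_
      filter_upwards [self_mem_nhdsWithin] with x hx
      exact hnear x hx
    · filter_upwards [hae] with ξ hξ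
      have hξ0 := norm_pos_iff.2 hξ
      rw [hk₀' ξ hξ]
      refine ENNReal.Tendsto.const_mul (ENNReal.tendsto_ofReal ?_) (Or.inr
        (ne_top_of_le_ne_top (ENNReal.mul_ne_top hCp (by simp)) (hup ξ hξ)))
      refine Tendsto.mul_const _ ?_
      have h3 : Tendsto (fun x : Ambient n => bdryDist x ξ) (𝓝[upperHalf n] 0) (𝓝 ‖ξ‖) := by
        have h5 := (continuous_bdryDist_left ξ).tendsto 0
        have h6 : bdryDist (0 : Ambient n) ξ = ‖ξ‖ := by simp [bdryDist]
        rw [h6] at h5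
        exact h5.mono_left nhdsWithin_le_nhds
      exact h3.rpow_const (Or.inl hξ0.ne')
    · filter_upwards [hae] with ξ hξ
      have hξ0 := norm_pos_iff.2 hξ
      filter_upwards [hx0'.eventually_lt_const (show 0 < ‖ξ‖ / 2 by linarith)] with x hx
      refine not_lt.2 ?_
      linarith [norm_le_add x ξ]
  refine hmain.congr' ?_
  filter_upwards [self_mem_nhdsWithin] with x hx
  rw [huv.mul_euclNorm_rpow_div_eq hx]

end IsPositiveSolution

/-! ### Choice of exponents and conclusion -/

theorem theorem1p8 (n : ℕ) (hn : 3 ≤ n) (α β γ p₀ q₀ : ℝ)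
    (hγ : 2 ≤ γ) (hγn : γ < n) (hα : 0 ≤ α) (hβ : 0 ≤ β) (hp₀ : 1 < p₀) (hq₀ : 1 < q₀)
    (hscale : ((n : ℝ) - 1) / n * (1 / (p₀ + 1)) + 1 / (q₀ + 1) = (n + α + β + 1 - γ) / n)
    (u : Boundary n → ℝ≥0∞) (v : Ambient n → ℝ≥0∞)
    (huv : IsPositiveSolution α β γ p₀ q₀ u v) :
    (1 / q₀ - (n + 1 + β - γ) / (q₀ * n) > (β - 1) / n →
      (∫⁻ x in upperHalf n,
          v x ^ q₀ * ENNReal.ofReal (x.2 / euclNorm x ^ ((n : ℝ) + 2 - γ + β))) < ∞ ∧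
      Tendsto (fun ξ : Boundary n => u ξ * ENNReal.ofReal (‖ξ‖ ^ α)) (𝓝[≠] 0)
        (𝓝 (∫⁻ x in upperHalf n,
          v x ^ q₀ * ENNReal.ofReal (x.2 / euclNorm x ^ ((n : ℝ) + 2 - γ + β))))) ∧
    (1 / p₀ - (n + 2 + α - γ) / (p₀ * ((n : ℝ) - 1)) > α / ((n : ℝ) - 1) →
      (∫⁻ ξ : Boundary n,
          u ξ ^ p₀ * ENNReal.ofReal (1 / ‖ξ‖ ^ ((n : ℝ) + 2 - γ + α))) < ∞ ∧
      Tendsto (fun x : Ambient n => v x * ENNReal.ofReal (euclNorm x ^ β / x.2))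
        (𝓝[upperHalf n] 0)
        (𝓝 (∫⁻ ξ : Boundary n,
          u ξ ^ p₀ * ENNReal.ofReal (1 / ‖ξ‖ ^ ((n : ℝ) + 2 - γ + α))))) := by
  have hn2 : 2 ≤ n := by omega
  have hn3 : (3 : ℝ) ≤ n := by exact_mod_cast hn
  have hn0 : (0 : ℝ) < n := by linarith
  have hn1 : (0 : ℝ) < (n : ℝ) - 1 := by linarith
  have hp1 : 0 < p₀ + 1 := by linarith
  have hq1 : 0 < q₀ + 1 := by linarith
  have hp0 : 0 < p₀ := by linarith
  have hq0 : 0 < q₀ := by linarith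
  obtain ⟨A, hAdef⟩ : ∃ A : ℝ, A = n / (q₀ + 1) := ⟨_, rfl⟩
  obtain ⟨B, hBdef⟩ : ∃ B : ℝ, B = ((n : ℝ) - 1) / (p₀ + 1) := ⟨_, rfl⟩
  have hA : A * (q₀ + 1) = n := by rw [hAdef, div_mul_cancel₀ _ hq1.ne']
  have hB : B * (p₀ + 1) = (n : ℝ) - 1 := by rw [hBdef, div_mul_cancel₀ _ hp1.ne']
  have hAB : A + B = n + α + β + 1 - γ := by
    rw [eq_div_iff hn0.ne'] at hscale
    rw [← hscale, hAdef, hBdef]; field_simp; ring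
  obtain ⟨δ₁, h1⟩ : ∃ δ₁ : ℝ, δ₁ = A - β + 1 := ⟨_, rfl⟩
  obtain ⟨δ₂, h2⟩ : ∃ δ₂ : ℝ, δ₂ = B - α := ⟨_, rfl⟩
  have hD : δ₁ + δ₂ = (n : ℝ) + 2 - γ := by linarith
  have hδ₂ : 0 < δ₂ := by
    have := huv.alpha_lt hn2 hγn hα hp0 hq0
    rw [← hB] at this
    linarith [lt_of_mul_lt_mul_right this hp1.le]
  -- The lower bound at infinity gives `B < α + D`, that is `δ₂ < D = δ₁ + δ₂`.
  have hδ₁ : 0 < δ₁ := by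
    have := huv.lt_alpha_add hn2 hγn hα hp0 hq0
    rw [← hB] at this
    linarith [lt_of_mul_lt_mul_right this hp1.le]
  have hsys := huv.scaledSystem hp0 hq0 hn2 hA hB h1 h2 hD
  have hdec : ∀ σ : ℝ, 0 < σ → σ < δ₁ → σ < δ₂ → ∃ C : ℝ≥0∞, C ≠ ∞ ∧
      (∀ ξ, ξ ≠ 0 → u ξ ≤ C * ENNReal.ofReal (‖ξ‖ ^ (σ - B))) ∧
      ∀ x ∈ upperHalf n, v x ≤ C * ENNReal.ofReal (euclNorm x ^ (σ - A)) := by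
    intro σ h0 hσ₁ hσ₂
    obtain ⟨C, hC, hf, hg⟩ := hsys.exists_decay hn2 hδ₁ hδ₂ (by linarith) (by linarith) hp₀ hq₀
      (by rw [← hAdef, ← hBdef]; linarith) h0 hσ₁ hσ₂
    exact ⟨C, hC, fun ξ hξ => ENNReal.le_of_mul_ofReal_rpow_le (norm_pos_iff.2 hξ) (hf ξ hξ),
      fun x hx => ENNReal.le_of_mul_ofReal_rpow_le (euclNorm_pos hx) (hg x hx)⟩
  refine ⟨fun hi => ?_, fun hii => ?_⟩
  -- After clearing denominators the hypothesis reads `q₀(β-1) < γ - 1 - β`, and `q₀δ₁ - δ₂ = γ - 1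
  -- - β - q₀(β-1)`.
  · have hcond : δ₂ < q₀ * δ₁ := by
      have h3 : (β - 1) / n * (q₀ * n) < (1 / q₀ - (n + 1 + β - γ) / (q₀ * n)) * (q₀ * n) :=
        mul_lt_mul_of_pos_right hi (by positivity)
      have e1 : (β - 1) / n * (q₀ * n) = q₀ * (β - 1) := by field_simp
      have e2 : (1 / q₀ - (n + 1 + β - γ) / (q₀ * n)) * (q₀ * n) = n - (n + 1 + β - γ) := by
        field_simp
      rw [e1, e2] at h3
      rw [h1]
      nlinarith
    -- The interval is nonempty: `δ₂/q₀ < δ₁` is the hypothesis of (i), and `δ₂/q₀ < δ₂` holds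
    -- because `q₀ > 1`.
    obtain ⟨σ, hσ, hσ'⟩ : ∃ σ, δ₂ / q₀ < σ ∧ σ < min δ₁ δ₂ := exists_between (lt_min
      (by rw [div_lt_iff₀ hq0]; linarith) (div_lt_self hδ₂ hq₀))
    have hσ0 : 0 < σ := lt_trans (by positivity) hσ
    obtain ⟨C, hC, hu, hv⟩ := hdec σ hσ0 (hσ'.trans_le (min_le_left _ _))
      (hσ'.trans_le (min_le_right _ _))
    rw [div_lt_iff₀ hq0, mul_comm] at hσ
    exact huv.tendsto_boundary hn2 hγ hγn hq0 hδ₁ hδ₂ hA h1 hD hσ0 hσ hC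
      (fun ξ hξ => ne_top_of_le_ne_top (ENNReal.mul_ne_top hC (by simp)) (hu ξ hξ)) hv
  -- The hypothesis reads `p₀α < γ - 3 - α`, and `p₀δ₂ - δ₁ = γ - 3 - α - p₀α`.
  · have hcond : δ₁ < p₀ * δ₂ := by
      have h3 : α / ((n : ℝ) - 1) * (p₀ * ((n : ℝ) - 1)) <
          (1 / p₀ - (n + 2 + α - γ) / (p₀ * ((n : ℝ) - 1))) * (p₀ * ((n : ℝ) - 1)) :=
        mul_lt_mul_of_pos_right hii (by positivity)
      have e1 : α / ((n : ℝ) - 1) * (p₀ * ((n : ℝ) - 1)) = p₀ * α := by field_simp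
      have e2 : (1 / p₀ - (n + 2 + α - γ) / (p₀ * ((n : ℝ) - 1))) * (p₀ * ((n : ℝ) - 1)) =
          (n : ℝ) - 1 - (n + 2 + α - γ) := by field_simp
      rw [e1, e2] at h3
      rw [h2]
      nlinarith
    -- `δ₁ + δ₂ < (p₀+1)δ₂ ≤ (p₀+1)B = n - 1`, using `α ≥ 0`.
    have hDn : δ₁ + δ₂ < (n : ℝ) - 1 := by
      have h3 : 0 ≤ p₀ * α := by positivity
      rw [← hB]
      rw [h2] at hcond ⊢
      nlinarith
    obtain ⟨σ, hσ, hσ'⟩ : ∃ σ, δ₁ / p₀ < σ ∧ σ < min δ₁ δ₂ := exists_between (lt_min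
      (div_lt_self hδ₁ hp₀) (by rw [div_lt_iff₀ hp0]; linarith))
    have hσ0 : 0 < σ := lt_trans (by positivity) hσ
    obtain ⟨C, hC, hu, hv⟩ := hdec σ hσ0 (hσ'.trans_le (min_le_left _ _))
      (hσ'.trans_le (min_le_right _ _))
    rw [div_lt_iff₀ hp0, mul_comm] at hσ
    exact huv.tendsto_half hn2 hp0 hB h2 hD (by linarith) hDn hσ hC
      (fun x hx => ne_top_of_le_ne_top (ENNReal.mul_ne_top hC (by simp)) (hv x hx)) hu
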